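/- **Setting.** Let $d\ge 1$ and let $\mathcal X\subseteq\mathbb R^d$ be compact and convex, contain the ball of radius $r>0$ around the origin, and have diameter at most $D_x$. Let $\Xi$ be a metric space and let $J:\mathcal X\times\Xi\to\mathbb R$ be a cost function with $|J|\le U$ that is $L_0$-Lipschitz in $x$ for every $\xi$, $L_0$-Lipschitz in $\xi$ for every $x$, and $m$-strongly convex in $x$ for every $\xi$ ($U,L_0,m>0$). For a risk level $\alpha\in(0,1]$ and a distribution function $F$ let $\mathrm{CVaR}_\alpha[F]=\frac1\alpha\int_{1-\alpha}^1F^{-1}(p)\,dp$ with $F^{-1}(p)=\inf\{y:F(y)\ge p\}$, the mean of the worst $\alpha$-fraction of the outcomes. Let $\mathcal D_1,\dots,\mathcal D_T$ be Borel probability measures on $\Xi$, let $C_t(x)=\mathrm{CVaR}_\alpha[J(x,\xi)]$ for $\xi\sim\mathcal D_t$, and let $x_t^*$ minimize $C_t$ over $\mathcal X$. Assume the variation budget $\sum_{t=2}^TW_1(\mathcal D_{t-1},\mathcal D_t)\le V_D$ with $V_D>0$, where $W_1(\mu,\nu)$ is the supremum of $\mathbb E_\mu f-\mathbb E_\nu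 f$ over the 1-Lipschitz functions $f$ that are integrable for both. **Algorithm.** Let $\delta\in(0,r)$, let $\Delta_T\ge 1$ be an integer batch size, let $\mathcal X^\delta=\{x\in\mathcal X:\frac1{1-\delta/r}x\in\mathcal X\}$, and start at $x_1\in\mathcal X^\delta$. In iteration $t=1,\dots,T$ let $j=\lceil t/\Delta_T\rceil$ and $\tau=t-(j-1)\Delta_T$, draw $u_t$ uniformly from the unit sphere, play $\hat x_t=x_t+\delta u_t$, draw $n_t=\phi(\tau)\ge1$ samples $\xi_t^i\sim\mathcal D_t$ (all $u_t$, $\xi_t^i$ are independent), let $\hat F_t$ be the empirical distribution function of $J(\hat x_t,\xi_t^1),\dots,J(\hat x_t,\xi_t^{n_t})$, let $\hat g_t=\frac d\delta\mathrm{CVaR}_\alpha[\hat F_t]\,u_t$, and let $x_{t+1}$ be the Euclidean projection of $x_t-\eta_t\hat g_t$ onto $\mathcal X^\delta$, where $\eta_t=\frac1{m\tau}$. The sampling numbers satisfy $\sum_{\tau=1}^{\Delta_T}\phi(\tau)^{-1/2}\le c\,\Delta_T^{1-a/2}$ with constants $a,c>0$. The dynamic regret is $\mathrm{DR}(T)=\sum_{t=1}^TC_t(\hat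 x_t)-\sum_{t=1}^TC_t(x_t^*)$. **Theorem.** There are constants $K>0$ and $p\in\mathbb N$ that depend only on $d,\alpha,U,L_0,D_x,r,m,c,a$ such that the following holds for all such data and every $\gamma\in(0,1)$. 1. If $a\in(0,\frac43]$, $\delta=(V_D/T)^{\frac a{4+a}}<r$, $(T/V_D)^{\frac4{4+a}}\in(1,T)$, and $\Delta_T$ is $(T/V_D)^{\frac4{4+a}}$ rounded up or down to an integer, then with probability at least $1-\gamma$ $$\mathrm{DR}(T)\le K\Big(\ln\frac{2T}\gamma\Big)^p\,T^{\frac4{4+a}}V_D^{\frac a{4+a}}.$$ 2. If $a>\frac43$, $\delta=(V_D/T)^{\frac14}<r$, $(T/V_D)^{\frac34}\in(1,T)$, and $\Delta_T$ is $(T/V_D)^{\frac34}$ rounded up or down to an integer, then with probability at least $1-\gamma$ $$\mathrm{DR}(T)\le K\Big(\ln\frac{2T}\gamma\Big)^p\,T^{\frac34}V_D^{\frac14}.$$ -/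

import Mathlib

open MeasureTheory ProbabilityTheory
open scoped ENNReal

namespace RiskAverse

noncomputable section

/-- The space `ℝ^d` with the Euclidean norm. -/
abbrev Vec (d : ℕ) : Type := EuclideanSpace ℝ (Fin d)

/-- The unit sphere of `ℝ^d`. -/
abbrev UnitSphere (d : ℕ) : Type := Metric.sphere (0 : Vec d) 1

/-- The uniform probability distribution on the unit sphere of `ℝ^d` (normalized surface
measure). -/
def sphereUniform (d : ℕ) : Measure (UnitSphere d) :=
  ((volume : Measure (Vec d)).toSphere Set.univ)⁻¹ • (volume : Measure (Vec d)).toSphere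

/-- A minimizer of `f` over the set `s` (an arbitrary point if there is none). -/
def argmin {d : ℕ} (s : Set (Vec d)) (f : Vec d → ℝ) : Vec d :=
  Classical.epsilon fun y => y ∈ s ∧ ∀ z ∈ s, f y ≤ f z

/-- Projection onto `s`: the minimizer over `y ∈ s` of `‖x - y‖ ^ 2`. -/
def proj {d : ℕ} (s : Set (Vec d)) (x : Vec d) : Vec d :=
  argmin s fun y => ‖x - y‖ ^ 2

/-- The value at risk (generalized inverse) `F⁻¹(p) = inf {y : F y ≥ p}` of a cumulative
distribution function `F`. -/
def valueAtRisk (F : ℝ → ℝ) (p : ℝ) : ℝ := sInf {y | p ≤ F y}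

/-- Conditional value at risk: the expectation of the worst (largest) `α`-fraction of the outcomes
of a random variable with cumulative distribution function `F`, that is, the average of the values
at risk over the levels in `(1 - α, 1]`. -/
def cvar (α : ℝ) (F : ℝ → ℝ) : ℝ := α⁻¹ * ∫ p in (1 - α)..1, valueAtRisk F p

/-- The cumulative distribution function of `J (x, ξ)` for `ξ ∼ μ`. -/
def costCDF {d : ℕ} {Ξ : Type*} [MeasurableSpace Ξ] (J : Vec d → Ξ → ℝ) (μ : Measure Ξ)
    (x : Vec d) (y : ℝ) : ℝ :=
  cdf (μ.map (J x)) y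

/-- The risk-averse objective `C(x) = CVaR_α [J (x, ξ)]`, `ξ ∼ μ`. -/
def cvarCost {d : ℕ} {Ξ : Type*} [MeasurableSpace Ξ] (α : ℝ) (J : Vec d → Ξ → ℝ)
    (μ : Measure Ξ) (x : Vec d) : ℝ :=
  cvar α (costCDF J μ x)

/-- The empirical distribution function of the values `z 1, …, z n`. -/
def empiricalCDF (n : ℕ) (z : ℕ → ℝ) (y : ℝ) : ℝ :=
  (1 / (n : ℝ)) * ∑ i ∈ Finset.Icc 1 n, Set.indicator {v : ℝ | v ≤ y} (fun _ => (1 : ℝ)) (z i)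

/-- The Wasserstein distance `W₁`, in its Kantorovich–Rubinstein form: the supremum of
`E_μ f - E_ν f` over all 1-Lipschitz functions `f` with finite expectations. -/
def wasserstein {Ξ : Type*} [MetricSpace Ξ] [MeasurableSpace Ξ] (μ ν : Measure Ξ) : ℝ≥0∞ :=
  ⨆ (f : Ξ → ℝ) (_ : LipschitzWith 1 f) (_ : Integrable f μ) (_ : Integrable f ν),
    ENNReal.ofReal (∫ ξ, f ξ ∂μ - ∫ ξ, f ξ ∂ν)

/-- The distribution variation `∑_{t=2}^T W₁(D_{t-1}, D_t)`. -/
def distributionVariation {Ξ : Type*} [MetricSpace Ξ] [MeasurableSpace Ξ] (D : ℕ → Measure Ξ)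
    (T : ℕ) : ℝ≥0∞ :=
  ∑ t ∈ Finset.Icc 2 T, wasserstein (D (t - 1)) (D t)

/-- The shrunken set `X^δ = {x ∈ X : x / (1 - δ / r) ∈ X}`. -/
def shrink {d : ℕ} (X : Set (Vec d)) (r δ : ℝ) : Set (Vec d) :=
  {x | x ∈ X ∧ (1 / (1 - δ / r)) • x ∈ X}

/-- The batch `⌈t / Δ⌉` of iteration `t`, for batches of length `Δ`. -/
def batch (Δ t : ℕ) : ℕ := ⌈(t : ℝ) / (Δ : ℝ)⌉₊

/-- The epoch `t - (j - 1) Δ` of iteration `t ≥ 1` inside its batch `j`. -/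
def epoch (Δ t : ℕ) : ℕ := t - (batch Δ t - 1) * Δ

/-- The parameters of the learning algorithm: admissible set, radius of the ball it contains, risk
level, smoothing parameter, batch size, sampling numbers `φ` and learning rates `σ` (both functions
of the epoch), and the initial action. -/
structure Params (d : ℕ) where
  X : Set (Vec d)
  r : ℝ
  α : ℝ
  δ : ℝ
  Δ : ℕ
  φ : ℕ → ℕ
  σ : ℕ → ℝ
  x₀ : Vec d

namespace Params

variable {d : ℕ} {Ξ : Type*}

/-- The gradient estimate `(d / δ) CVaR_α [F̂_t] u_t`, where `F̂_t` is the empirical distribution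
function of the `n_t = φ (τ)` sampled costs `J (x̂_t, ξ_t^i)` at the action `x̂_t = x_t + δ u_t`. -/
def gradEstimate (A : Params d) (J : Vec d → Ξ → ℝ) (t : ℕ) (x u : Vec d) (ξ : ℕ → Ξ) : Vec d :=
  (((d : ℝ) / A.δ) *
    cvar A.α (empiricalCDF (A.φ (epoch A.Δ t)) fun i => J (x + A.δ • u) (ξ i))) • u

/-- The iterates `x_t` of the algorithm with restarts, for given directions `u_t` and given noise
samples `ξ_t^i`. The first iteration, `t = 1`, starts at the initial action, and
`x_{t+1}` is the projection onto `X^δ` of `x_t - η_t ĝ_t`, `η_t = σ (τ)`. The sampling number and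
the learning rate are reset at the beginning of every batch, the action is kept. -/
def iterate (A : Params d) (J : Vec d → Ξ → ℝ) (u : ℕ → Vec d) (ξ : ℕ → ℕ → Ξ) : ℕ → Vec d
  | 0 => A.x₀
  | 1 => A.x₀
  | t + 2 =>
    proj (shrink A.X A.r A.δ)
      (iterate A J u ξ (t + 1) - A.σ (epoch A.Δ (t + 1)) •
        A.gradEstimate J (t + 1) (iterate A J u ξ (t + 1)) (u (t + 1)) (ξ (t + 1)))

/-- The action `x̂_t = x_t + δ u_t` played at iteration `t`. -/
def action (A : Params d) (J : Vec d → Ξ → ℝ) (u : ℕ → Vec d) (ξ : ℕ → ℕ → Ξ) (t : ℕ) : Vec d :=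
  A.iterate J u ξ t + A.δ • u t

/-- The dynamic regret `∑_{t=1}^T C_t(x̂_t) - ∑_{t=1}^T C_t(x_t^*)`, where `x_t^*` minimizes
`C_t = CVaR_α [J (·, ξ)]`, `ξ ∼ D_t`, over the admissible set. -/
def dynamicRegret [MeasurableSpace Ξ] (A : Params d) (J : Vec d → Ξ → ℝ) (D : ℕ → Measure Ξ)
    (T : ℕ) (u : ℕ → Vec d) (ξ : ℕ → ℕ → Ξ) : ℝ :=
  ∑ t ∈ Finset.Icc 1 T, cvarCost A.α J (D t) (A.action J u ξ t) -
    ∑ t ∈ Finset.Icc 1 T, cvarCost A.α J (D t) (argmin A.X (cvarCost A.α J (D t)))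

end Params

/-- The conditions on the admissible set: it is compact and convex, contains the ball of radius `r`
around the origin, and has diameter at most `Dx`. -/
structure AdmissibleSet {d : ℕ} (X : Set (Vec d)) (r Dx : ℝ) : Prop where
  isCompact : IsCompact X
  convex : Convex ℝ X
  ball_subset : Metric.closedBall 0 r ⊆ X
  diam_le : Metric.diam X ≤ Dx

/-- The conditions on the cost: it is bounded by `U`, is `L₀`-Lipschitz in the decision and in the
noise, and is `m`-strongly convex in the decision. -/
structure AdmissibleCost {d : ℕ} {Ξ : Type*} [MetricSpace Ξ] (X : Set (Vec d))
    (J : Vec d → Ξ → ℝ) (U L₀ m : ℝ) : Prop where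
  bounded : ∀ x ∈ X, ∀ ξ, |J x ξ| ≤ U
  lipschitz_decision : ∀ ξ, ∀ x ∈ X, ∀ y ∈ X, |J x ξ - J y ξ| ≤ L₀ * ‖x - y‖
  lipschitz_noise : ∀ x ∈ X, ∀ ξ ζ, |J x ξ - J x ζ| ≤ L₀ * dist ξ ζ
  strongConvexOn : ∀ ξ, StrongConvexOn X m fun x => J x ξ

/-- The random inputs of the algorithm: the directions `u_t` are uniform on the unit sphere, the
noise samples `ξ_t^i` have distribution `D_t`, and all of them are mutually independent. -/
structure RandomInputs {d : ℕ} {Ξ Ω : Type*} [MeasurableSpace Ξ] [MeasurableSpace Ω]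
    (P : Measure Ω) (D : ℕ → Measure Ξ) (u : ℕ → Ω → UnitSphere d) (ξ : ℕ → ℕ → Ω → Ξ) :
    Prop where
  measurable_direction : ∀ t, Measurable (u t)
  measurable_noise : ∀ t i, Measurable (ξ t i)
  law_direction : ∀ t, P.map (u t) = sphereUniform d
  law_noise : ∀ t i, P.map (ξ t i) = D t
  indep : iIndep (fun k : ℕ ⊕ ℕ × ℕ => Sum.elim
    (fun t => MeasurableSpace.comap (u t) inferInstance)
    (fun q => MeasurableSpace.comap (ξ q.1 q.2) inferInstance) k) P

/-- `n` is the real number `x`, rounded up or down to an integer. -/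
def IsRounding (n : ℕ) (x : ℝ) : Prop := n = ⌊x⌋₊ ∨ n = ⌈x⌉₊

/-- The sampling requirement `∑_{τ=1}^Δ 1 / √φ(τ) ≤ c Δ^(1 - a/2)`, with at least one sample in
every epoch. -/
def SamplingRequirement (φ : ℕ → ℕ) (Δ : ℕ) (c a : ℝ) : Prop :=
  (∀ τ ∈ Finset.Icc 1 Δ, 1 ≤ φ τ) ∧
    ∑ τ ∈ Finset.Icc 1 Δ, 1 / √(φ τ : ℝ) ≤ c * (Δ : ℝ) ^ (1 - a / 2)

end

end RiskAverse

/-!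
The CVaR of a random variable `Z` with values in `[-B, B]` and distribution function `F` is
`-B + α⁻¹ ∫ y in (-B, B], min (1 - F y) α` (`IsBoundedCDF.cvar_eq`). Two consequences carry the
analysis of the objective. Choosing where to switch between the two arguments of the minimum gives
the Rockafellar–Uryasev formula `CVaR = min_ν (ν + α⁻¹ E (Z - ν)₊)`, from which the objective
`C_t` inherits from the cost the Lipschitz property, strong convexity, and a Lipschitz dependence on
the distribution in `W₁`. And CVaR is `α⁻¹`-Lipschitz for the `L¹` distance of distribution
functions, so the empirical CVaR of `n` samples has mean absolute error at most
`2 U / (α √n)` (`integral_abs_cvar_empiricalCDF_sub_le`).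

Consequently the mean of the gradient estimate, given the iterate `x`, satisfies
`⟪E g, x - y⟫ ≥ C x - C y + (m / 2) ‖x - y‖² - error` (`le_integral_inner_gradEstimate`). Apart
from the sampling error, this says that strong convexity survives one-point smoothing
(`le_integral_sphere`). As `C` is merely Lipschitz and the divergence theorem is not at hand for
balls, the ball is approximated by radial cutoffs, integrated in polar coordinates.

The fluctuations of `⟪g_t, x_t - y_t⟫` around their conditional means are bounded by
`B ‖x_t - y_t‖` with `B = d U / δ`. An exponential supermartingale with parameter `m / (2 B²)`
therefore controls their sum by `(2 B² / m) log (1 / γ)` plus `(m / 4) ∑ ‖x_t - y_t‖²`, half of the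
strong convexity term (`one_sub_le_linearized`). The comparators `y_t` have to be deterministic and
constant within a batch: `y_t` minimizes over the shrunken set the objective at the beginning of the
batch. Online gradient descent with steps `1 / (m τ)` has linearized regret
`(m / 2) ∑ ‖x_t - y_t‖² + (B² / (2 m)) ∑ 1 / τ_t` without any cost of restarting, because its
potential `(m / 2) (τ - 1) ‖x_t - y_t‖²` vanishes at the start of a batch
(`sum_inner_gradEstimate_le`). What remains is `(m / 4) ∑ ‖x_t - y_t‖²`, and quadratic growth of the
objective around its minimizer `y_t` bounds it by half of the regret, up to the drift of the
objectives within the batch; the total drift is at most `(L₀ / α) Δ V` (`dynamicRegret_le`).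

All told the regret is of the order `T δ + Δ V + log (2 T / γ) T / (Δ δ²) + T / (δ Δ ^ (a / 2))`.
With `δ = (V / T) ^ s` and `Δ ≈ (T / V) ^ (1 - s)` the first two terms are equal, and they dominate
the other two, up to constants and the logarithm, when `s ≤ 1 / 4` and `4 s ≤ (1 - s) a`
(`regret_bound`).
The largest such `s` is the minimum of `a / (4 + a)` and `1 / 4`, which is the first one exactly if
`a ≤ 4 / 3`. A single power of the logarithm suffices.
-/

namespace RiskAverse

open Set Filter Topology
open scoped RealInnerProductSpace

/-! ### Smoothing over the sphere -/

/-- The radial cutoff that is `1` on the ball of radius `δ - ε`, `0` outside the ball of radius `δ`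
and affine in the norm in between. -/
noncomputable def cutoff {E : Type*} [NormedAddCommGroup E] (δ ε : ℝ) (z : E) : ℝ :=
  min 1 (max 0 ((δ - ‖z‖) / ε))

section Cutoff

variable {E : Type*} [NormedAddCommGroup E] {δ ε : ℝ}

lemma cutoff_nonneg (z : E) : 0 ≤ cutoff δ ε z := le_min zero_le_one (le_max_left _ _)

lemma cutoff_le_one (z : E) : cutoff δ ε z ≤ 1 := min_le_left _ _

lemma cutoff_of_le (hε : 0 < ε) {z : E} (hz : ‖z‖ ≤ δ - ε) : cutoff δ ε z = 1 := by
  refine min_eq_left ((?_ : (1 : ℝ) ≤ _).trans (le_max_right _ _))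
  rw [le_div_iff₀ hε]; linarith

lemma cutoff_of_ge (hε : 0 < ε) {z : E} (hz : δ ≤ ‖z‖) : cutoff δ ε z = 0 := by
  have h : (δ - ‖z‖) / ε ≤ 0 := div_nonpos_of_nonpos_of_nonneg (by linarith) hε.le
  simp [cutoff, max_eq_left h]

lemma cutoff_of_mem (hε : 0 < ε) {z : E} (hz₁ : δ - ε ≤ ‖z‖) (hz₂ : ‖z‖ ≤ δ) :
    cutoff δ ε z = (δ - ‖z‖) / ε := by
  have h₀ : 0 ≤ (δ - ‖z‖) / ε := div_nonneg (by linarith) hε.le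
  have h₁ : (δ - ‖z‖) / ε ≤ 1 := by rw [div_le_one hε]; linarith
  simp [cutoff, max_eq_right h₀, min_eq_right h₁]

lemma lipschitzWith_cutoff (hε : 0 < ε) :
    LipschitzWith (Real.toNNReal ε⁻¹) (cutoff δ ε : E → ℝ) := by
  have h : LipschitzWith (Real.toNNReal ε⁻¹) fun z : E => (δ - ‖z‖) / ε := by
    refine LipschitzWith.of_dist_le_mul fun z z' => ?_
    rw [Real.coe_toNNReal _ (by positivity), Real.dist_eq, ← sub_div, abs_div, abs_of_pos hε,
      div_eq_inv_mul]
    gcongr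
    rw [sub_sub_sub_cancel_left, dist_comm, dist_eq_norm]
    exact abs_norm_sub_norm_le _ _
  exact (h.const_max 0).const_min 1

end Cutoff

lemma lineDeriv_cutoff {E : Type*} [NormedAddCommGroup E] [InnerProductSpace ℝ E] {δ ε : ℝ}
    (hε : 0 < ε) (hεδ : ε < δ) {z : E} (hz₁ : ‖z‖ ≠ δ - ε) (hz₂ : ‖z‖ ≠ δ) (w : E) :
    lineDeriv ℝ (cutoff δ ε) z w =
      if δ - ε < ‖z‖ ∧ ‖z‖ < δ then -(⟪‖z‖⁻¹ • z, w⟫ / ε) else 0 := by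
  have hc : Continuous fun z : E => ‖z‖ := continuous_norm
  have key : ∀ f : E → ℝ, cutoff δ ε =ᶠ[𝓝 z] f →
      lineDeriv ℝ (cutoff δ ε) z w = lineDeriv ℝ f z w := fun f hf => hf.lineDeriv_eq
  split_ifs with h
  · have hz : z ≠ 0 := by
      rintro rfl
      simp at h; linarith
    have hev : cutoff δ ε =ᶠ[𝓝 z] fun z => (δ - ‖z‖) / ε := by
      filter_upwards [(isOpen_lt continuous_const hc).mem_nhds h.1,
        (isOpen_lt hc continuous_const).mem_nhds h.2] with y hy₁ hy₂
      exact cutoff_of_mem hε (le_of_lt hy₁) (le_of_lt hy₂)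
    rw [key _ hev]
    have hd : HasFDerivAt (fun y : E => ‖y‖) (‖z‖⁻¹ • innerSL ℝ z) z := by
      have h1 : HasFDerivAt (fun y : E => ‖y‖ ^ 2) (2 • innerSL ℝ z) z := by
        simpa using (hasStrictFDerivAt_norm_sq z).hasFDerivAt
      have h2 := h1.sqrt (by positivity)
      simp only [Real.sqrt_sq (norm_nonneg _)] at h2
      convert h2 using 1
      ext v
      simp
      field_simp
    simp only [div_eq_mul_inv]
    have hd' := ((hd.const_sub δ).mul_const ε⁻¹).hasLineDerivAt w
    rw [hd'.lineDeriv]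
    simp [inner_smul_left]
    ring
  · rcases lt_or_gt_of_ne hz₁ with h1 | h1
    · have hev : cutoff δ ε =ᶠ[𝓝 z] fun _ => 1 := by
        filter_upwards [(isOpen_lt hc continuous_const).mem_nhds h1] with y hy
        exact cutoff_of_le hε (le_of_lt hy)
      rw [key _ hev]; simp [lineDeriv]
    · have h2 : δ < ‖z‖ := lt_of_le_of_ne (not_lt.1 fun h2 => h ⟨h1, h2⟩) hz₂.symm
      have hev : cutoff δ ε =ᶠ[𝓝 z] fun _ => 0 := by
        filter_upwards [(isOpen_lt continuous_const hc).mem_nhds h2] with y hy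
        exact cutoff_of_ge hε (le_of_lt hy)
      rw [key _ hev]; simp [lineDeriv]

/-- Integration of a positively homogeneous function of degree `0` over a ball, in polar
coordinates. -/
lemma integral_ball_direction {E : Type*} [NormedAddCommGroup E] [InnerProductSpace ℝ E]
    [FiniteDimensional ℝ E] [Nontrivial E] [MeasurableSpace E] [BorelSpace E] (μ : Measure E)
    [μ.IsAddHaarMeasure] (f : E → ℝ) {R : ℝ} (hR : 0 < R) :
    ∫ z in Metric.ball 0 R, f (‖z‖⁻¹ • z) ∂μ =
      R ^ Module.finrank ℝ E / Module.finrank ℝ E *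
        ∫ v : Metric.sphere (0 : E) 1, f v ∂μ.toSphere := by
  have hpos : 0 < Module.finrank ℝ E := Module.finrank_pos
  rw [← integral_indicator measurableSet_ball]
  calc ∫ z, (Metric.ball (0 : E) R).indicator (fun z => f (‖z‖⁻¹ • z)) z ∂μ
      = ∫ z : ({(0)}ᶜ : Set E),
          (Metric.ball (0 : E) R).indicator (fun z => f (‖z‖⁻¹ • z)) z ∂(μ.comap (↑)) := by
        rw [integral_subtype_comap (measurableSet_singleton _).compl, restrict_compl_singleton]
    _ = ∫ p : Metric.sphere (0 : E) 1 × Ioi (0 : ℝ),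
          f p.1 * (Iio (⟨R, hR⟩ : Ioi (0 : ℝ))).indicator (fun _ => (1 : ℝ)) p.2
          ∂(μ.toSphere.prod (.volumeIoiPow (Module.finrank ℝ E - 1))) := by
        rw [← μ.measurePreserving_homeomorphUnitSphereProd.integral_comp
          (Homeomorph.measurableEmbedding _)]
        refine integral_congr_ae (.of_forall fun z => ?_)
        simp only [indicator, Metric.mem_ball, dist_zero_right, mem_Iio, ← Subtype.coe_lt_coe,
          homeomorphUnitSphereProd_apply_snd_coe, homeomorphUnitSphereProd_apply_fst_coe]
        split_ifs <;> simp
    _ = _ := by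
        rw [integral_prod_mul (fun v : Metric.sphere (0 : E) 1 => f v),
          integral_indicator_const _ measurableSet_Iio, measureReal_def,
          Measure.volumeIoiPow_apply_Iio, ENNReal.toReal_ofReal (by positivity), mul_comm]
        rw [Nat.sub_add_cancel hpos, Nat.cast_pred hpos]
        simp

section Smoothing

variable {E : Type*} [NormedAddCommGroup E] [InnerProductSpace ℝ E]
    [FiniteDimensional ℝ E] [MeasurableSpace E] [BorelSpace E] (μ : Measure E)
    [μ.IsAddHaarMeasure] {X : Set E} {h : E → ℝ} {L m δ ε : ℝ} {x y : E}

/-- The derivative at `x` in direction `x - y` of the convolution of `h` with a cutoff dominates the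
strong convexity increment of `h` between `y` and `x`, up to the smoothing error. -/
lemma mul_integral_cutoff_le (hX : IsCompact X) (hh : ContinuousOn h X)
    (hL : ∀ a ∈ X, ∀ b ∈ X, |h a - h b| ≤ L * ‖a - b‖) (hL₀ : 0 ≤ L)
    (hconv : StrongConvexOn X m h) (hε : 0 < ε)
    (hx : Metric.closedBall x δ ⊆ X) (hy : Metric.closedBall y δ ⊆ X) :
    (h x - h y + m / 2 * ‖x - y‖ ^ 2 - 2 * L * δ) * ∫ z, cutoff δ ε z ∂μ ≤
      -∫ z, lineDeriv ℝ (cutoff δ ε) z (x - y) * X.indicator h (x + z) ∂μ := by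
  set w := x - y with hw
  set χ : E → ℝ := cutoff δ ε with hχ
  set g : E → ℝ := fun z => X.indicator h (x + z) with hg
  have hint : Integrable (X.indicator h) μ :=
    (integrable_indicator_iff hX.measurableSet).2 (hh.integrableOn_compact hX)
  have hgi : Integrable g μ := hint.comp_add_left x
  have hχc : Continuous χ := (lipschitzWith_cutoff hε).continuous
  have hχs : HasCompactSupport χ := by
    refine HasCompactSupport.of_support_subset_isCompact (isCompact_closedBall (0 : E) δ) ?_
    intro z hz
    by_contra hz'
    rw [mem_closedBall_zero_iff, not_le] at hz'
    exact hz (cutoff_of_ge hε hz'.le)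
  have hχi : Integrable χ μ := hχc.integrable_of_hasCompactSupport hχs
  -- `hlim` moves the derivative of the convolution onto the cutoff, as `h` need not be smooth
  have hbd : ∀ z, ‖χ z‖ ≤ 1 := fun z => by
    rw [Real.norm_eq_abs, abs_of_nonneg (cutoff_nonneg z)]; exact cutoff_le_one z
  have hlim := (lipschitzWith_cutoff (E := E) (δ := δ) hε
    ).integral_inv_smul_sub_mul_tendsto_integral_lineDeriv_mul (μ := μ) hgi w
  have hlim2 : Tendsto (fun t : ℝ => -((h x - h y + m / 2 * ‖w‖ ^ 2 - 2 * L * δ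
      - m / 2 * t * ‖w‖ ^ 2) * ∫ z, χ z ∂μ)) (𝓝[>] 0)
      (𝓝 (-((h x - h y + m / 2 * ‖w‖ ^ 2 - 2 * L * δ) * ∫ z, χ z ∂μ))) := by
    have : Continuous (fun t : ℝ => -((h x - h y + m / 2 * ‖w‖ ^ 2 - 2 * L * δ
      - m / 2 * t * ‖w‖ ^ 2) * ∫ z, χ z ∂μ)) := by fun_prop
    have h0 := this.tendsto 0
    simp only [mul_zero, zero_mul, sub_zero] at h0
    exact h0.mono_left nhdsWithin_le_nhds
  have := le_of_tendsto_of_tendsto hlim hlim2 ?_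
  · linarith
  filter_upwards [Ioo_mem_nhdsGT (zero_lt_one' ℝ)] with t ht
  have hgt : Integrable (fun z => g (z - t • w)) μ := hgi.comp_sub_right (t • w)
  have hi1 : Integrable (fun z => χ (z + t • w) * g z) μ :=
    hgi.bdd_mul (hχc.comp (by fun_prop : Continuous fun z => z + t • w)).aestronglyMeasurable
      (.of_forall fun z => hbd _)
  have hi2 : Integrable (fun z => χ z * g z) μ :=
    hgi.bdd_mul hχc.aestronglyMeasurable (.of_forall hbd)
  have hi3 : Integrable (fun z => χ z * g (z - t • w)) μ :=
    hgt.bdd_mul hχc.aestronglyMeasurable (.of_forall hbd)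
  have e1 : ∫ z, (t⁻¹ • (χ (z + t • w) - χ z)) * g z ∂μ =
      ∫ z, t⁻¹ * (χ z * g (z - t • w) - χ z * g z) ∂μ := by
    have h1 : ∫ z, χ (z + t • w) * g z ∂μ = ∫ z, χ z * g (z - t • w) ∂μ := by
      rw [← integral_add_right_eq_self (μ := μ) (fun z => χ z * g (z - t • w)) (t • w)]
      simp
    have h2 : (fun z => (t⁻¹ • (χ (z + t • w) - χ z)) * g z) =
        fun z => t⁻¹ * (χ (z + t • w) * g z - χ z * g z) := by
      ext z; simp only [smul_eq_mul]; ring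
    rw [h2, integral_const_mul, integral_const_mul, integral_sub hi1 hi2, integral_sub hi3 hi2, h1]
  rw [e1, ← integral_const_mul, ← integral_neg]
  refine integral_mono ((hi3.sub hi2).const_mul _) (hχi.const_mul _).neg fun z => ?_
  simp only
  by_cases hz : ‖z‖ < δ
  · have hxz : x + z ∈ X := hx (by simpa using hz.le)
    have hyz : y + z ∈ X := hy (by simpa using hz.le)
    have hcx := hconv.2 hxz hyz (by linarith [ht.2] : 0 ≤ 1 - t) ht.1.le (by ring)
    have hpt : (1 - t) • (x + z) + t • (y + z) = x + (z - t • w) := by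
      rw [hw]; module
    have hmem : x + (z - t • w) ∈ X := by
      rw [← hpt]; exact hconv.1 hxz hyz (by linarith [ht.2]) ht.1.le (by ring)
    rw [hpt] at hcx
    have hg1 : g z = h (x + z) := indicator_of_mem hxz h
    have hg2 : g (z - t • w) = h (x + (z - t • w)) := indicator_of_mem hmem h
    have hxX : x ∈ X := hx (Metric.mem_closedBall_self ((norm_nonneg z).trans hz.le))
    have hyX : y ∈ X := hy (Metric.mem_closedBall_self ((norm_nonneg z).trans hz.le))
    have l1 := abs_le.1 (hL _ hxz _ hxX)
    have l2 := abs_le.1 (hL _ hyz _ hyX)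
    have hzL : L * ‖z‖ ≤ L * δ := by gcongr
    simp only [add_sub_cancel_left] at l1 l2
    have hnorm : x + z - (y + z) = w := by rw [hw]; abel
    simp only [hnorm, smul_eq_mul] at hcx
    have hmain : t⁻¹ * (g (z - t • w) - g z) ≤ -(h x - h y + m / 2 * ‖w‖ ^ 2 - 2 * L * δ
        - m / 2 * t * ‖w‖ ^ 2) := by
      rw [inv_mul_le_iff₀ ht.1, hg1, hg2]
      have : t * (h (y + z) - h (x + z)) ≤ t * (-(h x - h y) + 2 * L * δ) :=
        mul_le_mul_of_nonneg_left (by linarith) ht.1.le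
      nlinarith
    have := mul_le_mul_of_nonneg_left hmain (cutoff_nonneg (δ := δ) (ε := ε) z)
    simp only [hχ] at this ⊢
    nlinarith
  · have : χ z = 0 := cutoff_of_ge hε (not_lt.1 hz)
    simp [this]

/-- The derivative of the cutoff lives on the shell `δ - ε < ‖z‖ < δ`; the two bounding spheres are
null sets. -/
lemma integral_lineDeriv_cutoff_mul [Nontrivial E] (g : E → ℝ) (w : E) (hε : 0 < ε) (hεδ : ε < δ) :
    -∫ z, lineDeriv ℝ (cutoff δ ε) z w * g z ∂μ =
      ε⁻¹ * ∫ z in Metric.ball 0 δ \ Metric.ball 0 (δ - ε), ⟪‖z‖⁻¹ • z, w⟫ * g z ∂μ := by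
  rw [← integral_indicator (measurableSet_ball.diff measurableSet_ball), ← integral_const_mul,
    ← integral_neg]
  refine integral_congr_ae ?_
  have h1 : ∀ᵐ z ∂μ, z ∉ Metric.sphere (0 : E) (δ - ε) :=
    measure_eq_zero_iff_ae_notMem.1 (Measure.addHaar_sphere μ 0 _)
  have h2 : ∀ᵐ z ∂μ, z ∉ Metric.sphere (0 : E) δ :=
    measure_eq_zero_iff_ae_notMem.1 (Measure.addHaar_sphere μ 0 _)
  filter_upwards [h1, h2] with z hz1 hz2
  rw [mem_sphere_zero_iff_norm] at hz1 hz2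
  rw [lineDeriv_cutoff hε hεδ hz1 hz2]
  simp only [indicator, Set.mem_sdiff, Metric.mem_ball, dist_zero_right, not_lt]
  have : (δ - ε < ‖z‖ ∧ ‖z‖ < δ) ↔ (‖z‖ < δ ∧ δ - ε ≤ ‖z‖) :=
    ⟨fun h => ⟨h.2, h.1.le⟩, fun h => ⟨lt_of_le_of_ne h.2 (Ne.symm hz1), h.1⟩⟩
  simp only [this]
  split_ifs
  · ring
  · simp

/-- Strong convexity survives one-point smoothing. For smooth `h` the left-hand side is, by the
divergence theorem, the derivative at `x` in direction `x - y` of the average of `h` over the ball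
of radius `δ`; here the ball is replaced by radial cutoffs that converge to it. -/
theorem le_integral_sphere [Nontrivial E] (hX : IsCompact X) (hh : ContinuousOn h X)
    (hL : ∀ a ∈ X, ∀ b ∈ X, |h a - h b| ≤ L * ‖a - b‖) (hL₀ : 0 ≤ L)
    (hconv : StrongConvexOn X m h) (hδ : 0 < δ)
    (hx : Metric.closedBall x δ ⊆ X) (hy : Metric.closedBall y δ ⊆ X) :
    (h x - h y + m / 2 * ‖x - y‖ ^ 2 - 2 * L * δ) * μ.toSphere.real univ ≤
      Module.finrank ℝ E / δ *
        ∫ v : Metric.sphere (0 : E) 1, h (x + δ • (v : E)) * ⟪(v : E), x - y⟫ ∂μ.toSphere := by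
  set w := x - y with hw
  set κ := h x - h y + m / 2 * ‖w‖ ^ 2 - 2 * L * δ with hκ
  set n := Module.finrank ℝ E with hn
  have hnpos : 0 < n := Module.finrank_pos
  set v₁ := μ.real (Metric.ball (0 : E) 1) with hv₁
  have hv₁0 : 0 ≤ v₁ := measureReal_nonneg
  set G := ∫ v : Metric.sphere (0 : E) 1, h (x + δ • (v : E)) * ⟪(v : E), w⟫ ∂μ.toSphere with hG
  have hvol : ∀ R, 0 ≤ R → μ.real (Metric.ball (0 : E) R) = R ^ n * v₁ := fun R hR => by
    rw [hv₁, measureReal_def, Measure.addHaar_ball _ _ hR, ENNReal.toReal_mul,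
      ENNReal.toReal_ofReal (by positivity), measureReal_def]
  have hxX : x ∈ X := hx (Metric.mem_closedBall_self hδ.le)
  have hmemX : ∀ z : E, ‖z‖ ≤ δ → x + z ∈ X := fun z hz => hx (by simpa using hz)
  -- the inequality for each cutoff
  have key : ∀ ε ∈ Ioo 0 δ, κ * (δ ^ n * v₁) ≤
      ((δ ^ n - (δ - ε) ^ n) / ε) / n * G +
        (L * ‖w‖ + |κ|) * (v₁ * (δ ^ n - (δ - ε) ^ n)) := by
    intro ε ⟨hε, hεδ⟩
    have h1 := mul_integral_cutoff_le μ hX hh hL hL₀ hconv hε hx hy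
    rw [integral_lineDeriv_cutoff_mul μ _ _ hε hεδ, ← hw, ← hκ] at h1
    set A := Metric.ball (0 : E) δ \ Metric.ball 0 (δ - ε) with hA
    have hAm : MeasurableSet A := measurableSet_ball.diff measurableSet_ball
    have hsub : Metric.ball (0 : E) (δ - ε) ⊆ Metric.ball 0 δ :=
      Metric.ball_subset_ball (by linarith)
    have hAvol : μ.real A = v₁ * (δ ^ n - (δ - ε) ^ n) := by
      rw [hA, measureReal_sdiff hsub measurableSet_ball, hvol _ hδ.le, hvol _ (by linarith)]; ring
    have hAfin : μ A ≠ ⊤ := ((measure_mono sdiff_subset).trans_lt measure_ball_lt_top).ne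
    -- the mass of the cutoff
    have hχ : κ * (δ ^ n * v₁) - |κ| * μ.real A ≤ κ * ∫ z, cutoff δ ε z ∂μ := by
      have hχc : Continuous (cutoff δ ε : E → ℝ) := (lipschitzWith_cutoff hε).continuous
      have hind : ∀ R, ∫ z, (Metric.ball (0 : E) R).indicator (fun _ => (1 : ℝ)) z ∂μ =
          μ.real (Metric.ball 0 R) := fun R => by
        rw [integral_indicator_const _ measurableSet_ball]; simp
      have hii : ∀ R, Integrable ((Metric.ball (0 : E) R).indicator (fun _ => (1 : ℝ))) μ :=
        fun R => (integrable_indicator_iff measurableSet_ball).2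
          (integrableOn_const measure_ball_lt_top.ne)
      have hle : ∀ z : E,
          cutoff δ ε z ≤ (Metric.ball (0 : E) δ).indicator (fun _ => (1 : ℝ)) z := by
        intro z
        by_cases hz : z ∈ Metric.ball (0 : E) δ
        · rw [indicator_of_mem hz]; exact cutoff_le_one z
        · rw [indicator_of_notMem hz]
          exact (cutoff_of_ge hε (by simpa using hz)).le
      have hge : ∀ z : E,
          (Metric.ball (0 : E) (δ - ε)).indicator (fun _ => (1 : ℝ)) z ≤ cutoff δ ε z := by
        intro z
        by_cases hz : z ∈ Metric.ball (0 : E) (δ - ε)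
        · rw [indicator_of_mem hz]
          exact (cutoff_of_le hε (by simpa using (mem_ball_zero_iff.1 hz).le)).ge
        · rw [indicator_of_notMem hz]; exact cutoff_nonneg z
      have hχi : Integrable (cutoff δ ε : E → ℝ) μ :=
        (hii δ).mono' hχc.aestronglyMeasurable (.of_forall fun z => by
          rw [Real.norm_eq_abs, abs_of_nonneg (cutoff_nonneg z)]; exact hle z)
      have b1 := integral_mono hχi (hii δ) hle
      have b2 := integral_mono (hii (δ - ε)) hχi hge
      rw [hind, hvol _ hδ.le] at b1
      rw [hind, hvol _ (by linarith)] at b2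
      have b3 : |κ * (∫ z, cutoff δ ε z ∂μ - δ ^ n * v₁)| ≤ |κ| * μ.real A := by
        rw [abs_mul]
        gcongr
        rw [abs_le, hAvol]
        constructor <;> nlinarith
      have := (abs_le.1 b3).1
      linarith
    -- the shell integral
    set f : E → ℝ := fun v => h (x + δ • v) * ⟪v, w⟫ with hf
    have hdir : ∀ z ∈ A, z ≠ 0 := by
      rintro z hz rfl
      exact hz.2 (Metric.mem_ball_self (by linarith))
    have hnu : ∀ z ∈ A, ‖‖z‖⁻¹ • z‖ = 1 := fun z hz => by
      rw [norm_smul, norm_inv, norm_norm, inv_mul_cancel₀ (norm_ne_zero_iff.2 (hdir z hz))]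
    have hFc : ContinuousOn (fun z => f (‖z‖⁻¹ • z)) A := by
      have hd : ContinuousOn (fun z : E => ‖z‖⁻¹ • z) A :=
        (continuous_norm.continuousOn.inv₀ fun z hz => norm_ne_zero_iff.2 (hdir z hz)).smul
          continuousOn_id
      have : ContinuousOn (fun z : E => h (x + δ • (‖z‖⁻¹ • z))) A := by
        refine hh.comp (by fun_prop) fun z hz => hmemX _ ?_
        rw [norm_smul, hnu z hz, mul_one, Real.norm_of_nonneg hδ.le]
      exact this.mul (hd.inner continuousOn_const)
    obtain ⟨M, hM⟩ : ∃ M, ∀ a ∈ X, |h a| ≤ M := by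
      obtain ⟨M, hM⟩ := hX.exists_bound_of_continuousOn hh
      exact ⟨M, hM⟩
    have hMx : 0 ≤ M := (abs_nonneg _).trans (hM x hxX)
    have hfb : ∀ v : E, ‖v‖ = 1 → |f v| ≤ M * ‖w‖ := fun v hv => by
      rw [hf, abs_mul]
      refine mul_le_mul (hM _ (hmemX _ ?_)) ?_ (abs_nonneg _) hMx
      · rw [norm_smul, hv, mul_one, Real.norm_of_nonneg hδ.le]
      · simpa [hv] using abs_real_inner_le_norm v w
    have hFi : IntegrableOn (fun z => f (‖z‖⁻¹ • z)) A μ := by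
      refine Integrable.mono' (integrableOn_const (C := M * ‖w‖) hAfin)
        (hFc.aestronglyMeasurable hAm) ?_
      filter_upwards [ae_restrict_mem hAm] with z hz using hfb _ (hnu z hz)
    have hint : Integrable (fun z => X.indicator h (x + z)) μ :=
      ((integrable_indicator_iff hX.measurableSet).2 (hh.integrableOn_compact hX)).comp_add_left x
    have hGi : IntegrableOn (fun z => ⟪‖z‖⁻¹ • z, w⟫ * X.indicator h (x + z)) A μ := by
      refine Integrable.bdd_mul (c := ‖w‖) hint.integrableOn ?_ ?_
      · refine ContinuousOn.aestronglyMeasurable ?_ hAm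
        exact ((continuous_norm.continuousOn.inv₀ fun z hz => norm_ne_zero_iff.2 (hdir z hz)).smul
          continuousOn_id).inner continuousOn_const
      · filter_upwards [ae_restrict_mem hAm] with z hz
        simpa [hnu z hz] using norm_inner_le_norm (𝕜 := ℝ) (‖z‖⁻¹ • z) w
    have hshell : ∫ z in A, ⟪‖z‖⁻¹ • z, w⟫ * X.indicator h (x + z) ∂μ ≤
        ∫ z in A, (f (‖z‖⁻¹ • z) + L * ε * ‖w‖) ∂μ := by
      refine setIntegral_mono_on hGi (hFi.add (integrableOn_const hAfin)) hAm fun z hz => ?_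
      have hzδ : ‖z‖ < δ := by simpa using hz.1
      have hzε : δ - ε ≤ ‖z‖ := by simpa using hz.2
      rw [indicator_of_mem (hmemX z hzδ.le)]
      have e1 : |h (x + z) - h (x + δ • (‖z‖⁻¹ • z))| ≤ L * ε := by
        refine (hL _ (hmemX z hzδ.le) _ (hmemX _ ?_)).trans ?_
        · rw [norm_smul, hnu z hz, mul_one, Real.norm_of_nonneg hδ.le]
        · gcongr
          have : x + z - (x + δ • (‖z‖⁻¹ • z)) = (‖z‖ - δ) • (‖z‖⁻¹ • z) := by
            rw [sub_smul, smul_inv_smul₀ (norm_ne_zero_iff.2 (hdir z hz))]; abel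
          rw [this, norm_smul, hnu z hz, mul_one, Real.norm_eq_abs, abs_le]
          constructor <;> linarith
      have e2 : |⟪‖z‖⁻¹ • z, w⟫| ≤ ‖w‖ := by
        simpa [hnu z hz] using abs_real_inner_le_norm (‖z‖⁻¹ • z) w
      have e3 : |(h (x + z) - h (x + δ • (‖z‖⁻¹ • z))) * ⟪‖z‖⁻¹ • z, w⟫| ≤ L * ε * ‖w‖ := by
        rw [abs_mul]
        exact mul_le_mul e1 e2 (abs_nonneg _) (by positivity)
      have := (abs_le.1 e3).2
      simp only [hf]
      linarith
    have hbi : ∀ R, 0 < R → ∫ z in Metric.ball 0 R, f (‖z‖⁻¹ • z) ∂μ = R ^ n / n * G :=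
      fun R hR => integral_ball_direction μ f hR
    have hballi : IntegrableOn (fun z => f (‖z‖⁻¹ • z)) (Metric.ball 0 δ) μ := by
      have hb : IntegrableOn (fun z => f (‖z‖⁻¹ • z)) (Metric.ball 0 δ \ {0}) μ := by
        have hm : MeasurableSet (Metric.ball (0 : E) δ \ {0}) :=
          measurableSet_ball.diff (measurableSet_singleton _)
        have hnz : ∀ z ∈ Metric.ball (0 : E) δ \ {0}, ‖z‖ ≠ 0 := fun z hz =>
          norm_ne_zero_iff.2 hz.2
        have hnu' : ∀ z ∈ Metric.ball (0 : E) δ \ {0}, ‖‖z‖⁻¹ • z‖ = 1 := fun z hz => by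
          rw [norm_smul, norm_inv, norm_norm, inv_mul_cancel₀ (hnz z hz)]
        have hd : ContinuousOn (fun z : E => ‖z‖⁻¹ • z) (Metric.ball (0 : E) δ \ {0}) :=
          (continuous_norm.continuousOn.inv₀ hnz).smul continuousOn_id
        have hc : ContinuousOn (fun z : E => h (x + δ • (‖z‖⁻¹ • z)))
            (Metric.ball (0 : E) δ \ {0}) := by
          refine hh.comp (by fun_prop) fun z hz => hmemX _ ?_
          rw [norm_smul, hnu' z hz, mul_one, Real.norm_of_nonneg hδ.le]
        refine Integrable.mono' (integrableOn_const (C := M * ‖w‖)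
          ((measure_mono sdiff_subset).trans_lt measure_ball_lt_top).ne)
          ((hc.mul (hd.inner continuousOn_const)).aestronglyMeasurable hm) ?_
        filter_upwards [ae_restrict_mem hm] with z hz using hfb _ (hnu' z hz)
      have hs : IntegrableOn (fun z => f (‖z‖⁻¹ • z)) {0} μ := integrableOn_singleton (by simp)
        (by rw [measure_singleton]; exact ENNReal.zero_lt_top)
      exact (hb.union hs).mono_set (by rw [sdiff_union_self]; exact subset_union_left)
    have hshell2 : ∫ z in A, f (‖z‖⁻¹ • z) ∂μ = (δ ^ n - (δ - ε) ^ n) / n * G := by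
      rw [hA, setIntegral_sdiff measurableSet_ball hballi hsub, hbi δ hδ,
        hbi (δ - ε) (by linarith)]
      ring
    rw [integral_add hFi (integrableOn_const hAfin), hshell2, setIntegral_const, smul_eq_mul]
      at hshell
    have hfin := mul_le_mul_of_nonneg_left hshell (inv_nonneg.2 hε.le)
    have hring : ε⁻¹ * ((δ ^ n - (δ - ε) ^ n) / n * G + μ.real A * (L * ε * ‖w‖)) =
        ((δ ^ n - (δ - ε) ^ n) / ε) / n * G + L * ‖w‖ * μ.real A := by
      field_simp
    rw [← hAvol]
    linarith
  -- the limit `ε → 0`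
  have hd : HasDerivAt (fun ε : ℝ => (δ - ε) ^ n) (-(n * δ ^ (n - 1))) 0 := by
    simpa using ((hasDerivAt_id (0 : ℝ)).const_sub δ).fun_pow n
  have hslope : Tendsto (fun ε : ℝ => (δ ^ n - (δ - ε) ^ n) / ε) (𝓝[>] 0)
      (𝓝 (n * δ ^ (n - 1))) := by
    have := (hasDerivAt_iff_tendsto_slope_zero.1 hd).neg.mono_left
      (nhdsWithin_mono _ (fun a (ha : 0 < a) => ha.ne'))
    simp only [neg_neg] at this
    refine this.congr fun ε => ?_
    simp only [zero_add, sub_zero, smul_eq_mul]; ring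
  have hcont : Tendsto (fun ε : ℝ => (L * ‖w‖ + |κ|) * (v₁ * (δ ^ n - (δ - ε) ^ n))) (𝓝[>] 0)
      (𝓝 0) := by
    have : Continuous fun ε : ℝ => (L * ‖w‖ + |κ|) * (v₁ * (δ ^ n - (δ - ε) ^ n)) := by fun_prop
    have h0 := this.tendsto 0
    simp only [sub_zero, sub_self, mul_zero] at h0
    exact h0.mono_left nhdsWithin_le_nhds
  have hfinal := ge_of_tendsto (((hslope.div_const (n : ℝ)).mul_const G).add hcont)
    (by filter_upwards [Ioo_mem_nhdsGT hδ] with ε hε using key ε hε)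
  have hn0 : (n : ℝ) ≠ 0 := by positivity
  rw [add_zero, mul_div_cancel_left₀ _ hn0] at hfinal
  have hpow : δ ^ n = δ ^ (n - 1) * δ := by rw [← pow_succ, Nat.sub_add_cancel hnpos]
  rw [hpow] at hfinal
  have hp : 0 < δ ^ (n - 1) := by positivity
  have h3 : κ * (δ * v₁) ≤ G := le_of_mul_le_mul_left (by linarith) hp
  rw [Measure.toSphere_real_apply_univ, div_mul_eq_mul_div, le_div_iff₀ hδ]
  calc κ * (n * v₁) * δ = n * (κ * (δ * v₁)) := by ring
    _ ≤ n * G := by gcongr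

end Smoothing

/-! ### CVaR as a truncated layer-cake integral -/

/-- The properties of the distribution function of a random variable with values in `[-B, B]` that
determine its CVaR. Right continuity is not needed, as it affects values at risk only on a null
set of levels. -/
structure IsBoundedCDF (F : ℝ → ℝ) (B : ℝ) : Prop where
  mono : Monotone F
  nonneg : ∀ y, 0 ≤ F y
  le_one : ∀ y, F y ≤ 1
  eq_zero : ∀ y < -B, F y = 0
  eq_one : ∀ y, B ≤ y → F y = 1

namespace IsBoundedCDF

variable {F G : ℝ → ℝ} {B α : ℝ}

lemma neg_le (hF : IsBoundedCDF F B) : -B ≤ B := by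
  by_contra! h
  have h1 := hF.eq_one ((B + -B) / 2) (by linarith)
  rw [hF.eq_zero ((B + -B) / 2) (by linarith)] at h1
  norm_num at h1

/-- Up to the null set `{valueAtRisk F p}`, the points of `(-B, B]` where `F < p` are those below
the value at risk. -/
lemma valueAtRisk_eq (hF : IsBoundedCDF F B) {p : ℝ} (hp : 0 < p) (hp1 : p ≤ 1) :
    valueAtRisk F p = -B + ∫ y in Ioc (-B) B, {y | F y < p}.indicator (fun _ => (1 : ℝ)) y := by
  set v := valueAtRisk F p with hv
  have hne : B ∈ {y | p ≤ F y} := by simp [hF.eq_one B le_rfl, hp1]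
  have hlow : ∀ y ∈ {y | p ≤ F y}, -B ≤ y := fun y hy => by
    by_contra! h
    have : p ≤ F y := hy
    rw [hF.eq_zero y h] at this
    linarith
  have hbdd : BddBelow {y | p ≤ F y} := ⟨-B, hlow⟩
  have hv1 : -B ≤ v := le_csInf ⟨B, hne⟩ hlow
  have hv2 : v ≤ B := csInf_le hbdd hne
  have hae : ∫ y in Ioc (-B) B, {y | F y < p}.indicator (fun _ => (1 : ℝ)) y =
      ∫ y in Ioc (-B) B, (Ioc (-B) v).indicator (fun _ => (1 : ℝ)) y := by
    refine setIntegral_congr_ae measurableSet_Ioc ?_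
    have : ∀ᵐ y : ℝ, y ≠ v := by
      simp [ae_iff, measure_singleton]
    filter_upwards [this] with y hy hyB
    simp only [indicator, mem_ofPred_eq, mem_Ioc]
    congr 1
    simp only [eq_iff_iff, hyB.1, true_and]
    constructor
    · intro h
      by_contra! h'
      obtain ⟨a, ha, hay⟩ := exists_lt_of_csInf_lt ⟨B, hne⟩ h'
      exact absurd ((show p ≤ F a from ha).trans (hF.mono hay.le)) (not_le.2 h)
    · intro h
      by_contra! h'
      exact hy (le_antisymm h (csInf_le hbdd h'))
  rw [hae, setIntegral_indicator measurableSet_Ioc, setIntegral_const, smul_eq_mul, mul_one,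
    Ioc_inter_Ioc, sup_idem, inf_eq_right.2 hv2, Real.volume_real_Ioc_of_le hv1]
  ring

lemma measurable (hF : IsBoundedCDF F B) : Measurable F := hF.mono.measurable

/-- CVaR as a layer-cake integral of the tail `1 - F`, truncated at the risk level. -/
theorem cvar_eq (hF : IsBoundedCDF F B) (hα : 0 < α) (hα1 : α ≤ 1) :
    cvar α F = -B + α⁻¹ * ∫ y in Ioc (-B) B, min (1 - F y) α := by
  have hB := hF.neg_le
  rw [cvar, intervalIntegral.integral_of_le (by linarith)]
  have h1 : ∫ p in Ioc (1 - α) 1, valueAtRisk F p = ∫ p in Ioc (1 - α) 1,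
      (-B + ∫ y in Ioc (-B) B, {y | F y < p}.indicator (fun _ => (1 : ℝ)) y) :=
    setIntegral_congr_fun measurableSet_Ioc fun p hp =>
      hF.valueAtRisk_eq (by linarith [hp.1]) hp.2
  have hmeas : MeasurableSet {q : ℝ × ℝ | F q.2 < q.1} :=
    measurableSet_lt (hF.measurable.comp measurable_snd) measurable_fst
  have hint : Integrable (Function.uncurry fun p y : ℝ => {y | F y < p}.indicator
      (fun _ => (1 : ℝ)) y) ((volume.restrict (Ioc (1 - α) 1)).prod
        (volume.restrict (Ioc (-B) B))) := by
    have : (Function.uncurry fun p y : ℝ => {y | F y < p}.indicator (fun _ => (1 : ℝ)) y) =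
        {q : ℝ × ℝ | F q.2 < q.1}.indicator fun _ => (1 : ℝ) := by
      ext ⟨p, y⟩; simp [indicator, Function.uncurry]
    rw [this]
    exact (integrable_const 1).indicator hmeas
  have hint' : Integrable (fun p : ℝ => ∫ y in Ioc (-B) B,
      {y | F y < p}.indicator (fun _ => (1 : ℝ)) y) (volume.restrict (Ioc (1 - α) 1)) :=
    hint.integral_prod_left
  rw [h1, integral_add (integrable_const _) hint',
    integral_integral_swap hint, setIntegral_const, smul_eq_mul,
    Real.volume_real_Ioc_of_le (by linarith)]
  have h2 : ∀ y, ∫ p in Ioc (1 - α) 1, {y | F y < p}.indicator (fun _ => (1 : ℝ)) y =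
      min (1 - F y) α := fun y => by
    have : (fun p => {y | F y < p}.indicator (fun _ => (1 : ℝ)) y) =
        (Ioi (F y)).indicator fun _ => (1 : ℝ) := by
      ext p; simp [indicator]
    rw [this, setIntegral_indicator measurableSet_Ioi, setIntegral_const, smul_eq_mul, mul_one,
      Ioc_inter_Ioi, Real.volume_real_Ioc_of_le (by
        simp only [sup_le_iff]; exact ⟨by linarith, hF.le_one y⟩)]
    rcases le_total (1 - α) (F y) with h | h
    · rw [sup_eq_right.2 h, min_eq_left (by linarith)]
    · rw [sup_eq_left.2 h, min_eq_right (by linarith)]; ring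
  simp only [h2]
  field_simp
  ring

lemma integrableOn (hF : IsBoundedCDF F B) (s : Set ℝ) (hs : volume s ≠ ⊤) :
    IntegrableOn (fun y => min (1 - F y) α) s := by
  refine Integrable.mono' (integrableOn_const (C := 1 + |α|) hs)
    ((measurable_const.sub hF.measurable).min measurable_const).aestronglyMeasurable
    (.of_forall fun y => ?_)
  rw [Real.norm_eq_abs, abs_le]
  have h1 := hF.nonneg y
  have h2 := hF.le_one y
  constructor
  · exact le_min (by linarith [abs_nonneg α]) (by linarith [neg_abs_le α])
  · exact (min_le_left _ _).trans (by linarith [abs_nonneg α])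

lemma integrableOn_tail (hF : IsBoundedCDF F B) (s : Set ℝ) (hs : volume s ≠ ⊤) :
    IntegrableOn (fun y => 1 - F y) s :=
  (hF.integrableOn (α := 1) s hs).congr (.of_forall fun y =>
    min_eq_left (by linarith [hF.nonneg y]))

lemma abs_cvar_sub_le (hF : IsBoundedCDF F B) (hG : IsBoundedCDF G B) (hα : 0 < α) (hα1 : α ≤ 1) :
    |cvar α F - cvar α G| ≤ α⁻¹ * ∫ y in Ioc (-B) B, |F y - G y| := by
  have hfin : volume (Ioc (-B) B) ≠ ⊤ := measure_Ioc_lt_top.ne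
  have hFi := hF.integrableOn (α := α) _ hfin
  have hGi := hG.integrableOn (α := α) _ hfin
  rw [hF.cvar_eq hα hα1, hG.cvar_eq hα hα1, add_sub_add_left_eq_sub, ← mul_sub,
    ← integral_sub hFi hGi, abs_mul, abs_of_pos (inv_pos.2 hα)]
  gcongr
  refine (abs_integral_le_integral_abs).trans (integral_mono (hFi.sub hGi).abs ?_ fun y => ?_)
  · refine (((hG.integrableOn_tail _ hfin).sub (hF.integrableOn_tail _ hfin)).abs).congr
      (.of_forall fun y => ?_)
    simp
  · have := abs_min_sub_min_le_max (1 - F y) α (1 - G y) α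
    simpa [abs_sub_comm] using this

lemma abs_cvar_le (hF : IsBoundedCDF F B) (hα : 0 < α) (hα1 : α ≤ 1) : |cvar α F| ≤ B := by
  have hfin : volume (Ioc (-B) B) ≠ ⊤ := measure_Ioc_lt_top.ne
  have h0 : 0 ≤ ∫ y in Ioc (-B) B, min (1 - F y) α :=
    setIntegral_nonneg measurableSet_Ioc fun y _ => le_min (by linarith [hF.le_one y]) hα.le
  have h1 : ∫ y in Ioc (-B) B, min (1 - F y) α ≤ ∫ y in Ioc (-B) B, α :=
    integral_mono (hF.integrableOn _ hfin) (integrableOn_const hfin) fun y => min_le_right _ _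
  rw [setIntegral_const, Real.volume_real_Ioc_of_le hF.neg_le, smul_eq_mul] at h1
  rw [hF.cvar_eq hα hα1, abs_le]
  have h2 : α⁻¹ * ∫ y in Ioc (-B) B, min (1 - F y) α ≤ α⁻¹ * ((B - -B) * α) := by gcongr
  have h3 : α⁻¹ * ((B - -B) * α) = 2 * B := by field_simp; ring
  have h4 : 0 ≤ α⁻¹ * ∫ y in Ioc (-B) B, min (1 - F y) α := by positivity
  constructor <;> linarith

/-- In the truncated tail `min (1 - F) α`, use the bound `α` up to `ν` and the bound `1 - F` beyond
it. -/
lemma cvar_le_tail (hF : IsBoundedCDF F B) (hα : 0 < α) (hα1 : α ≤ 1) {ν : ℝ}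
    (hν : ν ∈ Icc (-B) B) : cvar α F ≤ ν + α⁻¹ * ∫ y in Ioc ν B, (1 - F y) := by
  have hfin : ∀ a b : ℝ, volume (Ioc a b) ≠ ⊤ := fun _ _ => measure_Ioc_lt_top.ne
  rw [hF.cvar_eq hα hα1, ← Ioc_union_Ioc_eq_Ioc hν.1 hν.2,
    setIntegral_union (by rw [Ioc_disjoint_Ioc]; simp [hν.1, hν.2]) measurableSet_Ioc
      (hF.integrableOn _ (hfin _ _)) (hF.integrableOn _ (hfin _ _))]
  have h1 : ∫ y in Ioc (-B) ν, min (1 - F y) α ≤ ∫ y in Ioc (-B) ν, α :=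
    integral_mono (hF.integrableOn _ (hfin _ _)) (integrableOn_const (hfin _ _))
      fun y => min_le_right _ _
  have h2 : ∫ y in Ioc ν B, min (1 - F y) α ≤ ∫ y in Ioc ν B, (1 - F y) :=
    integral_mono (hF.integrableOn _ (hfin _ _)) (hF.integrableOn_tail _ (hfin _ _))
      fun y => min_le_left _ _
  rw [setIntegral_const, Real.volume_real_Ioc_of_le hν.1, smul_eq_mul] at h1
  have h3 : α⁻¹ * ((∫ y in Ioc (-B) ν, min (1 - F y) α) + ∫ y in Ioc ν B, min (1 - F y) α) ≤
      α⁻¹ * ((ν - -B) * α + ∫ y in Ioc ν B, (1 - F y)) := by gcongr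
  have h4 : α⁻¹ * ((ν - -B) * α + ∫ y in Ioc ν B, (1 - F y)) =
      ν + B + α⁻¹ * ∫ y in Ioc ν B, (1 - F y) := by field_simp; ring
  linarith

/-- Equality holds when `ν` is the value at risk at the level `1 - α`, where the truncation of the
tail stops being active. -/
lemma exists_cvar_eq_tail (hF : IsBoundedCDF F B) (hα : 0 < α) (hα1 : α ≤ 1) :
    ∃ ν ∈ Icc (-B) B, cvar α F = ν + α⁻¹ * ∫ y in Ioc ν B, (1 - F y) := by
  have hfin : ∀ a b : ℝ, volume (Ioc a b) ≠ ⊤ := fun _ _ => measure_Ioc_lt_top.ne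
  set S := {y | y ∈ Icc (-B) B ∧ 1 - α ≤ F y} with hS
  have hBS : B ∈ S := ⟨⟨hF.neg_le, le_rfl⟩, by rw [hF.eq_one B le_rfl]; linarith⟩
  have hbdd : BddBelow S := ⟨-B, fun y hy => hy.1.1⟩
  set ν := sInf S with hνdef
  have hν : ν ∈ Icc (-B) B := ⟨le_csInf ⟨B, hBS⟩ fun y hy => hy.1.1, csInf_le hbdd hBS⟩
  refine ⟨ν, hν, ?_⟩
  rw [hF.cvar_eq hα hα1, ← Ioc_union_Ioc_eq_Ioc hν.1 hν.2,
    setIntegral_union (by rw [Ioc_disjoint_Ioc]; simp [hν.1, hν.2]) measurableSet_Ioc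
      (hF.integrableOn _ (hfin _ _)) (hF.integrableOn _ (hfin _ _))]
  have h1 : ∫ y in Ioc (-B) ν, min (1 - F y) α = ∫ y in Ioc (-B) ν, α := by
    refine setIntegral_congr_ae measurableSet_Ioc ?_
    have : ∀ᵐ y : ℝ, y ≠ ν := by simp [ae_iff, measure_singleton]
    filter_upwards [this] with y hy hyB
    refine min_eq_right ?_
    by_contra! h
    exact hy (le_antisymm hyB.2 (csInf_le hbdd ⟨⟨hyB.1.le, hyB.2.trans hν.2⟩, by linarith⟩))
  have h2 : ∫ y in Ioc ν B, min (1 - F y) α = ∫ y in Ioc ν B, (1 - F y) := by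
    refine setIntegral_congr_fun measurableSet_Ioc fun y hy => min_eq_left ?_
    obtain ⟨a, ha, hay⟩ := exists_lt_of_csInf_lt ⟨B, hBS⟩ hy.1
    linarith [ha.2, hF.mono hay.le]
  rw [h1, h2, setIntegral_const, Real.volume_real_Ioc_of_le hν.1, smul_eq_mul]
  field_simp
  ring

end IsBoundedCDF

section RandomVariable

variable {Ξ : Type*} [MeasurableSpace Ξ] {μ : Measure Ξ} [IsProbabilityMeasure μ] {f : Ξ → ℝ}
  {B α : ℝ}

lemma cdf_map_apply (hf : Measurable f) (y : ℝ) : cdf (μ.map f) y = μ.real {ξ | f ξ ≤ y} := by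
  have := Measure.isProbabilityMeasure_map (μ := μ) hf.aemeasurable
  rw [cdf_eq_real, map_measureReal_apply hf measurableSet_Iic]
  rfl

lemma isBoundedCDF_cdf_map (hf : Measurable f) (hB : ∀ ξ, |f ξ| ≤ B) :
    IsBoundedCDF (cdf (μ.map f)) B where
  mono := monotone_cdf _
  nonneg := cdf_nonneg _
  le_one := cdf_le_one _
  eq_zero y hy := by
    rw [cdf_map_apply hf]
    have : {ξ | f ξ ≤ y} = ∅ := by
      ext ξ; simp only [mem_ofPred_eq, mem_empty_iff_false, iff_false, not_le]
      linarith [(abs_le.1 (hB ξ)).1]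
    simp [this]
  eq_one y hy := by
    rw [cdf_map_apply hf]
    have : {ξ | f ξ ≤ y} = univ := by
      ext ξ; simp only [mem_ofPred_eq, mem_univ, iff_true]
      linarith [(abs_le.1 (hB ξ)).2]
    simp [this]

/-- Layer-cake formula for the expected excess over `ν`. -/
lemma integral_tail_cdf_map (hf : Measurable f) (hB : ∀ ξ, |f ξ| ≤ B) (ν : ℝ) :
    ∫ y in Ioc ν B, (1 - cdf (μ.map f) y) = ∫ ξ, max (f ξ - ν) 0 ∂μ := by
  have hmeas : MeasurableSet {q : ℝ × Ξ | q.1 < f q.2} :=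
    measurableSet_lt measurable_fst (hf.comp measurable_snd)
  have hint : Integrable (Function.uncurry fun (y : ℝ) ξ => {ξ | y < f ξ}.indicator
      (fun _ => (1 : ℝ)) ξ) ((volume.restrict (Ioc ν B)).prod μ) := by
    have : (Function.uncurry fun (y : ℝ) ξ => {ξ | y < f ξ}.indicator (fun _ => (1 : ℝ)) ξ) =
        {q : ℝ × Ξ | q.1 < f q.2}.indicator fun _ => (1 : ℝ) := by
      ext ⟨p, y⟩; simp [indicator, Function.uncurry]
    rw [this]
    exact (integrable_const 1).indicator hmeas
  have h1 : ∀ y, 1 - cdf (μ.map f) y = ∫ ξ, {ξ | y < f ξ}.indicator (fun _ => (1 : ℝ)) ξ ∂μ := by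
    intro y
    have hm : MeasurableSet {ξ | f ξ ≤ y} := measurableSet_le hf measurable_const
    rw [cdf_map_apply hf, integral_indicator_const _ (measurableSet_lt measurable_const hf),
      ← probReal_compl_eq_one_sub hm, smul_eq_mul, mul_one]
    congr 1
    ext ξ; simp
  simp only [h1]
  rw [integral_integral_swap hint]
  congr 1 with ξ
  have : (fun y => {ξ | y < f ξ}.indicator (fun _ => (1 : ℝ)) ξ) =
      (Iio (f ξ)).indicator fun _ => (1 : ℝ) := by ext; simp [indicator]
  rw [this, setIntegral_indicator measurableSet_Iio, setIntegral_const, smul_eq_mul, mul_one]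
  have h2 : Ioc ν B ∩ Iio (f ξ) = Ioo ν (f ξ) := by
    ext y
    simp only [mem_inter_iff, mem_Ioc, mem_Iio, mem_Ioo]
    exact ⟨fun h => ⟨h.1.1, h.2⟩, fun h => ⟨⟨h.1, by linarith [(abs_le.1 (hB ξ)).2, h.2]⟩, h.2⟩⟩
  rw [h2, measureReal_def, Real.volume_Ioo, ENNReal.toReal_ofReal']

/-- The Rockafellar–Uryasev bound: every threshold `ν` gives an upper bound on CVaR. -/
theorem cvar_le_excess (hf : Measurable f) (hB : ∀ ξ, |f ξ| ≤ B) (hα : 0 < α) (hα1 : α ≤ 1)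
    (ν : ℝ) : cvar α (cdf (μ.map f)) ≤ ν + α⁻¹ * ∫ ξ, max (f ξ - ν) 0 ∂μ := by
  have hB' : ∀ ξ, |f ξ| ≤ max B |ν| := fun ξ => (hB ξ).trans (le_max_left _ _)
  rw [← integral_tail_cdf_map hf hB']
  exact (isBoundedCDF_cdf_map hf hB').cvar_le_tail hα hα1
    (abs_le.1 (le_max_right B |ν|))

/-- The Rockafellar–Uryasev bound is attained. -/
theorem exists_cvar_eq_excess (hf : Measurable f) (hB : ∀ ξ, |f ξ| ≤ B) (hα : 0 < α)
    (hα1 : α ≤ 1) :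
    ∃ ν, cvar α (cdf (μ.map f)) = ν + α⁻¹ * ∫ ξ, max (f ξ - ν) 0 ∂μ := by
  obtain ⟨ν, -, h⟩ := (isBoundedCDF_cdf_map (μ := μ) hf hB).exists_cvar_eq_tail hα hα1
  exact ⟨ν, by rw [← integral_tail_cdf_map hf hB, h]⟩

lemma integrable_excess (hf : Measurable f) (hB : ∀ ξ, |f ξ| ≤ B) (ν : ℝ) :
    Integrable (fun ξ => max (f ξ - ν) 0) μ := by
  refine Integrable.of_bound (C := B + |ν|)
    ((hf.sub_const ν).max measurable_const).aestronglyMeasurable (.of_forall fun ξ => ?_)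
  rw [Real.norm_eq_abs, abs_of_nonneg (le_max_right _ _)]
  refine max_le ?_ ?_ <;> linarith [(abs_le.1 (hB ξ)).2, neg_abs_le ν, abs_nonneg ν,
    (abs_nonneg _).trans (hB ξ)]

end RandomVariable

/-! ### The risk-averse objective and empirical CVaR -/

section Objective

variable {d : ℕ} {Ξ : Type*} [MetricSpace Ξ] {X : Set (Vec d)} {J : Vec d → Ξ → ℝ}
  {U L₀ m α : ℝ}

lemma AdmissibleCost.continuous_noise (hJ : AdmissibleCost X J U L₀ m) {x : Vec d} (hx : x ∈ X) :
    Continuous (J x) := by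
  refine (LipschitzWith.of_dist_le' (K := L₀) fun ξ ζ => ?_).continuous
  rw [Real.dist_eq]
  exact hJ.lipschitz_noise x hx ξ ζ

variable [MeasurableSpace Ξ] [BorelSpace Ξ] {μ : Measure Ξ} [IsProbabilityMeasure μ]

lemma AdmissibleCost.measurable_noise (hJ : AdmissibleCost X J U L₀ m) {x : Vec d} (hx : x ∈ X) :
    Measurable (J x) :=
  (hJ.continuous_noise hx).measurable

lemma cvarCost_le (hJ : AdmissibleCost X J U L₀ m) (hα : 0 < α) (hα1 : α ≤ 1) {x : Vec d}
    (hx : x ∈ X) (ν : ℝ) : cvarCost α J μ x ≤ ν + α⁻¹ * ∫ ξ, max (J x ξ - ν) 0 ∂μ :=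
  cvar_le_excess (hJ.measurable_noise hx) (hJ.bounded x hx) hα hα1 ν

lemma exists_cvarCost_eq (hJ : AdmissibleCost X J U L₀ m) (hα : 0 < α) (hα1 : α ≤ 1) {x : Vec d}
    (hx : x ∈ X) : ∃ ν, cvarCost α J μ x = ν + α⁻¹ * ∫ ξ, max (J x ξ - ν) 0 ∂μ :=
  exists_cvar_eq_excess (hJ.measurable_noise hx) (hJ.bounded x hx) hα hα1

lemma isBoundedCDF_costCDF (hJ : AdmissibleCost X J U L₀ m) {x : Vec d} (hx : x ∈ X) :
    IsBoundedCDF (costCDF J μ x) U :=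
  isBoundedCDF_cdf_map (hJ.measurable_noise hx) (hJ.bounded x hx)

lemma AdmissibleCost.integrable_excess (hJ : AdmissibleCost X J U L₀ m) {x : Vec d} (hx : x ∈ X)
    (ν : ℝ) : Integrable (fun ξ => max (J x ξ - ν) 0) μ :=
  RiskAverse.integrable_excess (hJ.measurable_noise hx) (hJ.bounded x hx) ν

lemma cvarCost_sub_le (hJ : AdmissibleCost X J U L₀ m) (hα : 0 < α) (hα1 : α ≤ 1)
    {x y : Vec d} (hx : x ∈ X) (hy : y ∈ X) :
    cvarCost α J μ x - cvarCost α J μ y ≤ L₀ / α * ‖x - y‖ := by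
  obtain ⟨ν, hν⟩ := exists_cvarCost_eq (μ := μ) hJ hα hα1 hy
  have h1 := cvarCost_le (μ := μ) hJ hα hα1 hx ν
  have h2 : ∫ ξ, max (J x ξ - ν) 0 ∂μ ≤ ∫ ξ, (max (J y ξ - ν) 0 + L₀ * ‖x - y‖) ∂μ := by
    refine integral_mono (hJ.integrable_excess hx ν)
      ((hJ.integrable_excess hy ν).add (integrable_const _)) fun ξ => ?_
    have h3 := hJ.lipschitz_decision ξ x hx y hy
    refine max_le ?_ ?_
    · linarith [(abs_le.1 h3).2, le_max_left (J y ξ - ν) 0]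
    · linarith [abs_nonneg (J x ξ - J y ξ), le_max_right (J y ξ - ν) 0]
  rw [integral_add (hJ.integrable_excess hy ν) (integrable_const _), integral_const, probReal_univ,
    one_smul] at h2
  have h3 : α⁻¹ * ∫ ξ, max (J x ξ - ν) 0 ∂μ ≤
      α⁻¹ * (∫ ξ, max (J y ξ - ν) 0 ∂μ + L₀ * ‖x - y‖) := by gcongr
  rw [hν]
  have h4 : L₀ / α * ‖x - y‖ = α⁻¹ * (L₀ * ‖x - y‖) := by ring
  linarith

lemma abs_cvarCost_sub_le (hJ : AdmissibleCost X J U L₀ m) (hα : 0 < α) (hα1 : α ≤ 1)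
    {x y : Vec d} (hx : x ∈ X) (hy : y ∈ X) :
    |cvarCost α J μ x - cvarCost α J μ y| ≤ L₀ / α * ‖x - y‖ := by
  rw [abs_sub_le_iff]
  exact ⟨cvarCost_sub_le hJ hα hα1 hx hy, norm_sub_rev x y ▸ cvarCost_sub_le hJ hα hα1 hy hx⟩

lemma continuousOn_cvarCost (hJ : AdmissibleCost X J U L₀ m) (hα : 0 < α) (hα1 : α ≤ 1) :
    ContinuousOn (cvarCost α J μ) X := by
  refine (LipschitzOnWith.of_dist_le' (K := L₀ / α) fun x hx y hy => ?_).continuousOn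
  rw [Real.dist_eq, dist_eq_norm]
  exact abs_cvarCost_sub_le hJ hα hα1 hx hy

lemma abs_cvarCost_le (hJ : AdmissibleCost X J U L₀ m) (hα : 0 < α) (hα1 : α ≤ 1)
    {x : Vec d} (hx : x ∈ X) : |cvarCost α J μ x| ≤ U :=
  (isBoundedCDF_costCDF hJ hx).abs_cvar_le hα hα1

/-- CVaR inherits strong convexity: combine the optimal thresholds at the two points and lower the
result by the strong convexity gain, which CVaR passes on because it commutes with constants. -/
theorem strongConvexOn_cvarCost (hX : Convex ℝ X) (hJ : AdmissibleCost X J U L₀ m) (hα : 0 < α)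
    (hα1 : α ≤ 1) : StrongConvexOn X m (cvarCost α J μ) := by
  refine ⟨hX, fun x hx y hy a b ha hb hab => ?_⟩
  obtain ⟨ν, hν⟩ := exists_cvarCost_eq (μ := μ) hJ hα hα1 hx
  obtain ⟨ν', hν'⟩ := exists_cvarCost_eq (μ := μ) hJ hα hα1 hy
  set κ := a * b * (m / 2 * ‖x - y‖ ^ 2) with hκ
  have hz := hX hx hy ha hb hab
  have h1 := cvarCost_le (μ := μ) hJ hα hα1 hz (a * ν + b * ν' - κ)
  have hix := (hJ.integrable_excess (μ := μ) hx ν).const_mul a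
  have hiy := (hJ.integrable_excess (μ := μ) hy ν').const_mul b
  have h2 : ∫ ξ, max (J (a • x + b • y) ξ - (a * ν + b * ν' - κ)) 0 ∂μ ≤
      ∫ ξ, (a * max (J x ξ - ν) 0 + b * max (J y ξ - ν') 0) ∂μ := by
    refine integral_mono (hJ.integrable_excess hz _) (hix.add hiy) fun ξ => ?_
    have h3 := (hJ.strongConvexOn ξ).2 hx hy ha hb hab
    simp only [smul_eq_mul] at h3
    have h4 := mul_le_mul_of_nonneg_left (le_max_left (J x ξ - ν) 0) ha
    have h5 := mul_le_mul_of_nonneg_left (le_max_left (J y ξ - ν') 0) hb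
    refine max_le (by simp only [hκ]; linarith) ?_
    have := mul_nonneg ha (le_max_right (J x ξ - ν) 0)
    have := mul_nonneg hb (le_max_right (J y ξ - ν') 0)
    linarith
  rw [integral_add hix hiy, integral_const_mul, integral_const_mul] at h2
  have h3 := mul_le_mul_of_nonneg_left h2 (inv_pos.2 hα).le
  simp only [smul_eq_mul]
  rw [hν, hν']
  have h6 : α⁻¹ * (a * ∫ ξ, max (J x ξ - ν) 0 ∂μ + b * ∫ ξ, max (J y ξ - ν') 0 ∂μ) =
    a * (α⁻¹ * ∫ ξ, max (J x ξ - ν) 0 ∂μ) + b * (α⁻¹ * ∫ ξ, max (J y ξ - ν') 0 ∂μ) := by ring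
  linarith

/-- Kantorovich–Rubinstein duality, applied to the excess over the optimal threshold, bounds the
dependence of CVaR on the distribution. -/
theorem abs_cvarCost_sub_le_wasserstein (hJ : AdmissibleCost X J U L₀ m) (hL : 0 < L₀)
    (hα : 0 < α) (hα1 : α ≤ 1) {ν : Measure Ξ} [IsProbabilityMeasure ν] {x : Vec d} (hx : x ∈ X)
    (hW : wasserstein μ ν ≠ ⊤) :
    |cvarCost α J μ x - cvarCost α J ν x| ≤ L₀ / α * (wasserstein μ ν).toReal := by
  have hlip : ∀ s, LipschitzWith 1 fun ξ => L₀⁻¹ * max (J x ξ - s) 0 := fun s => by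
    refine LipschitzWith.of_dist_le_mul fun ξ ζ => ?_
    rw [Real.dist_eq, ← mul_sub, abs_mul, abs_of_pos (inv_pos.2 hL), NNReal.coe_one, one_mul,
      inv_mul_le_iff₀ hL]
    refine (abs_max_sub_max_le_abs _ _ _).trans ?_
    rw [sub_sub_sub_cancel_right]
    exact hJ.lipschitz_noise x hx ξ ζ
  have hi : ∀ (ρ : Measure Ξ) [IsProbabilityMeasure ρ] (s : ℝ),
      Integrable (fun ξ => L₀⁻¹ * max (J x ξ - s) 0) ρ := fun ρ _ s =>
    (hJ.integrable_excess hx s).const_mul _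
  have hdual : ∀ f : Ξ → ℝ, LipschitzWith 1 f → Integrable f μ → Integrable f ν →
      ∫ ξ, f ξ ∂μ - ∫ ξ, f ξ ∂ν ≤ (wasserstein μ ν).toReal := fun f h1 h2 h3 => by
    refine (ENNReal.ofReal_le_iff_le_toReal hW).1 ?_
    unfold wasserstein
    exact le_iSup₂_of_le f h1 (le_iSup₂_of_le h2 h3 le_rfl)
  have key : ∀ s, |∫ ξ, max (J x ξ - s) 0 ∂μ - ∫ ξ, max (J x ξ - s) 0 ∂ν| ≤
      L₀ * (wasserstein μ ν).toReal := fun s => by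
    have h1 := hdual _ (hlip s) (hi μ s) (hi ν s)
    have h2 := hdual _ (hlip s).neg (hi μ s).neg (hi ν s).neg
    simp only [Pi.neg_apply, integral_neg, integral_const_mul] at h1 h2
    have e : ∀ w : ℝ, w = L₀ * (L₀⁻¹ * w) := fun w => by field_simp
    rw [abs_le, e (∫ ξ, max (J x ξ - s) 0 ∂μ), e (∫ ξ, max (J x ξ - s) 0 ∂ν), ← mul_sub]
    constructor <;> nlinarith
  obtain ⟨s, hs⟩ := exists_cvarCost_eq (μ := μ) hJ hα hα1 hx
  obtain ⟨s', hs'⟩ := exists_cvarCost_eq (μ := ν) hJ hα hα1 hx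
  have h1 := cvarCost_le (μ := μ) hJ hα hα1 hx s'
  have h2 := cvarCost_le (μ := ν) hJ hα hα1 hx s
  have h3 := mul_le_mul_of_nonneg_left (abs_le.1 (key s')).2 (inv_pos.2 hα).le
  have h4 := mul_le_mul_of_nonneg_left (abs_le.1 (key s)).1 (inv_pos.2 hα).le
  have e : L₀ / α * (wasserstein μ ν).toReal = α⁻¹ * (L₀ * (wasserstein μ ν).toReal) := by ring
  rw [abs_le, e]
  constructor <;> linarith

end Objective

section Empirical

variable {n : ℕ} {B α : ℝ}

lemma isBoundedCDF_empiricalCDF (hn : 1 ≤ n) {z : ℕ → ℝ} (hz : ∀ i, |z i| ≤ B) :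
    IsBoundedCDF (empiricalCDF n z) B := by
  have hn0 : (0 : ℝ) < n := by exact_mod_cast hn
  have h1 : ∀ y, ∑ i ∈ Finset.Icc 1 n, indicator {v : ℝ | v ≤ y} (fun _ => (1 : ℝ)) (z i) ≤ n := by
    intro y
    calc _ ≤ ∑ i ∈ Finset.Icc 1 n, (1 : ℝ) :=
          Finset.sum_le_sum fun i _ => indicator_le_self' (fun _ _ => zero_le_one) _
      _ = n := by simp
  refine ⟨fun y y' hy => ?_, fun y => ?_, fun y => ?_, fun y hy => ?_, fun y hy => ?_⟩
  · simp only [empiricalCDF]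
    refine mul_le_mul_of_nonneg_left (Finset.sum_le_sum fun i _ => ?_) (by positivity)
    exact indicator_le_indicator_of_subset (fun v (hv : v ≤ y) => hv.trans hy)
      (fun _ => zero_le_one) _
  · exact mul_nonneg (by positivity)
      (Finset.sum_nonneg fun i _ => indicator_nonneg (fun _ _ => zero_le_one) _)
  · rw [empiricalCDF, one_div, inv_mul_le_iff₀ hn0, mul_one]
    exact h1 y
  · rw [empiricalCDF, Finset.sum_eq_zero, mul_zero]
    intro i _
    refine indicator_of_notMem ?_ _
    simp only [mem_ofPred_eq, not_le]
    linarith [(abs_le.1 (hz i)).1]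
  · have : ∀ i ∈ Finset.Icc 1 n, indicator {v : ℝ | v ≤ y} (fun _ => (1 : ℝ)) (z i) = 1 := by
      intro i _
      refine indicator_of_mem ?_ _
      simp only [mem_ofPred_eq]
      linarith [(abs_le.1 (hz i)).2]
    rw [empiricalCDF, Finset.sum_congr rfl this]
    simp
    field_simp

variable {Ω : Type*} [MeasurableSpace Ω] {Z : ℕ → Ω → ℝ}

lemma measurable_empiricalCDF (hZ : ∀ i, Measurable (Z i)) :
    Measurable fun q : Ω × ℝ => empiricalCDF n (fun i => Z i q.1) q.2 := by
  refine Measurable.const_mul (Finset.measurable_sum _ fun i _ => ?_) _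
  have : (fun q : Ω × ℝ => indicator {v : ℝ | v ≤ q.2} (fun _ => (1 : ℝ)) (Z i q.1)) =
      indicator {q : Ω × ℝ | Z i q.1 ≤ q.2} fun _ => 1 := by
    ext q; simp [indicator]
  rw [this]
  exact measurable_const.indicator
    (measurableSet_le ((hZ i).comp measurable_fst) measurable_snd)

lemma measurable_cvar_empiricalCDF (hα : 0 < α) (hα1 : α ≤ 1) (hn : 1 ≤ n)
    (hZ : ∀ i, Measurable (Z i)) (hB : ∀ i ω, |Z i ω| ≤ B) :
    Measurable fun ω => cvar α (empiricalCDF n fun i => Z i ω) := by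
  have h : ∀ ω, cvar α (empiricalCDF n fun i => Z i ω) =
      -B + α⁻¹ * ∫ y in Ioc (-B) B, min (1 - empiricalCDF n (fun i => Z i ω) y) α := fun ω =>
    (isBoundedCDF_empiricalCDF hn fun i => hB i ω).cvar_eq hα hα1
  simp only [h]
  refine Measurable.const_add (Measurable.const_mul ?_ _) _
  refine (StronglyMeasurable.integral_prod_right (ν := volume.restrict (Ioc (-B) B))
    (f := fun ω y => min (1 - empiricalCDF n (fun i => Z i ω) y) α) ?_).measurable
  exact ((measurable_const.sub (measurable_empiricalCDF hZ)).min
    measurable_const).stronglyMeasurable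

variable {P : Measure Ω} [IsProbabilityMeasure P] {F : ℝ → ℝ}

/-- The mean absolute error of the empirical distribution function at one point, from the variance
bound by the arithmetic-geometric mean inequality. -/
lemma integral_abs_empiricalCDF_sub_le (hn : 1 ≤ n) (hZ : ∀ i, Measurable (Z i))
    (hind : iIndepFun Z P) (y : ℝ) (hF : ∀ i, P.real {ω | Z i ω ≤ y} = F y) :
    ∫ ω, |empiricalCDF n (fun i => Z i ω) y - F y| ∂P ≤ 1 / √n := by
  have hn0 : (0 : ℝ) < n := by exact_mod_cast hn
  set I : ℝ → ℝ := indicator {v : ℝ | v ≤ y} fun _ => 1 with hI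
  have hIm : Measurable I := measurable_const.indicator measurableSet_Iic
  have hIb : ∀ v, I v ∈ Icc (0 : ℝ) 1 := fun v =>
    ⟨indicator_nonneg (fun _ _ => zero_le_one) _, indicator_le_self' (fun _ _ => zero_le_one) _⟩
  set Y : ℕ → Ω → ℝ := fun i ω => I (Z i ω) with hY
  have hYm : ∀ i, Measurable (Y i) := fun i => hIm.comp (hZ i)
  have hYL : ∀ i, MemLp (Y i) 2 P := fun i =>
    MemLp.of_bound (hYm i).aestronglyMeasurable 1 (.of_forall fun ω => by
      rw [Real.norm_eq_abs, abs_of_nonneg (hIb _).1]; exact (hIb _).2)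
  have hYE : ∀ i, ∫ ω, Y i ω ∂P = F y := fun i => by
    have : Y i = indicator {ω | Z i ω ≤ y} fun _ => 1 := by
      ext ω; simp [hY, hI, indicator]
    rw [this, integral_indicator_const _ (measurableSet_le (hZ i) measurable_const), hF i]
    simp
  have hvar : ∀ i, Var[Y i; P] ≤ 1 := fun i => by
    refine (variance_le_sq_of_bounded (a := 0) (b := 1) (.of_forall fun ω => hIb _)
      (hYm i).aemeasurable).trans ?_
    norm_num
  set S : Ω → ℝ := ∑ i ∈ Finset.Icc 1 n, Y i with hS
  have hSL : MemLp S 2 P := memLp_finsetSum' _ fun i _ => hYL i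
  have hSE : ∫ ω, S ω ∂P = n * F y := by
    simp only [hS, Finset.sum_apply]
    rw [integral_finsetSum _ fun i _ => (hYL i).integrable (by norm_num)]
    simp [hYE]
  have hSV : Var[S; P] ≤ n := by
    rw [hS, IndepFun.variance_sum (fun i _ => hYL i) fun i _ j _ hij =>
      (hind.indepFun hij).comp hIm hIm]
    calc _ ≤ ∑ i ∈ Finset.Icc 1 n, (1 : ℝ) := Finset.sum_le_sum fun i _ => hvar i
      _ = n := by simp
  rw [variance_eq_integral hSL.aestronglyMeasurable.aemeasurable, hSE] at hSV
  have hg : ∀ ω, empiricalCDF n (fun i => Z i ω) y - F y = (S ω - n * F y) / n := fun ω => by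
    simp only [empiricalCDF, hS, hY, hI, Finset.sum_apply]
    field_simp
  have hsq : Integrable (fun ω => (S ω - n * F y) ^ 2) P :=
    (hSL.sub (memLp_const _)).integrable_sq
  have hsn : 0 < √(n : ℝ) := Real.sqrt_pos.2 hn0
  have hss : √(n : ℝ) * √n = n := Real.mul_self_sqrt hn0.le
  calc ∫ ω, |empiricalCDF n (fun i => Z i ω) y - F y| ∂P
      ≤ ∫ ω, ((2 * √n * n)⁻¹ * (S ω - n * F y) ^ 2 + (2 * √n)⁻¹) ∂P := by
        refine integral_mono_of_nonneg (.of_forall fun ω => abs_nonneg _)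
          ((hsq.const_mul _).add (integrable_const _)) (.of_forall fun ω => ?_)
        simp only
        rw [hg, abs_div, abs_of_pos hn0]
        have e : (2 * √n * n)⁻¹ * (S ω - n * F y) ^ 2 + (2 * √n)⁻¹ =
            (|S ω - n * F y| ^ 2 + √n ^ 2) / (2 * √n * n) := by
          rw [sq_abs, Real.sq_sqrt hn0.le]
          field_simp
        rw [e, div_le_div_iff₀ hn0 (by positivity)]
        nlinarith [sq_nonneg (|S ω - n * F y| - √n),
          mul_nonneg hn0.le (sq_nonneg (|S ω - n * F y| - √n))]
    _ = (2 * √n * n)⁻¹ * ∫ ω, (S ω - n * F y) ^ 2 ∂P + (2 * √n)⁻¹ := by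
        rw [integral_add (hsq.const_mul _) (integrable_const _), integral_const_mul]; simp
    _ ≤ (2 * √n * n)⁻¹ * n + (2 * √n)⁻¹ := by gcongr
    _ = 1 / √n := by field_simp; norm_num

/-- The empirical CVaR of `n` independent samples has mean absolute error `O(n^{-1/2})`. -/
theorem integral_abs_cvar_empiricalCDF_sub_le (hα : 0 < α) (hα1 : α ≤ 1) (hn : 1 ≤ n)
    (hZ : ∀ i, Measurable (Z i)) (hB : ∀ i ω, |Z i ω| ≤ B) (hind : iIndepFun Z P)
    (hFB : IsBoundedCDF F B) (hF : ∀ i y, P.real {ω | Z i ω ≤ y} = F y) :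
    ∫ ω, |cvar α (empiricalCDF n fun i => Z i ω) - cvar α F| ∂P ≤ 2 * B / α * (1 / √n) := by
  have hE : ∀ ω, IsBoundedCDF (empiricalCDF n fun i => Z i ω) B := fun ω =>
    isBoundedCDF_empiricalCDF hn fun i => hB i ω
  have hm : Measurable fun q : Ω × ℝ => |empiricalCDF n (fun i => Z i q.1) q.2 - F q.2| :=
    ((measurable_empiricalCDF hZ).sub (hFB.measurable.comp measurable_snd)).abs
  have hint : Integrable (Function.uncurry fun ω y => |empiricalCDF n (fun i => Z i ω) y - F y|)
      (P.prod (volume.restrict (Ioc (-B) B))) := by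
    refine Integrable.of_bound hm.aestronglyMeasurable 1 (.of_forall fun ⟨ω, y⟩ => ?_)
    simp only [Function.uncurry, Real.norm_eq_abs, abs_abs]
    rw [abs_le]
    constructor <;> linarith [(hE ω).nonneg y, (hE ω).le_one y, hFB.nonneg y, hFB.le_one y]
  have hint1 : Integrable (fun ω => ∫ y in Ioc (-B) B, |empiricalCDF n (fun i => Z i ω) y - F y|)
    P := hint.integral_prod_left
  have hint2 : Integrable (fun y => ∫ ω, |empiricalCDF n (fun i => Z i ω) y - F y| ∂P)
    (volume.restrict (Ioc (-B) B)) := hint.integral_prod_right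
  calc _ ≤ ∫ ω, (α⁻¹ * ∫ y in Ioc (-B) B, |empiricalCDF n (fun i => Z i ω) y - F y|) ∂P :=
        integral_mono_of_nonneg (.of_forall fun ω => abs_nonneg _) (hint1.const_mul _)
          (.of_forall fun ω => (hE ω).abs_cvar_sub_le hFB hα hα1)
    _ = α⁻¹ * ∫ y in Ioc (-B) B, ∫ ω, |empiricalCDF n (fun i => Z i ω) y - F y| ∂P := by
        rw [integral_const_mul, integral_integral_swap hint]
    _ ≤ α⁻¹ * ∫ y in Ioc (-B) B, 1 / √n := by
        refine mul_le_mul_of_nonneg_left (integral_mono hint2 (integrable_const _) fun y => ?_)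
          (inv_pos.2 hα).le
        exact integral_abs_empiricalCDF_sub_le hn hZ hind y fun i => hF i y
    _ = 2 * B / α * (1 / √n) := by
        rw [setIntegral_const, Real.volume_real_Ioc_of_le hFB.neg_le, smul_eq_mul]; ring

end Empirical

/-! ### Projection and the shrunken set -/

section Projection

variable {d : ℕ} {s : Set (Vec d)}

lemma argmin_spec {f : Vec d → ℝ} (hs : IsCompact s) (hne : s.Nonempty) (hf : ContinuousOn f s) :
    argmin s f ∈ s ∧ ∀ z ∈ s, f (argmin s f) ≤ f z := by
  obtain ⟨y, hy, hmin⟩ := hs.exists_isMinOn hne hf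
  exact Classical.epsilon_spec (p := fun y => y ∈ s ∧ ∀ z ∈ s, f y ≤ f z)
    ⟨y, hy, fun z hz => hmin hz⟩

lemma proj_mem (hs : IsCompact s) (hne : s.Nonempty) (x : Vec d) : proj s x ∈ s :=
  (argmin_spec hs hne (by fun_prop)).1

/-- The variational inequality that characterizes the projection. -/
lemma inner_sub_proj_le (hs : IsCompact s) (hc : Convex ℝ s) (hne : s.Nonempty) (x : Vec d)
    {y : Vec d} (hy : y ∈ s) : ⟪x - proj s x, y - proj s x⟫ ≤ 0 := by
  set p := proj s x with hp
  obtain ⟨hps, hmin⟩ := argmin_spec (f := fun y => ‖x - y‖ ^ 2) hs hne (by fun_prop)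
  change p ∈ s at hps
  change ∀ z ∈ s, ‖x - p‖ ^ 2 ≤ ‖x - z‖ ^ 2 at hmin
  have key : ∀ θ ∈ Ioo (0 : ℝ) 1, 2 * ⟪x - p, y - p⟫ ≤ θ * ‖y - p‖ ^ 2 := fun θ hθ => by
    have hz : p + θ • (y - p) ∈ s := hc.add_smul_sub_mem hps hy ⟨hθ.1.le, hθ.2.le⟩
    have h1 := hmin _ hz
    have h2 : x - (p + θ • (y - p)) = (x - p) - θ • (y - p) := by abel
    rw [h2, norm_sub_sq_real (x - p), norm_smul, inner_smul_right, mul_pow, Real.norm_eq_abs,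
      sq_abs] at h1
    have h3 : θ * (2 * ⟪x - p, y - p⟫) ≤ θ * (θ * ‖y - p‖ ^ 2) := by nlinarith
    exact le_of_mul_le_mul_left h3 hθ.1
  have hlim : Tendsto (fun θ : ℝ => θ * ‖y - p‖ ^ 2) (𝓝[>] 0) (𝓝 0) := by
    have : Continuous fun θ : ℝ => θ * ‖y - p‖ ^ 2 := by fun_prop
    simpa using (this.tendsto 0).mono_left nhdsWithin_le_nhds
  have := ge_of_tendsto hlim
    (by filter_upwards [Ioo_mem_nhdsGT (zero_lt_one' ℝ)] with θ hθ using key θ hθ)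
  linarith

lemma norm_proj_sub_le (hs : IsCompact s) (hc : Convex ℝ s) (hne : s.Nonempty) (x x' : Vec d) :
    ‖proj s x - proj s x'‖ ≤ ‖x - x'‖ := by
  have h1 := inner_sub_proj_le hs hc hne x (proj_mem hs hne x')
  have h2 := inner_sub_proj_le hs hc hne x' (proj_mem hs hne x)
  set p := proj s x
  set p' := proj s x'
  have h3 : ‖p - p'‖ * ‖p - p'‖ ≤ ‖x - x'‖ * ‖p - p'‖ := by
    refine le_trans ?_ (real_inner_le_norm (x - x') (p - p'))
    rw [← real_inner_self_eq_norm_mul_norm]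
    have : ⟪p - p', p - p'⟫ - ⟪x - x', p - p'⟫ = ⟪x - p, p' - p⟫ + ⟪x' - p', p - p'⟫ := by
      simp only [inner_sub_left, inner_sub_right]; ring
    linarith
  rcases (norm_nonneg (p - p')).eq_or_lt with h | h
  · rw [← h]; exact norm_nonneg _
  · exact le_of_mul_le_mul_right h3 h

lemma proj_of_mem (hs : IsCompact s) (hc : Convex ℝ s) {x : Vec d} (hx : x ∈ s) :
    proj s x = x := by
  have := inner_sub_proj_le hs hc ⟨x, hx⟩ x hx
  rw [real_inner_self_nonpos, sub_eq_zero] at this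
  exact this.symm

lemma continuous_proj (hs : IsCompact s) (hc : Convex ℝ s) (hne : s.Nonempty) :
    Continuous (proj s) :=
  (LipschitzWith.of_dist_le_mul (K := 1) fun x y => by
    simpa [dist_eq_norm] using norm_proj_sub_le hs hc hne x y).continuous

/-- A minimizer of a strongly convex function over a convex subset satisfies the quadratic growth
condition. -/
lemma quadratic_growth {X : Set (Vec d)} {h : Vec d → ℝ} {m : ℝ} (hconv : StrongConvexOn X m h)
    (hsX : s ⊆ X) (hc : Convex ℝ s) {x y : Vec d} (hx : x ∈ s) (hy : y ∈ s)
    (hmin : ∀ z ∈ s, h y ≤ h z) : m / 2 * ‖x - y‖ ^ 2 ≤ h x - h y := by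
  have key : ∀ θ ∈ Ioo (0 : ℝ) 1, m / 2 * ‖x - y‖ ^ 2 - θ * (m / 2 * ‖x - y‖ ^ 2) ≤ h x - h y := by
    intro θ hθ
    have h1 := hconv.2 (hsX hx) (hsX hy) hθ.1.le (by linarith [hθ.2] : 0 ≤ 1 - θ) (by ring)
    have h2 := hmin _ (hc hx hy hθ.1.le (by linarith [hθ.2] : 0 ≤ 1 - θ) (by ring))
    simp only [smul_eq_mul] at h1
    have h3 : θ * (m / 2 * ‖x - y‖ ^ 2 - θ * (m / 2 * ‖x - y‖ ^ 2)) ≤ θ * (h x - h y) := by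
      linarith
    exact le_of_mul_le_mul_left h3 hθ.1
  have hlim : Tendsto (fun θ : ℝ => m / 2 * ‖x - y‖ ^ 2 - θ * (m / 2 * ‖x - y‖ ^ 2)) (𝓝[>] 0)
      (𝓝 (m / 2 * ‖x - y‖ ^ 2)) := by
    have : Continuous fun θ : ℝ => m / 2 * ‖x - y‖ ^ 2 - θ * (m / 2 * ‖x - y‖ ^ 2) := by fun_prop
    simpa using (this.tendsto 0).mono_left nhdsWithin_le_nhds
  exact le_of_tendsto hlim
    (by filter_upwards [Ioo_mem_nhdsGT (zero_lt_one' ℝ)] with θ hθ using key θ hθ)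

end Projection

section Shrink

variable {d : ℕ} {X : Set (Vec d)} {r Dx δ : ℝ}

lemma shrink_subset : shrink X r δ ⊆ X := fun _ hx => hx.1

lemma AdmissibleSet.zero_mem (hX : AdmissibleSet X r Dx) (hr : 0 < r) : (0 : Vec d) ∈ X :=
  hX.ball_subset (Metric.mem_closedBall_self hr.le)

lemma AdmissibleSet.norm_sub_le (hX : AdmissibleSet X r Dx) {x y : Vec d} (hx : x ∈ X)
    (hy : y ∈ X) : ‖x - y‖ ≤ Dx := by
  rw [← dist_eq_norm]
  exact (Metric.dist_le_diam_of_mem hX.isCompact.isBounded hx hy).trans hX.diam_le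

lemma AdmissibleSet.convex_shrink (hX : AdmissibleSet X r Dx) : Convex ℝ (shrink X r δ) := by
  intro x hx y hy a b ha hb hab
  refine ⟨hX.convex hx.1 hy.1 ha hb hab, ?_⟩
  rw [smul_add, smul_comm _ a, smul_comm _ b]
  exact hX.convex hx.2 hy.2 ha hb hab

lemma AdmissibleSet.isCompact_shrink (hX : AdmissibleSet X r Dx) :
    IsCompact (shrink X r δ) := by
  refine hX.isCompact.inter_right (t := {x | (1 / (1 - δ / r)) • x ∈ X}) ?_
  exact hX.isCompact.isClosed.preimage (by fun_prop)

lemma AdmissibleSet.smul_mem_shrink (hX : AdmissibleSet X r Dx) (hr : 0 < r) (hδ : 0 < δ)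
    (hδr : δ < r) {x : Vec d} (hx : x ∈ X) : (1 - δ / r) • x ∈ shrink X r δ := by
  have h1 : δ / r < 1 := (div_lt_one hr).2 hδr
  have h2 : 0 < δ / r := by positivity
  refine ⟨hX.convex.smul_mem_of_zero_mem (hX.zero_mem hr) hx ⟨by linarith, by linarith⟩, ?_⟩
  rw [smul_smul, one_div, inv_mul_cancel₀ (by linarith), one_smul]
  exact hx

/-- Points of the shrunken set keep distance at least `δ` from the complement of `X`. -/
lemma AdmissibleSet.closedBall_subset (hX : AdmissibleSet X r Dx) (hr : 0 < r) (hδ : 0 < δ)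
    (hδr : δ < r) {x : Vec d} (hx : x ∈ shrink X r δ) : Metric.closedBall x δ ⊆ X := by
  intro y hy
  have h1 : δ / r < 1 := (div_lt_one hr).2 hδr
  have h2 : 0 < δ / r := by positivity
  have hv : (r / δ) • (y - x) ∈ X := by
    refine hX.ball_subset ?_
    rw [mem_closedBall_zero_iff, norm_smul, Real.norm_of_nonneg (by positivity), ← dist_eq_norm]
    calc r / δ * dist y x ≤ r / δ * δ := by gcongr; exact hy
      _ = r := by field_simp
  have := hX.convex hx.2 hv (by linarith : 0 ≤ 1 - δ / r) h2.le (by ring)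
  rw [smul_smul, smul_smul, mul_one_div_cancel (by linarith), one_smul] at this
  have e : δ / r * (r / δ) = 1 := by field_simp
  rw [e, one_smul] at this
  simpa using this

end Shrink

/-! ### Exponential supermartingales and the independence of the inputs -/

section Epoch

variable {Δ t : ℕ}

lemma batch_eq (hΔ : 1 ≤ Δ) (ht : 1 ≤ t) : batch Δ t = (t - 1) / Δ + 1 := by
  rw [batch, Nat.ceil_eq_iff (Nat.add_one_ne_zero _)]
  have hΔ0 : (0 : ℝ) < Δ := by exact_mod_cast hΔ
  have h1 : (t - 1) / Δ * Δ ≤ t - 1 := Nat.div_mul_le_self _ _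
  have h2 : t - 1 < ((t - 1) / Δ + 1) * Δ := by
    rw [mul_comm]; exact Nat.lt_mul_div_succ _ hΔ
  rw [lt_div_iff₀ hΔ0, div_le_iff₀ hΔ0, Nat.add_sub_cancel]
  have h3 : (t - 1) / Δ * Δ < t := by omega
  have h4 : t ≤ ((t - 1) / Δ + 1) * Δ := by omega
  exact ⟨by exact_mod_cast h3, by exact_mod_cast h4⟩

lemma epoch_eq (hΔ : 1 ≤ Δ) (ht : 1 ≤ t) : epoch Δ t = (t - 1) % Δ + 1 := by
  rw [epoch, batch_eq hΔ ht, Nat.add_sub_cancel]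
  have := Nat.div_add_mod' (t - 1) Δ
  omega

lemma epoch_mem (hΔ : 1 ≤ Δ) (ht : 1 ≤ t) : epoch Δ t ∈ Finset.Icc 1 Δ := by
  rw [epoch_eq hΔ ht, Finset.mem_Icc]
  have := Nat.mod_lt (t - 1) hΔ
  omega

end Epoch

section Freezing

variable {Ω α β : Type*} [MeasurableSpace Ω] [MeasurableSpace α] [MeasurableSpace β]
  {P : Measure Ω} [IsProbabilityMeasure P] {A : Ω → α} {W : Ω → β}

/-- The freezing lemma: under independence, `A` may be frozen while integrating over `W`. -/
lemma lintegral_indepFun (hA : Measurable A) (hW : Measurable W) (h : IndepFun A W P)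
    {f : α × β → ℝ≥0∞} (hf : Measurable f) :
    ∫⁻ ω, f (A ω, W ω) ∂P = ∫⁻ ω, ∫⁻ ω', f (A ω, W ω') ∂P ∂P := by
  have hmap := (indepFun_iff_map_prod_eq_prod_map_map hA.aemeasurable hW.aemeasurable).1 h
  have := Measure.isProbabilityMeasure_map (μ := P) hW.aemeasurable
  rw [← lintegral_map hf (hA.prodMk hW), hmap, lintegral_prod _ hf.aemeasurable,
    lintegral_map hf.lintegral_prod_right' hA]
  congr 1 with ω
  exact lintegral_map (hf.comp measurable_prodMk_left) hW

lemma integral_indepFun_le (hA : Measurable A) (hW : Measurable W) (h : IndepFun A W P)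
    {f : α × β → ℝ} (hf : Measurable f) {b e : ℝ} (hb : ∀ q, |f q| ≤ b)
    (he : ∀ a, ∫ ω, f (a, W ω) ∂P ≤ e) : ∫ ω, f (A ω, W ω) ∂P ≤ e := by
  have hmap := (indepFun_iff_map_prod_eq_prod_map_map hA.aemeasurable hW.aemeasurable).1 h
  have := Measure.isProbabilityMeasure_map (μ := P) hW.aemeasurable
  have := Measure.isProbabilityMeasure_map (μ := P) hA.aemeasurable
  have hi : Integrable f ((P.map A).prod (P.map W)) :=
    Integrable.of_bound hf.aestronglyMeasurable b (.of_forall hb)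
  have e1 : ∫ ω, f (A ω, W ω) ∂P = ∫ a, ∫ w, f (a, w) ∂(P.map W) ∂(P.map A) := by
    rw [← integral_map (hA.prodMk hW).aemeasurable (f := f) hf.aestronglyMeasurable, hmap,
      integral_prod _ hi]
  rw [e1]
  refine (integral_mono hi.integral_prod_left (integrable_const e) fun a => ?_).trans (by simp)
  have e2 := integral_map (μ := P) hW.aemeasurable (f := fun w => f (a, w))
    (hf.comp measurable_prodMk_left).aestronglyMeasurable
  exact e2.trans_le (he a)

end Freezing

section Supermartingale

variable {Ω S E : Type*} {m0 : MeasurableSpace Ω} [MeasurableSpace S] [MeasurableSpace E]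
  {P : Measure Ω} [IsProbabilityMeasure P]

/-- An exponential supermartingale: if, for each frozen state, the increment has exponential moment
at most `1` under the fresh randomness `W t`, the sum of the increments has exponential moment at
most `1`. -/
lemma lintegral_exp_sum_le_one {ℱ : ℕ → MeasurableSpace Ω} (hℱ : ∀ t, ℱ t ≤ m0)
    (hmono : Monotone ℱ) {W : ℕ → Ω → S} {x : ℕ → Ω → E} {Y : ℕ → E × S → ℝ}
    (hx : ∀ t, Measurable[ℱ t] (x t)) (hW : ∀ t, Measurable[ℱ (t + 1)] (W t))
    (hind : ∀ t, Indep (ℱ t) (MeasurableSpace.comap (W t) inferInstance) P)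
    (hY : ∀ t, 1 ≤ t → Measurable (Y t))
    (hexp : ∀ t, 1 ≤ t → ∀ e, ∫⁻ ω, ENNReal.ofReal (Real.exp (Y t (e, W t ω))) ∂P ≤ 1) (T : ℕ) :
    ∫⁻ ω, ENNReal.ofReal (Real.exp (∑ t ∈ Finset.Icc 1 T, Y t (x t ω, W t ω))) ∂P ≤ 1 := by
  have hmeas : ∀ T, Measurable[ℱ (T + 1)]
      fun ω => ∑ t ∈ Finset.Icc 1 T, Y t (x t ω, W t ω) := fun T => by
    refine Finset.measurable_sum _ fun t ht => ?_
    rw [Finset.mem_Icc] at ht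
    refine (hY t ht.1).comp ?_
    exact ((hx t).mono (hmono (by omega)) le_rfl).prodMk
      ((hW t).mono (hmono (by omega)) le_rfl)
  induction T with
  | zero => simp
  | succ T ih =>
    set M : Ω → ℝ := fun ω => ∑ t ∈ Finset.Icc 1 T, Y t (x t ω, W t ω) with hM
    have hA : Measurable[ℱ (T + 1)] fun ω => (M ω, x (T + 1) ω) :=
      (hmeas T).prodMk (hx (T + 1))
    have hAm : Measurable fun ω => (M ω, x (T + 1) ω) := hA.mono (hℱ _) le_rfl
    have hWm : Measurable (W (T + 1)) := (hW (T + 1)).mono (hℱ _) le_rfl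
    have hI : IndepFun (fun ω => (M ω, x (T + 1) ω)) (W (T + 1)) P := by
      rw [IndepFun_iff_Indep]
      exact indep_of_indep_of_le_left (hind (T + 1)) hA.comap_le
    have hYm : Measurable (Y (T + 1)) := hY _ (by omega)
    have hf : Measurable fun q : (ℝ × E) × S =>
        ENNReal.ofReal (Real.exp (q.1.1 + Y (T + 1) (q.1.2, q.2))) := by
      refine (Real.measurable_exp.comp ?_).ennreal_ofReal
      exact (measurable_fst.comp measurable_fst).add
        (hYm.comp ((measurable_snd.comp measurable_fst).prodMk measurable_snd))
    have e : ∀ ω, ∑ t ∈ Finset.Icc 1 (T + 1), Y t (x t ω, W t ω) =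
        M ω + Y (T + 1) (x (T + 1) ω, W (T + 1) ω) := fun ω => by
      rw [Finset.sum_Icc_succ_top (by omega)]
    simp only [e]
    refine (lintegral_indepFun hAm hWm hI hf).trans_le (le_trans (lintegral_mono fun ω => ?_) ih)
    simp only [Real.exp_add, ENNReal.ofReal_mul (Real.exp_nonneg _)]
    have hg : Measurable fun ω' =>
        ENNReal.ofReal (Real.exp (Y (T + 1) (x (T + 1) ω, W (T + 1) ω'))) :=
      (Real.measurable_exp.comp
        (hYm.comp (measurable_const.prodMk hWm))).ennreal_ofReal
    rw [lintegral_const_mul _ hg]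
    exact mul_le_of_le_one_right' (hexp _ (by omega) _)

/-- Chernoff's bound. -/
lemma one_sub_le_of_lintegral_exp_le_one {M : Ω → ℝ} (hM : Measurable M)
    (h : ∫⁻ ω, ENNReal.ofReal (Real.exp (M ω)) ∂P ≤ 1) {γ : ℝ} (hγ : 0 < γ) :
    ENNReal.ofReal (1 - γ) ≤ P {ω | M ω ≤ Real.log (1 / γ)} := by
  have h1 : P {ω | M ω ≤ Real.log (1 / γ)}ᶜ ≤ ENNReal.ofReal γ := by
    have h2 := mul_meas_ge_le_lintegral (μ := P) (Real.measurable_exp.comp hM).ennreal_ofReal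
      (ENNReal.ofReal (1 / γ))
    have h3 : P {ω | M ω ≤ Real.log (1 / γ)}ᶜ ≤
        P {ω | ENNReal.ofReal (1 / γ) ≤ ENNReal.ofReal ((Real.exp ∘ M) ω)} := by
      refine measure_mono fun ω hω => ?_
      simp only [mem_compl_iff, mem_ofPred_eq, not_le] at hω ⊢
      refine ENNReal.ofReal_le_ofReal ?_
      rw [Real.log_lt_iff_lt_exp (by positivity)] at hω
      exact hω.le
    have h4 : ENNReal.ofReal (1 / γ) * P {ω | M ω ≤ Real.log (1 / γ)}ᶜ ≤ 1 :=
      (mul_le_mul_right h3 _).trans (h2.trans h)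
    calc P {ω | M ω ≤ Real.log (1 / γ)}ᶜ
        = ENNReal.ofReal γ * (ENNReal.ofReal (1 / γ) * P {ω | M ω ≤ Real.log (1 / γ)}ᶜ) := by
          rw [← mul_assoc, ← ENNReal.ofReal_mul hγ.le, mul_one_div_cancel hγ.ne',
            ENNReal.ofReal_one, one_mul]
      _ ≤ ENNReal.ofReal γ * 1 := by gcongr
      _ = _ := mul_one _
  rw [prob_compl_eq_one_sub (measurableSet_le hM measurable_const)] at h1
  rw [ENNReal.ofReal_sub _ hγ.le, ENNReal.ofReal_one, tsub_le_iff_right]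
  rw [tsub_le_iff_right, add_comm] at h1
  exact h1

/-- Hoeffding's lemma for a variable bounded by `b` whose mean is at least `κ`. -/
lemma lintegral_exp_le_one {Z : Ω → ℝ} (hZ : Measurable Z) {b κ l : ℝ} (hb0 : 0 ≤ b)
    (hb : ∀ ω, |Z ω| ≤ b) (hκ : κ ≤ ∫ ω, Z ω ∂P) (hl : 0 ≤ l) :
    ∫⁻ ω, ENNReal.ofReal (Real.exp (l * (κ - Z ω) - l ^ 2 * b ^ 2 / 2)) ∂P ≤ 1 := by
  have hsub := hasSubgaussianMGF_of_mem_Icc (μ := P) (a := -b) (b := b) hZ.aemeasurable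
    (.of_forall fun ω => abs_le.1 (hb ω))
  have h1 := hsub.mgf_le (-l)
  have hi := hsub.integrable_exp_mul (-l)
  rw [mgf] at h1
  have hc : (((‖b - -b‖₊ / 2) ^ 2 : NNReal) : ℝ) = b ^ 2 := by
    push_cast
    rw [Real.norm_of_nonneg (by linarith)]
    ring
  rw [hc] at h1
  have hpt : ∀ ω, Real.exp (l * (κ - Z ω) - l ^ 2 * b ^ 2 / 2) ≤
      Real.exp (-(l ^ 2 * b ^ 2 / 2)) * Real.exp (-l * (Z ω - ∫ ω, Z ω ∂P)) := fun ω => by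
    rw [← Real.exp_add]
    refine Real.exp_le_exp.2 ?_
    nlinarith [mul_le_mul_of_nonneg_left hκ hl]
  calc _ ≤ ∫⁻ ω, ENNReal.ofReal (Real.exp (-(l ^ 2 * b ^ 2 / 2)) *
        Real.exp (-l * (Z ω - ∫ ω, Z ω ∂P))) ∂P :=
        lintegral_mono fun ω => ENNReal.ofReal_le_ofReal (hpt ω)
    _ = ENNReal.ofReal (Real.exp (-(l ^ 2 * b ^ 2 / 2)) *
        ∫ ω, Real.exp (-l * (Z ω - ∫ ω, Z ω ∂P)) ∂P) := by
        rw [← integral_const_mul, ofReal_integral_eq_lintegral_ofReal (hi.const_mul _)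
          (.of_forall fun ω => by positivity)]
    _ ≤ ENNReal.ofReal (Real.exp (-(l ^ 2 * b ^ 2 / 2)) * Real.exp (b ^ 2 * (-l) ^ 2 / 2)) := by
        gcongr
    _ = 1 := by
        rw [← Real.exp_add, show -(l ^ 2 * b ^ 2 / 2) + b ^ 2 * (-l) ^ 2 / 2 = 0 by ring]
        simp

end Supermartingale

section Inputs

variable {d : ℕ} {Ξ Ω : Type*} [MeasurableSpace Ξ] {u : ℕ → Ω → UnitSphere d} {ξ : ℕ → ℕ → Ω → Ξ}

/-- The σ-algebra generated by the direction (`inl t`) or the noise sample (`inr (t, i)`). -/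
abbrev inputSigma (u : ℕ → Ω → UnitSphere d) (ξ : ℕ → ℕ → Ω → Ξ) (k : ℕ ⊕ ℕ × ℕ) :
    MeasurableSpace Ω :=
  Sum.elim (fun t => MeasurableSpace.comap (u t) inferInstance)
    (fun q => MeasurableSpace.comap (ξ q.1 q.2) inferInstance) k

/-- The iteration in which an input is drawn. -/
def inputTime (k : ℕ ⊕ ℕ × ℕ) : ℕ := Sum.elim id Prod.fst k

/-- The σ-algebra generated by the inputs of the iterations before `t`. -/
abbrev past (u : ℕ → Ω → UnitSphere d) (ξ : ℕ → ℕ → Ω → Ξ) (t : ℕ) : MeasurableSpace Ω :=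
  ⨆ k ∈ {k | inputTime k < t}, inputSigma u ξ k

/-- The fresh randomness of iteration `t`. -/
def fresh (u : ℕ → Ω → UnitSphere d) (ξ : ℕ → ℕ → Ω → Ξ) (t : ℕ) (ω : Ω) :
    UnitSphere d × (ℕ → Ξ) :=
  (u t ω, fun i => ξ t i ω)

lemma measurable_direction_iSup {s : Set (ℕ ⊕ ℕ × ℕ)} {t : ℕ} (ht : Sum.inl t ∈ s) :
    Measurable[⨆ k ∈ s, inputSigma u ξ k] (u t) :=
  Measurable.mono (comap_measurable (u t)) (le_iSup₂_of_le (Sum.inl t) ht le_rfl) le_rfl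

lemma measurable_noise_iSup {s : Set (ℕ ⊕ ℕ × ℕ)} {t : ℕ} (ht : ∀ i, Sum.inr (t, i) ∈ s) :
    Measurable[⨆ k ∈ s, inputSigma u ξ k] fun ω i => ξ t i ω := by
  refine @measurable_pi_lambda _ _ _ (⨆ k ∈ s, inputSigma u ξ k) _ _ fun i => ?_
  exact Measurable.mono (comap_measurable (ξ t i))
    (le_iSup₂_of_le (Sum.inr (t, i)) (ht i) le_rfl) le_rfl

lemma measurable_fresh_iSup {s : Set (ℕ ⊕ ℕ × ℕ)} {t : ℕ} (ht : ∀ k, inputTime k = t → k ∈ s) :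
    Measurable[⨆ k ∈ s, inputSigma u ξ k] (fresh u ξ t) :=
  Measurable.prodMk (measurable_direction_iSup (ht _ rfl)) (measurable_noise_iSup fun _ => ht _ rfl)

lemma past_mono : Monotone (past u ξ) := fun _ _ hst =>
  biSup_mono fun _ (hk : _ < _) => lt_of_lt_of_le hk hst

lemma measurable_fresh_past (t : ℕ) : Measurable[past u ξ (t + 1)] (fresh u ξ t) :=
  measurable_fresh_iSup fun _ hk => Nat.lt_succ_of_le hk.le

variable [m0 : MeasurableSpace Ω] {P : Measure Ω} {D : ℕ → Measure Ξ}

namespace RandomInputs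

lemma inputSigma_le (h : RandomInputs P D u ξ) (k : ℕ ⊕ ℕ × ℕ) : inputSigma u ξ k ≤ m0 := by
  rcases k with t | ⟨t, i⟩
  · exact (h.measurable_direction t).comap_le
  · exact (h.measurable_noise t i).comap_le

lemma past_le (h : RandomInputs P D u ξ) (t : ℕ) : past u ξ t ≤ m0 :=
  iSup₂_le fun k _ => h.inputSigma_le k

lemma measurable_fresh (h : RandomInputs P D u ξ) (t : ℕ) : Measurable (fresh u ξ t) :=
  (h.measurable_direction t).prodMk (measurable_pi_lambda _ fun i => h.measurable_noise t i)

lemma indep_fresh (h : RandomInputs P D u ξ) (t : ℕ) :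
    Indep (past u ξ t) (MeasurableSpace.comap (fresh u ξ t) inferInstance) P := by
  have hdis : Disjoint {k | inputTime k < t} {k | inputTime k = t} := by
    rw [Set.disjoint_left]
    intro k hk hk'
    exact absurd hk' (ne_of_lt hk)
  refine indep_of_indep_of_le_right (indep_iSup_of_disjoint h.inputSigma_le h.indep hdis) ?_
  exact Measurable.comap_le (measurable_fresh_iSup fun k hk => hk)

lemma indepFun_direction_noise (h : RandomInputs P D u ξ) (t : ℕ) :
    IndepFun (u t) (fun ω i => ξ t i ω) P := by
  rw [IndepFun_iff_Indep]
  have hdis : Disjoint {Sum.inl t} (range (Sum.inr : ℕ × ℕ → ℕ ⊕ ℕ × ℕ)) := by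
    simp
  refine indep_of_indep_of_le_left (indep_of_indep_of_le_right
    (indep_iSup_of_disjoint h.inputSigma_le h.indep hdis) ?_) ?_
  · exact Measurable.comap_le (measurable_noise_iSup fun _ => ⟨_, rfl⟩)
  · exact Measurable.comap_le (measurable_direction_iSup rfl)

lemma iIndepFun_noise (h : RandomInputs P D u ξ) (t : ℕ) : iIndepFun (fun i => ξ t i) P := by
  have hinj : Function.Injective fun i : ℕ => (Sum.inr (t, i) : ℕ ⊕ ℕ × ℕ) := fun i j hij => by
    simpa using hij
  exact iIndep.precomp hinj h.indep

end RandomInputs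

end Inputs

/-! ### The gradient estimate -/

/-- The standing assumptions on the parameters `A` of the algorithm and the cost `J`. -/
structure AdmissibleRun {d : ℕ} {Ξ : Type*} [MetricSpace Ξ] (A : Params d) (J : Vec d → Ξ → ℝ)
    (Dx U L₀ m : ℝ) : Prop where
  set : AdmissibleSet A.X A.r Dx
  cost : AdmissibleCost A.X J U L₀ m
  r_pos : 0 < A.r
  δ_pos : 0 < A.δ
  δ_lt : A.δ < A.r
  α_pos : 0 < A.α
  α_le : A.α ≤ 1
  U_pos : 0 < U
  L₀_pos : 0 < L₀
  m_pos : 0 < m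
  Δ_pos : 1 ≤ A.Δ
  sample_pos : ∀ τ ∈ Finset.Icc 1 A.Δ, 1 ≤ A.φ τ
  init : A.x₀ ∈ shrink A.X A.r A.δ

/-- The CVaR estimate that scales the direction in `Params.gradEstimate`. -/
noncomputable def Params.cvarEstimate {d : ℕ} {Ξ : Type*} (A : Params d) (J : Vec d → Ξ → ℝ)
    (t : ℕ) (x u : Vec d) (ξ : ℕ → Ξ) : ℝ :=
  cvar A.α (empiricalCDF (A.φ (epoch A.Δ t)) fun i => J (x + A.δ • u) (ξ i))

namespace AdmissibleRun

variable {d : ℕ} {Ξ : Type*} [MetricSpace Ξ] {A : Params d} {J : Vec d → Ξ → ℝ} {Dx U L₀ m : ℝ}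

lemma shrink_nonempty (h : AdmissibleRun A J Dx U L₀ m) : (shrink A.X A.r A.δ).Nonempty :=
  ⟨_, h.init⟩

lemma isCompact_shrink (h : AdmissibleRun A J Dx U L₀ m) : IsCompact (shrink A.X A.r A.δ) :=
  h.set.isCompact_shrink

lemma convex_shrink (h : AdmissibleRun A J Dx U L₀ m) : Convex ℝ (shrink A.X A.r A.δ) :=
  h.set.convex_shrink

lemma add_smul_mem (h : AdmissibleRun A J Dx U L₀ m) {x : Vec d} (hx : x ∈ shrink A.X A.r A.δ)
    (v : UnitSphere d) : x + A.δ • (v : Vec d) ∈ A.X := by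
  refine h.set.closedBall_subset h.r_pos h.δ_pos h.δ_lt hx ?_
  rw [Metric.mem_closedBall, dist_self_add_left, norm_smul, norm_eq_of_mem_sphere, mul_one,
    Real.norm_of_nonneg h.δ_pos.le]

lemma iterate_mem (h : AdmissibleRun A J Dx U L₀ m) (u : ℕ → Vec d) (ξ : ℕ → ℕ → Ξ) (t : ℕ) :
    A.iterate J u ξ t ∈ shrink A.X A.r A.δ := by
  match t with
  | 0 => exact h.init
  | 1 => exact h.init
  | t + 2 => exact proj_mem h.isCompact_shrink h.shrink_nonempty _

lemma one_le_sample (h : AdmissibleRun A J Dx U L₀ m) {t : ℕ} (ht : 1 ≤ t) :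
    1 ≤ A.φ (epoch A.Δ t) :=
  h.sample_pos _ (epoch_mem h.Δ_pos ht)

lemma abs_cvarEstimate_le (h : AdmissibleRun A J Dx U L₀ m) {t : ℕ} (ht : 1 ≤ t)
    {x : Vec d} (hx : x ∈ shrink A.X A.r A.δ) (v : UnitSphere d) (ξ : ℕ → Ξ) :
    |A.cvarEstimate J t x v ξ| ≤ U :=
  (isBoundedCDF_empiricalCDF (h.one_le_sample ht) fun i =>
    h.cost.bounded _ (h.add_smul_mem hx v) (ξ i)).abs_cvar_le h.α_pos h.α_le

lemma norm_gradEstimate_le (h : AdmissibleRun A J Dx U L₀ m) {t : ℕ} (ht : 1 ≤ t)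
    {x : Vec d} (hx : x ∈ shrink A.X A.r A.δ) (v : UnitSphere d) (ξ : ℕ → Ξ) :
    ‖A.gradEstimate J t x v ξ‖ ≤ d / A.δ * U := by
  have h0 : 0 ≤ (d : ℝ) / A.δ := div_nonneg (Nat.cast_nonneg _) h.δ_pos.le
  rw [Params.gradEstimate, norm_smul, norm_eq_of_mem_sphere, mul_one, norm_mul,
    Real.norm_of_nonneg h0]
  exact mul_le_mul_of_nonneg_left (h.abs_cvarEstimate_le ht hx v ξ) h0

variable [MeasurableSpace Ξ] [BorelSpace Ξ]

lemma measurable_cvarEstimate (h : AdmissibleRun A J Dx U L₀ m) {t : ℕ} (ht : 1 ≤ t) :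
    Measurable fun q : shrink A.X A.r A.δ × (UnitSphere d × (ℕ → Ξ)) =>
      A.cvarEstimate J t q.1 q.2.1 q.2.2 := by
  have hJ : Measurable (Function.uncurry fun (x : A.X) ξ => J x ξ) := by
    refine measurable_uncurry_of_continuous_of_measurable (fun ξ => ?_)
      fun x => h.cost.measurable_noise x.2
    refine (LipschitzWith.of_dist_le' (K := L₀) fun x y => ?_).continuous
    rw [Real.dist_eq, Subtype.dist_eq, dist_eq_norm]
    exact h.cost.lipschitz_decision ξ x x.2 y y.2
  refine measurable_cvar_empiricalCDF (B := U)
    (Z := fun i (q : shrink A.X A.r A.δ × (UnitSphere d × (ℕ → Ξ))) =>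
      J (q.1 + A.δ • (q.2.1 : Vec d)) (q.2.2 i)) h.α_pos h.α_le (h.one_le_sample ht)
    (fun i => ?_) fun i q => h.cost.bounded _ (h.add_smul_mem q.1.2 q.2.1) _
  have hp : Measurable fun q : shrink A.X A.r A.δ × (UnitSphere d × (ℕ → Ξ)) =>
      (⟨q.1 + A.δ • (q.2.1 : Vec d), h.add_smul_mem q.1.2 q.2.1⟩ : A.X) := by
    refine Measurable.subtype_mk ?_
    exact (measurable_subtype_coe.comp measurable_fst).add
      ((measurable_subtype_coe.comp (measurable_fst.comp measurable_snd)).const_smul A.δ)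
  have hq : Measurable fun q : shrink A.X A.r A.δ × (UnitSphere d × (ℕ → Ξ)) => q.2.2 i :=
    (measurable_pi_apply i).comp (measurable_snd.comp measurable_snd)
  exact hJ.comp (hp.prodMk hq)

lemma measurable_gradEstimate (h : AdmissibleRun A J Dx U L₀ m) {t : ℕ} (ht : 1 ≤ t) :
    Measurable fun q : shrink A.X A.r A.δ × (UnitSphere d × (ℕ → Ξ)) =>
      A.gradEstimate J t q.1 q.2.1 q.2.2 :=
  ((h.measurable_cvarEstimate ht).const_mul _).smul
    (measurable_subtype_coe.comp (measurable_fst.comp measurable_snd))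

/-- Measurability of the CVaR estimate in the fresh randomness, for a frozen iterate. -/
lemma measurable_cvarEstimate_frozen (h : AdmissibleRun A J Dx U L₀ m) {t : ℕ} (ht : 1 ≤ t)
    {x : Vec d} (hx : x ∈ shrink A.X A.r A.δ) :
    Measurable fun q : UnitSphere d × (ℕ → Ξ) => A.cvarEstimate J t x q.1 q.2 := by
  have h1 : Measurable fun q : UnitSphere d × (ℕ → Ξ) => ((⟨x, hx⟩ : shrink A.X A.r A.δ), q) :=
    measurable_const.prodMk measurable_id
  have h2 := (h.measurable_cvarEstimate ht).comp h1
  exact h2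

lemma measurable_gradEstimate_frozen (h : AdmissibleRun A J Dx U L₀ m) {t : ℕ} (ht : 1 ≤ t)
    {x : Vec d} (hx : x ∈ shrink A.X A.r A.δ) :
    Measurable fun q : UnitSphere d × (ℕ → Ξ) => A.gradEstimate J t x q.1 q.2 := by
  have h1 : Measurable fun q : UnitSphere d × (ℕ → Ξ) => ((⟨x, hx⟩ : shrink A.X A.r A.δ), q) :=
    measurable_const.prodMk measurable_id
  have h2 := (h.measurable_gradEstimate ht).comp h1
  exact h2

variable {Ω : Type*} {u : ℕ → Ω → UnitSphere d} {ξ : ℕ → ℕ → Ω → Ξ}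

lemma measurable_iterate (h : AdmissibleRun A J Dx U L₀ m) (t : ℕ) :
    Measurable[past u ξ t] fun ω => (⟨A.iterate J (fun t => u t ω) (fun t i => ξ t i ω) t,
      h.iterate_mem _ _ t⟩ : shrink A.X A.r A.δ) := by
  match t with
  | 0 =>
    have h0 : Measurable[past u ξ 0] fun _ : Ω => (⟨A.x₀, h.init⟩ : shrink A.X A.r A.δ) :=
      measurable_const
    exact h0
  | 1 =>
    have h0 : Measurable[past u ξ 1] fun _ : Ω => (⟨A.x₀, h.init⟩ : shrink A.X A.r A.δ) :=
      measurable_const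
    exact h0
  | t + 2 =>
    have ih := measurable_iterate h (t + 1)
    have hstep : Measurable fun q : shrink A.X A.r A.δ × (UnitSphere d × (ℕ → Ξ)) =>
        (⟨proj (shrink A.X A.r A.δ) (q.1 - A.σ (epoch A.Δ (t + 1)) •
          A.gradEstimate J (t + 1) q.1 q.2.1 q.2.2),
          proj_mem h.isCompact_shrink h.shrink_nonempty _⟩ : shrink A.X A.r A.δ) := by
      refine Measurable.subtype_mk ?_
      have h1 := (h.measurable_gradEstimate (t := t + 1) (by omega)).const_smul
        (A.σ (epoch A.Δ (t + 1)))
      have h2 : Measurable fun q : shrink A.X A.r A.δ × (UnitSphere d × (ℕ → Ξ)) =>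
        (q.1 : Vec d) := measurable_subtype_coe.comp measurable_fst
      have h3 := (continuous_proj h.isCompact_shrink h.convex_shrink
        h.shrink_nonempty).measurable.comp (h2.sub h1)
      exact h3
    have hpast : past u ξ (t + 1) ≤ past u ξ (t + 2) := past_mono (Nat.le_succ _)
    have h4 := hstep.comp ((ih.mono hpast le_rfl).prodMk (measurable_fresh_past (t + 1)))
    exact h4

variable [m0 : MeasurableSpace Ω] {P : Measure Ω} [IsProbabilityMeasure P]
  {D : ℕ → Measure Ξ} [∀ t, IsProbabilityMeasure (D t)]

/-- The mean absolute error of the CVaR estimate, for a frozen iterate `x`. -/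
lemma integral_abs_cvarEstimate_sub_le (h : AdmissibleRun A J Dx U L₀ m)
    (hR : RandomInputs P D u ξ) {t : ℕ} (ht : 1 ≤ t) {x : Vec d}
    (hx : x ∈ shrink A.X A.r A.δ) :
    ∫ ω, |A.cvarEstimate J t x (u t ω) (fun i => ξ t i ω) -
        cvarCost A.α J (D t) (x + A.δ • (u t ω : Vec d))| ∂P ≤
      2 * U / A.α * (1 / √(A.φ (epoch A.Δ t))) := by
  have hCm : Measurable fun v : UnitSphere d =>
      cvarCost A.α J (D t) (x + A.δ • (v : Vec d)) := by
    refine Continuous.measurable ?_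
    exact (continuousOn_cvarCost h.cost h.α_pos h.α_le).comp_continuous (by fun_prop)
      fun v => h.add_smul_mem hx v
  have hm : Measurable fun q : UnitSphere d × (ℕ → Ξ) =>
      |A.cvarEstimate J t x q.1 q.2 - cvarCost A.α J (D t) (x + A.δ • (q.1 : Vec d))| := by
    have h1 := h.measurable_cvarEstimate_frozen ht hx
    have h2 := hCm.comp (measurable_fst : Measurable fun q : UnitSphere d × (ℕ → Ξ) => q.1)
    exact (h1.sub h2).abs
  have key := integral_indepFun_le (hR.measurable_direction t)
    (measurable_pi_lambda _ fun i => hR.measurable_noise t i) (hR.indepFun_direction_noise t)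
    hm (b := 2 * U) (e := 2 * U / A.α * (1 / √(A.φ (epoch A.Δ t))))
  refine key (fun q => ?_) fun v => ?_
  · have h1 := abs_le.1 (h.abs_cvarEstimate_le ht hx q.1 q.2)
    have h2 := abs_le.1 (abs_cvarCost_le (μ := D t) h.cost h.α_pos h.α_le (h.add_smul_mem hx q.1))
    rw [abs_abs, abs_le]
    constructor <;> linarith [h1.1, h1.2, h2.1, h2.2]
  · have hxv := h.add_smul_mem hx v
    have hJm := h.cost.measurable_noise hxv
    have hF : ∀ i y, P.real {ω | J (x + A.δ • (v : Vec d)) (ξ t i ω) ≤ y} =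
        costCDF J (D t) (x + A.δ • (v : Vec d)) y := fun i y => by
      have : {ω | J (x + A.δ • (v : Vec d)) (ξ t i ω) ≤ y} =
          ξ t i ⁻¹' {ζ | J (x + A.δ • (v : Vec d)) ζ ≤ y} := rfl
      rw [costCDF, cdf_map_apply hJm, this,
        ← map_measureReal_apply (hR.measurable_noise t i) (measurableSet_le hJm measurable_const),
        hR.law_noise]
    have key := integral_abs_cvar_empiricalCDF_sub_le
      (Z := fun i ω => J (x + A.δ • (v : Vec d)) (ξ t i ω)) h.α_pos h.α_le (h.one_le_sample ht)
      (fun i => hJm.comp (hR.measurable_noise t i)) (fun i ω => h.cost.bounded _ hxv _)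
      ((hR.iIndepFun_noise t).comp _ fun _ => hJm) (isBoundedCDF_costCDF h.cost hxv) hF
    exact key

lemma integral_sphereUniform (f : UnitSphere d → ℝ) :
    ∫ v, f v ∂(sphereUniform d) =
      ((volume : Measure (Vec d)).toSphere.real univ)⁻¹ *
        ∫ v, f v ∂((volume : Measure (Vec d)).toSphere) := by
  rw [sphereUniform, integral_smul_measure, ENNReal.toReal_inv, measureReal_def, smul_eq_mul]

/-- In the mean, the gradient estimate is an approximate strong subgradient of the objective. -/
lemma le_integral_inner_gradEstimate (hd : 0 < d) (h : AdmissibleRun A J Dx U L₀ m)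
    (hR : RandomInputs P D u ξ) {t : ℕ} (ht : 1 ≤ t) {x y : Vec d}
    (hx : x ∈ shrink A.X A.r A.δ) (hy : y ∈ shrink A.X A.r A.δ) :
    cvarCost A.α J (D t) x - cvarCost A.α J (D t) y + m / 2 * ‖x - y‖ ^ 2 -
        (2 * (L₀ / A.α) * A.δ +
          d / A.δ * (Dx * (2 * U / A.α * (1 / √(A.φ (epoch A.Δ t)))))) ≤
      ∫ ω, ⟪A.gradEstimate J t x (u t ω) (fun i => ξ t i ω), x - y⟫ ∂P := by
  set C := cvarCost A.α J (D t) with hC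
  set w := x - y with hw
  have hd0 : (0 : ℝ) < d := by exact_mod_cast hd
  have hdδ : 0 ≤ (d : ℝ) / A.δ := div_nonneg hd0.le h.δ_pos.le
  have : Nonempty (Fin d) := ⟨⟨0, hd⟩⟩
  have hnt : Nontrivial (Vec d) := inferInstance
  have hCc : Continuous fun v : UnitSphere d => C (x + A.δ • (v : Vec d)) :=
    (continuousOn_cvarCost h.cost h.α_pos h.α_le).comp_continuous (by fun_prop)
      fun v => h.add_smul_mem hx v
  have hwv : ∀ v : UnitSphere d, |⟪(v : Vec d), w⟫| ≤ ‖w‖ := fun v => by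
    simpa using abs_real_inner_le_norm (v : Vec d) w
  have hwD : ‖w‖ ≤ Dx := h.set.norm_sub_le hx.1 hy.1
  -- the smoothed objective
  have hsmooth : C x - C y + m / 2 * ‖w‖ ^ 2 - 2 * (L₀ / A.α) * A.δ ≤
      d / A.δ * ∫ ω, C (x + A.δ • (u t ω : Vec d)) * ⟪(u t ω : Vec d), w⟫ ∂P := by
    have h1 := le_integral_sphere (volume : Measure (Vec d)) h.set.isCompact
      (continuousOn_cvarCost (μ := D t) h.cost h.α_pos h.α_le)
      (fun a ha b hb => abs_cvarCost_sub_le (μ := D t) h.cost h.α_pos h.α_le ha hb)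
      (div_pos h.L₀_pos h.α_pos).le
      (strongConvexOn_cvarCost (μ := D t) h.set.convex h.cost h.α_pos h.α_le) h.δ_pos
      (h.set.closedBall_subset h.r_pos h.δ_pos h.δ_lt hx)
      (h.set.closedBall_subset h.r_pos h.δ_pos h.δ_lt hy)
    have hS : 0 < (volume : Measure (Vec d)).toSphere.real univ := by
      rw [measureReal_def]
      exact ENNReal.toReal_pos (by simp [hd.ne', (Metric.measure_ball_pos _ _ one_pos).ne'])
        (measure_ne_top _ _)
    have h2 : ∫ ω, C (x + A.δ • (u t ω : Vec d)) * ⟪(u t ω : Vec d), w⟫ ∂P =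
        ∫ v, C (x + A.δ • (v : Vec d)) * ⟪(v : Vec d), w⟫ ∂(sphereUniform d) := by
      rw [← hR.law_direction t, integral_map (hR.measurable_direction t).aemeasurable]
      exact (hCc.mul (by fun_prop)).aestronglyMeasurable
    rw [h2, integral_sphereUniform, mul_left_comm, le_inv_mul_iff₀ hS, mul_comm (Measure.real _ _)]
    rw [finrank_euclideanSpace_fin] at h1
    exact h1
  -- the sampling error
  have herr := h.integral_abs_cvarEstimate_sub_le hR ht hx
  have hcm : Measurable fun ω => A.cvarEstimate J t x (u t ω) (fun i => ξ t i ω) := by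
    have h1 := (h.measurable_cvarEstimate_frozen ht hx).comp (hR.measurable_fresh t)
    exact h1
  have hCm : Measurable fun ω => C (x + A.δ • (u t ω : Vec d)) := by
    have h1 := hCc.measurable.comp (hR.measurable_direction t)
    exact h1
  have hum : Measurable fun ω => ⟪(u t ω : Vec d), w⟫ :=
    (by fun_prop : Continuous fun v : UnitSphere d => ⟪(v : Vec d), w⟫).measurable.comp
      (hR.measurable_direction t)
  have hcb : ∀ ω, |A.cvarEstimate J t x (u t ω) (fun i => ξ t i ω)| ≤ U := fun ω =>
    h.abs_cvarEstimate_le ht hx _ _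
  have hCb : ∀ ω, |C (x + A.δ • (u t ω : Vec d))| ≤ U := fun ω =>
    abs_cvarCost_le h.cost h.α_pos h.α_le (h.add_smul_mem hx _)
  have hi1 : Integrable (fun ω => A.cvarEstimate J t x (u t ω) (fun i => ξ t i ω) *
      ⟪(u t ω : Vec d), w⟫) P := by
    refine Integrable.of_bound (hcm.mul hum).aestronglyMeasurable (U * ‖w‖) (.of_forall fun ω => ?_)
    rw [norm_mul]
    exact mul_le_mul (hcb ω) (hwv _) (abs_nonneg _) h.U_pos.le
  have hi2 : Integrable (fun ω => C (x + A.δ • (u t ω : Vec d)) * ⟪(u t ω : Vec d), w⟫) P := by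
    refine Integrable.of_bound (hCm.mul hum).aestronglyMeasurable (U * ‖w‖) (.of_forall fun ω => ?_)
    rw [norm_mul]
    exact mul_le_mul (hCb ω) (hwv _) (abs_nonneg _) h.U_pos.le
  have hi3 : Integrable (fun ω => |A.cvarEstimate J t x (u t ω) (fun i => ξ t i ω) -
      C (x + A.δ • (u t ω : Vec d))|) P := by
    refine Integrable.of_bound (hcm.sub hCm).abs.aestronglyMeasurable (2 * U)
      (.of_forall fun ω => ?_)
    have h1 := abs_le.1 (hcb ω)
    have h2 := abs_le.1 (hCb ω)
    rw [Real.norm_eq_abs, abs_abs, abs_le]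
    constructor <;> linarith [h1.1, h1.2, h2.1, h2.2]
  have hcomp : ∫ ω, (C (x + A.δ • (u t ω : Vec d)) * ⟪(u t ω : Vec d), w⟫ -
        Dx * |A.cvarEstimate J t x (u t ω) (fun i => ξ t i ω) - C (x + A.δ • (u t ω : Vec d))|) ∂P ≤
      ∫ ω, A.cvarEstimate J t x (u t ω) (fun i => ξ t i ω) * ⟪(u t ω : Vec d), w⟫ ∂P := by
    refine integral_mono (hi2.sub (hi3.const_mul _)) hi1 fun ω => ?_
    have h1 : |(A.cvarEstimate J t x (u t ω) (fun i => ξ t i ω) - C (x + A.δ • (u t ω : Vec d))) *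
        ⟪(u t ω : Vec d), w⟫| ≤ |A.cvarEstimate J t x (u t ω) (fun i => ξ t i ω) -
          C (x + A.δ • (u t ω : Vec d))| * Dx := by
      rw [abs_mul]
      exact mul_le_mul_of_nonneg_left ((hwv _).trans hwD) (abs_nonneg _)
    have h2 := (abs_le.1 h1).1
    simp only
    linarith
  rw [integral_sub hi2 (hi3.const_mul _), integral_const_mul] at hcomp
  have hDx : 0 ≤ Dx := (norm_nonneg _).trans hwD
  have e : ∀ ω, ⟪A.gradEstimate J t x (u t ω) (fun i => ξ t i ω), w⟫ =
      d / A.δ * (A.cvarEstimate J t x (u t ω) (fun i => ξ t i ω) * ⟪(u t ω : Vec d), w⟫) :=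
    fun ω => by
      rw [Params.gradEstimate, real_inner_smul_left, Params.cvarEstimate, mul_assoc]
  simp only [e]
  rw [integral_const_mul]
  have h3 := mul_le_mul_of_nonneg_left hcomp hdδ
  have h4 := mul_le_mul_of_nonneg_left (mul_le_mul_of_nonneg_left herr hDx) hdδ
  linarith

/-- The high-probability bound: with `B` the norm bound of the gradient estimates, the linearized
regret against deterministic comparators `y t` dominates the regret up to the systematic error, a
multiple of `log (1 / γ)`, and half of the strong convexity term, which pays for the fluctuations of
the martingale. -/
lemma one_sub_le_linearized (hd : 0 < d) (h : AdmissibleRun A J Dx U L₀ m)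
    (hR : RandomInputs P D u ξ) {y : ℕ → Vec d} (hy : ∀ t, y t ∈ shrink A.X A.r A.δ) (T : ℕ)
    {γ : ℝ} (hγ : 0 < γ) :
    ENNReal.ofReal (1 - γ) ≤ P {ω | ∑ t ∈ Finset.Icc 1 T,
      (cvarCost A.α J (D t) (A.iterate J (fun t => u t ω) (fun t i => ξ t i ω) t) -
        cvarCost A.α J (D t) (y t) +
        m / 4 * ‖A.iterate J (fun t => u t ω) (fun t i => ξ t i ω) t - y t‖ ^ 2 -
        (2 * (L₀ / A.α) * A.δ +
          d / A.δ * (Dx * (2 * U / A.α * (1 / √(A.φ (epoch A.Δ t)))))) -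
        ⟪A.gradEstimate J t (A.iterate J (fun t => u t ω) (fun t i => ξ t i ω) t) (u t ω)
          (fun i => ξ t i ω), A.iterate J (fun t => u t ω) (fun t i => ξ t i ω) t - y t⟫) ≤
      2 * (d / A.δ * U) ^ 2 / m * Real.log (1 / γ)} := by
  set B := d / A.δ * U with hB
  have hd0 : (0 : ℝ) < d := by exact_mod_cast hd
  have hB0 : 0 < B := mul_pos (div_pos hd0 h.δ_pos) h.U_pos
  have hm := h.m_pos
  -- with this `l`, the variance proxy `l * B ^ 2 / 2` is the share `m / 4` of the convexity modulus
  set l := m / (2 * B ^ 2) with hl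
  have hl0 : 0 < l := by positivity
  set K := shrink A.X A.r A.δ with hK
  set err : ℕ → ℝ := fun t => 2 * (L₀ / A.α) * A.δ +
    d / A.δ * (Dx * (2 * U / A.α * (1 / √(A.φ (epoch A.Δ t))))) with herr
  set κ : ℕ → K → ℝ := fun t x => cvarCost A.α J (D t) x - cvarCost A.α J (D t) (y t) +
    m / 2 * ‖(x : Vec d) - y t‖ ^ 2 - err t with hκ
  set Y : ℕ → K × (UnitSphere d × (ℕ → Ξ)) → ℝ := fun t q =>
    l * (κ t q.1 - ⟪A.gradEstimate J t q.1 q.2.1 q.2.2, (q.1 : Vec d) - y t⟫) -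
      l ^ 2 * (B * ‖(q.1 : Vec d) - y t‖) ^ 2 / 2 with hYdef
  set x : ℕ → Ω → K := fun t ω => ⟨A.iterate J (fun t => u t ω) (fun t i => ξ t i ω) t,
    h.iterate_mem _ _ t⟩ with hx
  have hcoe : Measurable fun q : K × (UnitSphere d × (ℕ → Ξ)) => (q.1 : Vec d) :=
    measurable_subtype_coe.comp measurable_fst
  have hκm : ∀ t, Measurable (κ t) := fun t => by
    have h1 : Continuous fun x : K => cvarCost A.α J (D t) x :=
      (continuousOn_cvarCost h.cost h.α_pos h.α_le).comp_continuous continuous_subtype_val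
        fun x => x.2.1
    refine Continuous.measurable ?_
    simp only [hκ]
    fun_prop
  have hYm : ∀ t, 1 ≤ t → Measurable (Y t) := fun t ht => by
    have h1 := h.measurable_gradEstimate ht
    have h2 := (hκm t).comp
      (measurable_fst : Measurable fun q : K × (UnitSphere d × (ℕ → Ξ)) => q.1)
    have h3 := Measurable.inner (𝕜 := ℝ) h1 (hcoe.sub_const (y t))
    exact ((h2.sub h3).const_mul l).sub
      ((((hcoe.sub_const (y t)).norm.const_mul B).pow_const 2).const_mul (l ^ 2) |>.div_const 2)
  have hexp : ∀ t, 1 ≤ t → ∀ e : K,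
      ∫⁻ ω, ENNReal.ofReal (Real.exp (Y t (e, fresh u ξ t ω))) ∂P ≤ 1 := fun t ht e => by
    have hZm : Measurable fun ω =>
        ⟪A.gradEstimate J t e (u t ω) (fun i => ξ t i ω), (e : Vec d) - y t⟫ := by
      have h1 : Measurable fun ω => A.gradEstimate J t e (u t ω) (fun i => ξ t i ω) := by
          have h2 := (h.measurable_gradEstimate_frozen ht e.2).comp (hR.measurable_fresh t)
          exact h2
      exact h1.inner measurable_const
    have key := lintegral_exp_le_one (P := P) hZm (b := B * ‖(e : Vec d) - y t‖) (by positivity)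
      (fun ω => ?_) (h.le_integral_inner_gradEstimate hd hR ht e.2 (hy t)) hl0.le
    · exact key
    refine (abs_real_inner_le_norm _ _).trans ?_
    gcongr
    exact h.norm_gradEstimate_le ht e.2 _ _
  have hsuper := lintegral_exp_sum_le_one (P := P) hR.past_le past_mono (h.measurable_iterate)
    measurable_fresh_past hR.indep_fresh hYm hexp T
  have hxm : ∀ t, Measurable (x t) := fun t => (h.measurable_iterate t).mono (hR.past_le t) le_rfl
  have hMm : Measurable fun ω => ∑ t ∈ Finset.Icc 1 T, Y t (x t ω, fresh u ξ t ω) :=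
    Finset.measurable_sum _ fun t ht =>
      (hYm t (Finset.mem_Icc.1 ht).1).comp ((hxm t).prodMk (hR.measurable_fresh t))
  refine (one_sub_le_of_lintegral_exp_le_one hMm hsuper hγ).trans (measure_mono fun ω hω => ?_)
  simp only [mem_ofPred_eq] at hω ⊢
  have e1 : ∀ t, Y t (x t ω, fresh u ξ t ω) = l *
      (cvarCost A.α J (D t) (x t ω) - cvarCost A.α J (D t) (y t) +
        m / 4 * ‖(x t ω : Vec d) - y t‖ ^ 2 - err t -
        ⟪A.gradEstimate J t (x t ω) (u t ω) (fun i => ξ t i ω), (x t ω : Vec d) - y t⟫) :=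
    fun t => by
      simp only [hYdef, hκ, fresh]
      have : l ^ 2 * (B * ‖(x t ω : Vec d) - y t‖) ^ 2 / 2 =
          l * (m / 4 * ‖(x t ω : Vec d) - y t‖ ^ 2) := by
        have : l * B ^ 2 = m / 2 := by rw [hl]; field_simp
        calc _ = l * (l * B ^ 2) * ‖(x t ω : Vec d) - y t‖ ^ 2 / 2 := by ring
          _ = _ := by rw [this]; ring
      rw [this]; ring
  simp only [e1, ← Finset.mul_sum] at hω
  rw [← le_div_iff₀' hl0] at hω
  refine hω.trans (le_of_eq ?_)
  rw [hl]; field_simp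

end AdmissibleRun

/-! ### Restarted projected gradient descent -/

section BatchSums

variable {Δ T : ℕ}

/-- The first iteration of the batch that contains iteration `t`. -/
noncomputable def batchStart (Δ t : ℕ) : ℕ := (batch Δ t - 1) * Δ + 1

lemma batchStart_eq (hΔ : 1 ≤ Δ) {t : ℕ} (ht : 1 ≤ t) : batchStart Δ t = (t - 1) / Δ * Δ + 1 := by
  rw [batchStart, batch_eq hΔ ht, Nat.add_sub_cancel]

lemma batchStart_le (hΔ : 1 ≤ Δ) {t : ℕ} (ht : 1 ≤ t) : batchStart Δ t ≤ t := by
  rw [batchStart_eq hΔ ht]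
  have := Nat.div_mul_le_self (t - 1) Δ
  omega

lemma lt_batchStart_add (hΔ : 1 ≤ Δ) {t : ℕ} (ht : 1 ≤ t) : t < batchStart Δ t + Δ := by
  rw [batchStart_eq hΔ ht]
  have h1 := Nat.mod_lt (t - 1) hΔ
  have h2 := Nat.div_add_mod' (t - 1) Δ
  omega

/-- Either a new batch begins, or the epoch advances within the same batch. -/
lemma epoch_succ (hΔ : 1 ≤ Δ) {t : ℕ} (ht : 1 ≤ t) : epoch Δ (t + 1) = 1 ∨
    (epoch Δ (t + 1) = epoch Δ t + 1 ∧ batchStart Δ (t + 1) = batchStart Δ t) := by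
  rw [epoch_eq hΔ ht, epoch_eq hΔ (by omega), batchStart_eq hΔ ht, batchStart_eq hΔ (by omega)]
  obtain ⟨k, rfl⟩ : ∃ k, t = k + 1 := ⟨t - 1, by omega⟩
  simp only [Nat.add_sub_cancel]
  by_cases h : Δ ∣ k + 1
  · left
    rw [Nat.dvd_iff_mod_eq_zero] at h
    omega
  · right
    rw [Nat.succ_div_of_not_dvd h]
    refine ⟨?_, rfl⟩
    have h1 := Nat.div_add_mod' (k + 1) Δ
    have h2 := Nat.div_add_mod' k Δ
    rw [Nat.succ_div_of_not_dvd h] at h1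
    omega

lemma sum_range_mul_mod (f : ℕ → ℝ) (N : ℕ) :
    ∑ i ∈ Finset.range (N * Δ), f (i % Δ) = N * ∑ i ∈ Finset.range Δ, f i := by
  induction N with
  | zero => simp
  | succ N ih =>
    rw [Nat.succ_mul, Finset.sum_range_add, ih]
    have : ∀ i ∈ Finset.range Δ, f ((N * Δ + i) % Δ) = f i := fun i hi => by
      rw [mul_comm, Nat.mul_add_mod, Nat.mod_eq_of_lt (Finset.mem_range.1 hi)]
    rw [Finset.sum_congr rfl this]
    push_cast
    ring

/-- A sum over iterations of a function of the epoch is at most a sum over `2 T / Δ` full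
batches. -/
lemma sum_epoch_le (hΔ : 1 ≤ Δ) (hΔT : Δ ≤ T) {f : ℕ → ℝ} (hf : ∀ τ ∈ Finset.Icc 1 Δ, 0 ≤ f τ) :
    ∑ t ∈ Finset.Icc 1 T, f (epoch Δ t) ≤ 2 * T / Δ * ∑ τ ∈ Finset.Icc 1 Δ, f τ := by
  have hΔ0 : (0 : ℝ) < Δ := by exact_mod_cast hΔ
  have e : ∀ n (g : ℕ → ℝ), ∑ t ∈ Finset.Icc 1 n, g t = ∑ i ∈ Finset.range n, g (i + 1) := by
    intro n g
    rw [Finset.range_eq_Ico, Finset.sum_Ico_add' g 0 n 1]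
    rfl
  have hTN : T ≤ (T / Δ + 1) * Δ := by
    rw [mul_comm]; exact (Nat.lt_mul_div_succ T hΔ).le
  have hS : 0 ≤ ∑ τ ∈ Finset.Icc 1 Δ, f τ := Finset.sum_nonneg hf
  have hnn : ∀ i : ℕ, 0 ≤ f (i % Δ + 1) := fun i => hf _ (by
    have := Nat.mod_lt i hΔ
    rw [Finset.mem_Icc]; omega)
  calc ∑ t ∈ Finset.Icc 1 T, f (epoch Δ t) = ∑ i ∈ Finset.range T, f (i % Δ + 1) := by
        rw [e]
        refine Finset.sum_congr rfl fun i _ => ?_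
        rw [epoch_eq hΔ (by omega), Nat.add_sub_cancel]
    _ ≤ ∑ i ∈ Finset.range ((T / Δ + 1) * Δ), f (i % Δ + 1) :=
        Finset.sum_le_sum_of_subset_of_nonneg (Finset.range_mono hTN) fun i _ _ => hnn i
    _ = ((T / Δ + 1 : ℕ) : ℝ) * ∑ τ ∈ Finset.Icc 1 Δ, f τ := by
        rw [e, sum_range_mul_mod fun i => f (i + 1)]
    _ ≤ 2 * T / Δ * ∑ τ ∈ Finset.Icc 1 Δ, f τ := by
        refine mul_le_mul_of_nonneg_right ?_ hS
        have h1 : ((T / Δ : ℕ) : ℝ) ≤ T / Δ := Nat.cast_div_le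
        have h2 : (1 : ℝ) ≤ T / Δ := by rw [one_le_div hΔ0]; exact_mod_cast hΔT
        push_cast
        calc ((T / Δ : ℕ) : ℝ) + 1 ≤ T / Δ + T / Δ := add_le_add h1 h2
          _ = 2 * T / Δ := by ring

lemma sum_one_div_le (n : ℕ) : ∑ τ ∈ Finset.Icc 1 n, 1 / (τ : ℝ) ≤ 1 + Real.log n := by
  have h := harmonic_le_one_add_log n
  rw [harmonic_eq_sum_Icc] at h
  push_cast at h
  simpa only [one_div] using h

end BatchSums

/-- The accumulated drift `∑ w i` over the transitions `i → i + 1` that may lie between the start of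
the batch of `t` and `t`. -/
noncomputable def drift (w : ℕ → ℝ) (Δ T t : ℕ) : ℝ :=
  ∑ i ∈ Finset.Ico 1 T with i + 1 ≤ t ∧ t < i + 1 + Δ, w i

lemma sum_drift_le {w : ℕ → ℝ} (hw : ∀ i, 0 ≤ w i) (Δ T : ℕ) :
    ∑ t ∈ Finset.Icc 1 T, drift w Δ T t ≤ Δ * ∑ i ∈ Finset.Ico 1 T, w i := by
  simp only [drift, Finset.sum_filter]
  rw [Finset.sum_comm, Finset.mul_sum]
  refine Finset.sum_le_sum fun i _ => ?_
  rw [← Finset.sum_filter, Finset.sum_const, nsmul_eq_mul]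
  refine mul_le_mul_of_nonneg_right ?_ (hw i)
  have hsub : (Finset.Icc 1 T).filter (fun t => i + 1 ≤ t ∧ t < i + 1 + Δ) ⊆
      Finset.Ico (i + 1) (i + 1 + Δ) := fun t ht => by
    rw [Finset.mem_filter] at ht
    exact Finset.mem_Ico.2 ht.2
  have := Finset.card_le_card hsub
  rw [Nat.card_Ico] at this
  exact_mod_cast this.trans (by omega)

lemma abs_sub_batchStart_le {w : ℕ → ℝ} (hw : ∀ i, 0 ≤ w i) {Δ T t : ℕ} (hΔ : 1 ≤ Δ) (ht : 1 ≤ t)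
    (htT : t ≤ T) {f : ℕ → ℝ} (hf : ∀ i ∈ Finset.Ico 1 T, |f i - f (i + 1)| ≤ w i) :
    |f (batchStart Δ t) - f t| ≤ drift w Δ T t := by
  have h1 := dist_le_Ico_sum_dist f (batchStart_le hΔ ht)
  have hs : 1 ≤ batchStart Δ t := by rw [batchStart]; omega
  have hlt := lt_batchStart_add hΔ ht
  rw [Real.dist_eq] at h1
  refine h1.trans ((Finset.sum_le_sum fun i hi => ?_).trans
    (Finset.sum_le_sum_of_subset_of_nonneg (f := w) ?_ fun i _ _ => hw i))
  · rw [Finset.mem_Ico] at hi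
    exact hf i (Finset.mem_Ico.2 (by omega))
  · intro i hi
    rw [Finset.mem_Ico] at hi
    rw [Finset.mem_filter, Finset.mem_Ico]
    omega

lemma Params.iterate_succ {d : ℕ} {Ξ : Type*} {A : Params d} {J : Vec d → Ξ → ℝ}
    {t : ℕ} (ht : 1 ≤ t) (u : ℕ → Vec d) (ξ : ℕ → ℕ → Ξ) :
    A.iterate J u ξ (t + 1) = proj (shrink A.X A.r A.δ)
      (A.iterate J u ξ t - A.σ (epoch A.Δ t) •
        A.gradEstimate J t (A.iterate J u ξ t) (u t) (ξ t)) := by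
  obtain ⟨k, rfl⟩ : ∃ k, t = k + 1 := ⟨t - 1, by omega⟩
  rfl

namespace AdmissibleRun

variable {d : ℕ} {Ξ : Type*} [MetricSpace Ξ] {A : Params d} {J : Vec d → Ξ → ℝ} {Dx U L₀ m : ℝ}
  {u : ℕ → UnitSphere d} {ξ : ℕ → ℕ → Ξ}

/-- The one-step inequality of projected gradient descent. -/
lemma inner_gradEstimate_le (h : AdmissibleRun A J Dx U L₀ m) (hσ : ∀ τ : ℕ, A.σ τ = 1 / (m * τ))
    {t : ℕ} (ht : 1 ≤ t) {z : Vec d} (hz : z ∈ shrink A.X A.r A.δ) :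
    ⟪A.gradEstimate J t (A.iterate J (fun t => u t) ξ t) (u t) (ξ t),
        A.iterate J (fun t => u t) ξ t - z⟫ ≤
      m / 2 * epoch A.Δ t * (‖A.iterate J (fun t => u t) ξ t - z‖ ^ 2 -
        ‖A.iterate J (fun t => u t) ξ (t + 1) - z‖ ^ 2) +
        (d / A.δ * U) ^ 2 / (2 * m) * (1 / epoch A.Δ t) := by
  have hx := h.iterate_mem (fun t => (u t : Vec d)) ξ t
  set x := A.iterate J (fun t => (u t : Vec d)) ξ t with hxdef
  have hg : ‖A.gradEstimate J t x (u t) (ξ t)‖ ≤ d / A.δ * U := h.norm_gradEstimate_le ht hx _ _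
  rw [Params.iterate_succ ht, ← hxdef]
  set g := A.gradEstimate J t x (u t) (ξ t)
  set B := d / A.δ * U
  have hm := h.m_pos
  have hτ : (0 : ℝ) < epoch A.Δ t := by
    exact_mod_cast (Finset.mem_Icc.1 (epoch_mem h.Δ_pos ht)).1
  rw [hσ]
  set τ : ℝ := (epoch A.Δ t : ℝ)
  have h1 := norm_proj_sub_le h.isCompact_shrink h.convex_shrink h.shrink_nonempty
    (x - (1 / (m * τ)) • g) z
  rw [proj_of_mem h.isCompact_shrink h.convex_shrink hz] at h1
  have h2 : ‖proj (shrink A.X A.r A.δ) (x - (1 / (m * τ)) • g) - z‖ ^ 2 ≤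
      ‖x - z‖ ^ 2 - 2 * (1 / (m * τ) * ⟪g, x - z⟫) + (1 / (m * τ)) ^ 2 * ‖g‖ ^ 2 := by
    calc _ ≤ ‖x - (1 / (m * τ)) • g - z‖ ^ 2 := by gcongr
      _ = ‖(x - z) - (1 / (m * τ)) • g‖ ^ 2 := by congr 2; abel
      _ = _ := by
        rw [norm_sub_sq_real, real_inner_smul_right, norm_smul, mul_pow, Real.norm_eq_abs, sq_abs,
          real_inner_comm]
  have h3 : (1 / (m * τ)) ^ 2 * ‖g‖ ^ 2 ≤ (1 / (m * τ)) ^ 2 * B ^ 2 := by gcongr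
  have h4 : m / 2 * τ * (2 * (1 / (m * τ) * ⟪g, x - z⟫)) ≤ m / 2 * τ * (‖x - z‖ ^ 2 -
      ‖proj (shrink A.X A.r A.δ) (x - (1 / (m * τ)) • g) - z‖ ^ 2 +
        (1 / (m * τ)) ^ 2 * B ^ 2) := by
    refine mul_le_mul_of_nonneg_left (by linarith) (by positivity)
  have e1 : m / 2 * τ * (2 * (1 / (m * τ) * ⟪g, x - z⟫)) = ⟪g, x - z⟫ := by field_simp
  have e2 : m / 2 * τ * ((1 / (m * τ)) ^ 2 * B ^ 2) = B ^ 2 / (2 * m) * (1 / τ) := by field_simp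
  rw [e1, mul_add, e2] at h4
  exact h4

/-- The linearized regret of restarted gradient descent with step sizes `1 / (m τ)`. The potential
`m / 2 * (τ - 1) * ‖x t - y t‖ ^ 2` telescopes within a batch and vanishes at its first iteration,
where the comparator may change. -/
lemma sum_inner_gradEstimate_le (h : AdmissibleRun A J Dx U L₀ m)
    (hσ : ∀ τ : ℕ, A.σ τ = 1 / (m * τ)) {y : ℕ → Vec d} (hy : ∀ s, y s ∈ shrink A.X A.r A.δ)
    (T : ℕ) :
    ∑ t ∈ Finset.Icc 1 T, ⟪A.gradEstimate J t (A.iterate J (fun t => u t) ξ t) (u t) (ξ t),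
        A.iterate J (fun t => u t) ξ t - y (batchStart A.Δ t)⟫ ≤
      ∑ t ∈ Finset.Icc 1 T,
        (m / 2 * ‖A.iterate J (fun t => u t) ξ t - y (batchStart A.Δ t)‖ ^ 2 +
          (d / A.δ * U) ^ 2 / (2 * m) * (1 / epoch A.Δ t)) := by
  set x : ℕ → Vec d := A.iterate J (fun t => u t) ξ with hx
  have hm := h.m_pos
  have hτ : ∀ t, 1 ≤ t → (1 : ℝ) ≤ epoch A.Δ t := fun t ht => by
    exact_mod_cast (Finset.mem_Icc.1 (epoch_mem h.Δ_pos ht)).1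
  have key : ∀ T : ℕ,
      ∑ t ∈ Finset.Icc 1 T, ⟪A.gradEstimate J t (x t) (u t) (ξ t), x t - y (batchStart A.Δ t)⟫ ≤
      ∑ t ∈ Finset.Icc 1 T, (m / 2 * ‖x t - y (batchStart A.Δ t)‖ ^ 2 +
          (d / A.δ * U) ^ 2 / (2 * m) * (1 / epoch A.Δ t)) -
        m / 2 * (epoch A.Δ (T + 1) - 1) * ‖x (T + 1) - y (batchStart A.Δ (T + 1))‖ ^ 2 := by
    intro T
    induction T with
    | zero => simp [epoch_eq h.Δ_pos le_rfl]
    | succ T ih =>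
      rw [Finset.sum_Icc_succ_top (by omega), Finset.sum_Icc_succ_top (by omega)]
      have h1 := h.inner_gradEstimate_le (u := u) (ξ := ξ) hσ (t := T + 1) (by omega)
        (hy (batchStart A.Δ (T + 1)))
      rw [← hx] at h1
      have h2 : m / 2 * (epoch A.Δ (T + 1 + 1) - 1) *
          ‖x (T + 1 + 1) - y (batchStart A.Δ (T + 1 + 1))‖ ^ 2 ≤
          m / 2 * epoch A.Δ (T + 1) * ‖x (T + 1 + 1) - y (batchStart A.Δ (T + 1))‖ ^ 2 := by
        rcases epoch_succ h.Δ_pos (t := T + 1) (by omega) with h3 | ⟨h3, h4⟩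
        · rw [h3]
          have := hτ (T + 1) (by omega)
          have : 0 ≤ m / 2 * epoch A.Δ (T + 1) *
            ‖x (T + 1 + 1) - y (batchStart A.Δ (T + 1))‖ ^ 2 := by positivity
          simpa using this
        · rw [h3, h4]
          push_cast
          simp
      linarith
  refine (key T).trans (sub_le_self _ ?_)
  have := hτ (T + 1) (by omega)
  exact mul_nonneg (mul_nonneg (by positivity) (by linarith)) (by positivity)

lemma bound_nonneg (h : AdmissibleRun A J Dx U L₀ m) : 0 ≤ Dx :=
  (norm_nonneg _).trans (h.set.norm_sub_le h.init.1 h.init.1)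

variable [MeasurableSpace Ξ] [BorelSpace Ξ] {D : ℕ → Measure Ξ} [∀ t, IsProbabilityMeasure (D t)]

/-- The comparator of a batch: the minimizer over the shrunken set of the objective at time `s`. -/
noncomputable def comparator (A : Params d) (J : Vec d → Ξ → ℝ) (D : ℕ → Measure Ξ) (s : ℕ) :
    Vec d :=
  argmin (shrink A.X A.r A.δ) (cvarCost A.α J (D s))

lemma comparator_spec (h : AdmissibleRun A J Dx U L₀ m) (s : ℕ) :
    comparator A J D s ∈ shrink A.X A.r A.δ ∧
      ∀ z ∈ shrink A.X A.r A.δ,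
        cvarCost A.α J (D s) (comparator A J D s) ≤ cvarCost A.α J (D s) z :=
  argmin_spec h.isCompact_shrink h.shrink_nonempty
    ((continuousOn_cvarCost h.cost h.α_pos h.α_le).mono shrink_subset)

/-- Dynamic regret in terms of the linearized bound `Λ`: the quadratic growth of the objective
around the comparators bounds the squared distances that are left over by the regret itself. -/
theorem dynamicRegret_le (h : AdmissibleRun A J Dx U L₀ m) (hσ : ∀ τ : ℕ, A.σ τ = 1 / (m * τ))
    {T : ℕ} {w : ℕ → ℝ} (hw : ∀ i, 0 ≤ w i)
    (hdrift : ∀ i ∈ Finset.Ico 1 T, ∀ x ∈ A.X,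
      |cvarCost A.α J (D i) x - cvarCost A.α J (D (i + 1)) x| ≤ w i)
    {err : ℕ → ℝ} {Λ : ℝ}
    (hΛ : ∑ t ∈ Finset.Icc 1 T,
      (cvarCost A.α J (D t) (A.iterate J (fun t => u t) ξ t) -
        cvarCost A.α J (D t) (comparator A J D (batchStart A.Δ t)) +
        m / 4 * ‖A.iterate J (fun t => u t) ξ t - comparator A J D (batchStart A.Δ t)‖ ^ 2 -
        err t -
        ⟪A.gradEstimate J t (A.iterate J (fun t => u t) ξ t) (u t) (ξ t),
          A.iterate J (fun t => u t) ξ t - comparator A J D (batchStart A.Δ t)⟫) ≤ Λ) :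
    A.dynamicRegret J D T (fun t => u t) ξ ≤
      T * (L₀ / A.α * A.δ * (1 + Dx / A.r)) + 2 * Λ + 2 * ∑ t ∈ Finset.Icc 1 T, err t +
        (d / A.δ * U) ^ 2 / m * ∑ t ∈ Finset.Icc 1 T, 1 / (epoch A.Δ t : ℝ) +
        4 * (A.Δ * ∑ i ∈ Finset.Ico 1 T, w i) := by
  have hcomp := h.comparator_spec (D := D)
  have hogd := h.sum_inner_gradEstimate_le (u := u) (ξ := ξ) hσ (fun s => (hcomp s).1) T
  have hxm := h.iterate_mem (fun t => (u t : Vec d)) ξ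
  set x : ℕ → Vec d := A.iterate J (fun t => u t) ξ with hx
  set y : ℕ → Vec d := fun t => comparator A J D (batchStart A.Δ t) with hy
  set C : ℕ → Vec d → ℝ := fun t => cvarCost A.α J (D t) with hC
  set L := L₀ / A.α with hL
  have hL0 : 0 < L := div_pos h.L₀_pos h.α_pos
  set v : ℕ → ℝ := drift w A.Δ T with hv
  have hδ := h.δ_pos
  have hr := h.r_pos
  have hm := h.m_pos
  have hlip : ∀ t, ∀ a ∈ A.X, ∀ b ∈ A.X, |C t a - C t b| ≤ L * ‖a - b‖ := fun t a ha b hb =>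
    abs_cvarCost_sub_le h.cost h.α_pos h.α_le ha hb
  have hshift : ∀ t ∈ Finset.Icc 1 T, ∀ z ∈ A.X, |C (batchStart A.Δ t) z - C t z| ≤ v t :=
    fun t ht z hz => by
      rw [Finset.mem_Icc] at ht
      exact abs_sub_batchStart_le hw h.Δ_pos ht.1 ht.2 (f := fun t => C t z)
        fun i hi => hdrift i hi z hz
  -- quadratic growth at the comparators
  have hgrow : ∀ t ∈ Finset.Icc 1 T, m / 4 * ‖x t - y t‖ ^ 2 ≤
      (C t (x t) - C t (y t)) / 2 + v t := fun t ht => by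
    have h1 := quadratic_growth
      (strongConvexOn_cvarCost (μ := D (batchStart A.Δ t)) h.set.convex h.cost h.α_pos h.α_le)
      shrink_subset h.convex_shrink (hxm t) (hcomp (batchStart A.Δ t)).1
      (hcomp (batchStart A.Δ t)).2
    have h2 := abs_le.1 (hshift t ht (x t) (hxm t).1)
    have h3 := abs_le.1 (hshift t ht (y t) (hcomp _).1.1)
    change m / 2 * ‖x t - y t‖ ^ 2 ≤ C (batchStart A.Δ t) (x t) - C (batchStart A.Δ t) (y t) at h1
    linarith [h2.1, h2.2, h3.1, h3.2]
  -- comparison of the comparators with the minimizers over the whole set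
  have hpoint : ∀ t ∈ Finset.Icc 1 T,
      C t (A.action J (fun t => u t) ξ t) - C t (argmin A.X (C t)) ≤
        L * A.δ * (1 + Dx / A.r) + (C t (x t) - C t (y t)) + 2 * v t := fun t ht => by
    set xs := argmin A.X (C t) with hxs
    have hxsX : xs ∈ A.X := (argmin_spec h.set.isCompact ⟨_, h.init.1⟩
      (continuousOn_cvarCost h.cost h.α_pos h.α_le)).1
    have h1 : C t (A.action J (fun t => u t) ξ t) - C t (x t) ≤ L * A.δ := by
      refine (abs_le.1 (hlip t _ (h.add_smul_mem (hxm t) (u t)) _ (hxm t).1)).2.trans (le_of_eq ?_)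
      rw [add_sub_cancel_left, norm_smul, norm_eq_of_mem_sphere, mul_one,
        Real.norm_of_nonneg hδ.le]
    have hz := h.set.smul_mem_shrink hr hδ h.δ_lt hxsX
    have h2 : C (batchStart A.Δ t) (y t) ≤ C (batchStart A.Δ t) xs + L * (A.δ / A.r * Dx) := by
      refine ((hcomp _).2 _ hz).trans ?_
      have h3 := (abs_le.1 (hlip (batchStart A.Δ t) _ hz.1 _ hxsX)).2
      have h4 : ‖(1 - A.δ / A.r) • xs - xs‖ ≤ A.δ / A.r * Dx := by
        have : (1 - A.δ / A.r) • xs - xs = -((A.δ / A.r) • xs) := by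
          rw [sub_smul, one_smul]; abel
        rw [this, norm_neg, norm_smul, Real.norm_of_nonneg (by positivity)]
        gcongr
        simpa using h.set.norm_sub_le hxsX (h.set.zero_mem hr)
      have h5 := mul_le_mul_of_nonneg_left h4 hL0.le
      change C (batchStart A.Δ t) _ ≤ _
      linarith
    have h3 := abs_le.1 (hshift t ht xs hxsX)
    have h4 := abs_le.1 (hshift t ht (y t) (hcomp _).1.1)
    have h5 : L * A.δ * (1 + Dx / A.r) = L * A.δ + L * (A.δ / A.r * Dx) := by ring
    linarith [h3.1, h3.2, h4.1, h4.2]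
  have hsv : ∑ t ∈ Finset.Icc 1 T, v t ≤ A.Δ * ∑ i ∈ Finset.Ico 1 T, w i := sum_drift_le hw _ _
  have hsg := Finset.sum_le_sum hgrow
  have hsp := Finset.sum_le_sum hpoint
  change ∑ t ∈ Finset.Icc 1 T, (C t (x t) - C t (y t) + m / 4 * ‖x t - y t‖ ^ 2 - err t -
    ⟪A.gradEstimate J t (x t) (u t) (ξ t), x t - y t⟫) ≤ Λ at hΛ
  change ∑ t ∈ Finset.Icc 1 T, ⟪A.gradEstimate J t (x t) (u t) (ξ t), x t - y t⟫ ≤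
    ∑ t ∈ Finset.Icc 1 T, (m / 2 * ‖x t - y t‖ ^ 2 +
      (d / A.δ * U) ^ 2 / (2 * m) * (1 / epoch A.Δ t)) at hogd
  have hDR : A.dynamicRegret J D T (fun t => u t) ξ = ∑ t ∈ Finset.Icc 1 T,
      (C t (A.action J (fun t => u t) ξ t) - C t (argmin A.X (C t))) := by
    rw [Params.dynamicRegret, Finset.sum_sub_distrib]
  rw [hDR]
  set R := ∑ t ∈ Finset.Icc 1 T, (C t (x t) - C t (y t)) with hR
  set Q := ∑ t ∈ Finset.Icc 1 T, ‖x t - y t‖ ^ 2 with hQ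
  rw [Finset.sum_sub_distrib, Finset.sum_sub_distrib, Finset.sum_add_distrib, ← hR,
    ← Finset.mul_sum, ← hQ] at hΛ
  rw [Finset.sum_add_distrib, ← Finset.mul_sum, ← Finset.mul_sum, ← hQ] at hogd
  rw [Finset.sum_add_distrib, ← Finset.mul_sum, ← hQ, ← Finset.sum_div, ← hR] at hsg
  rw [Finset.sum_add_distrib, Finset.sum_add_distrib, ← hR, Finset.sum_const,
    Nat.card_Icc, Nat.add_sub_cancel, nsmul_eq_mul, ← Finset.mul_sum] at hsp
  have e : (d / A.δ * U) ^ 2 / m * ∑ t ∈ Finset.Icc 1 T, 1 / (epoch A.Δ t : ℝ) =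
      2 * ((d / A.δ * U) ^ 2 / (2 * m) * ∑ t ∈ Finset.Icc 1 T, 1 / (epoch A.Δ t : ℝ)) := by
    field_simp
  linarith

end AdmissibleRun

/-! ### Tuning -/

section Tuning

lemma IsRounding.bounds {n T : ℕ} {q : ℝ} (h : IsRounding n q) (hq : 1 < q) (hqT : q < T) :
    1 ≤ n ∧ n ≤ T ∧ q / 2 ≤ n ∧ (n : ℝ) ≤ 2 * q := by
  have hf1 : 1 ≤ ⌊q⌋₊ := Nat.one_le_floor_iff _ |>.2 hq.le
  have hf1' : (1 : ℝ) ≤ ⌊q⌋₊ := by exact_mod_cast hf1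
  have hf2 := Nat.lt_floor_add_one q
  have hf3 : (⌊q⌋₊ : ℝ) ≤ q := Nat.floor_le (by linarith)
  have hc1 := Nat.le_ceil q
  have hc2 := Nat.ceil_lt_add_one (show 0 ≤ q by linarith)
  have hc3 : ⌈q⌉₊ ≤ T := Nat.ceil_le.2 hqT.le
  rcases h with rfl | rfl
  · exact ⟨hf1, by exact_mod_cast hf3.trans hqT.le, by linarith, by linarith⟩
  · refine ⟨by exact_mod_cast (show (0 : ℝ) < ⌈q⌉₊ by linarith), hc3, by linarith, by linarith⟩

variable {T V s a q δ D : ℝ}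

lemma mul_smoothing_eq (hT : 0 < T) (hV : 0 < V) :
    T * (V / T) ^ s = T ^ (1 - s) * V ^ s := by
  rw [Real.div_rpow hV.le hT.le, Real.rpow_sub hT, Real.rpow_one]
  ring

lemma batch_mul_eq (hT : 0 < T) (hV : 0 < V) :
    (T / V) ^ (1 - s) * V = T ^ (1 - s) * V ^ s := by
  rw [Real.div_rpow hT.le hV.le, Real.rpow_sub hV, Real.rpow_one]
  have : V ^ s ≠ 0 := (Real.rpow_pos_of_pos hV s).ne'
  field_simp

lemma smoothing_eq (hT : 0 < T) (hV : 0 < V) : (V / T) ^ s = (T / V) ^ (-s) := by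
  rw [Real.rpow_neg (by positivity), ← Real.inv_rpow (by positivity), inv_div]

/-- The cost of restarting. -/
lemma restart_le (hT : 0 < T) (hV : 0 < V) (hρ : 1 < T / V) (hs4 : s ≤ 1 / 4)
    (hD : (T / V) ^ (1 - s) / 2 ≤ D) :
    T / D / ((V / T) ^ s) ^ 2 ≤ 2 * (T ^ (1 - s) * V ^ s) := by
  rw [← mul_smoothing_eq hT hV, smoothing_eq hT hV]
  set ρ := T / V
  have hρ0 : 0 < ρ := by linarith
  have hδ : 0 < ρ ^ (-s) := Real.rpow_pos_of_pos hρ0 _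
  have hq : 0 < ρ ^ (1 - s) := Real.rpow_pos_of_pos hρ0 _
  have hD0 : 0 < D := by linarith
  have h1 : 1 ≤ ρ ^ (1 - s) * (ρ ^ (-s)) ^ 3 := by
    rw [← Real.rpow_natCast (ρ ^ (-s)) 3, ← Real.rpow_mul hρ0.le, ← Real.rpow_add hρ0]
    refine Real.one_le_rpow hρ.le ?_
    push_cast
    linarith
  rw [div_div, div_le_iff₀ (by positivity)]
  have h2 : 1 ≤ 2 * D * (ρ ^ (-s)) ^ 3 := h1.trans (by gcongr; linarith)
  calc T = T * 1 := (mul_one T).symm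
    _ ≤ T * (2 * D * (ρ ^ (-s)) ^ 3) := by gcongr
    _ = _ := by ring

/-- The cost of sampling. -/
lemma sampling_le (hT : 0 < T) (hV : 0 < V) (hρ : 1 < T / V) (ha : 0 < a)
    (hsa : 4 * s ≤ (1 - s) * a) (hD : (T / V) ^ (1 - s) / 2 ≤ D) :
    T / D * D ^ (1 - a / 2) / (V / T) ^ s ≤ 2 ^ (a / 2) * (T ^ (1 - s) * V ^ s) := by
  rw [← mul_smoothing_eq hT hV, smoothing_eq hT hV]
  set ρ := T / V
  have hρ0 : 0 < ρ := by linarith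
  have hδ : 0 < ρ ^ (-s) := Real.rpow_pos_of_pos hρ0 _
  have hq : 0 < ρ ^ (1 - s) := Real.rpow_pos_of_pos hρ0 _
  have hD0 : 0 < D := by linarith
  have h1 : 1 ≤ (ρ ^ (1 - s)) ^ (a / 2) * (ρ ^ (-s)) ^ 2 := by
    rw [← Real.rpow_natCast (ρ ^ (-s)) 2, ← Real.rpow_mul hρ0.le, ← Real.rpow_mul hρ0.le,
      ← Real.rpow_add hρ0]
    refine Real.one_le_rpow hρ.le ?_
    push_cast
    linarith
  have h2 : (ρ ^ (1 - s)) ^ (a / 2) ≤ 2 ^ (a / 2) * D ^ (a / 2) := by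
    rw [← Real.mul_rpow (by norm_num) hD0.le]
    exact Real.rpow_le_rpow hq.le (by linarith) (by linarith)
  have h3 : 0 < D ^ (a / 2) := Real.rpow_pos_of_pos hD0 _
  have e : T / D * D ^ (1 - a / 2) = T / D ^ (a / 2) := by
    rw [Real.rpow_sub hD0, Real.rpow_one]; field_simp
  rw [e, div_div, div_le_iff₀ (by positivity)]
  have h4 : 1 ≤ 2 ^ (a / 2) * D ^ (a / 2) * (ρ ^ (-s)) ^ 2 := h1.trans (by gcongr)
  calc T = T * 1 := (mul_one T).symm
    _ ≤ T * (2 ^ (a / 2) * D ^ (a / 2) * (ρ ^ (-s)) ^ 2) := by gcongr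
    _ = _ := by ring

end Tuning

/-- The constant of the regret bound. The absolute value only makes it positive for every `Dx`; an
admissible set forces `0 ≤ Dx`. -/
noncomputable def regretConstant (d : ℕ) (α U L₀ Dx r m c a : ℝ) : ℝ :=
  L₀ / α * (13 + |Dx| / r) + 16 * (d * U) ^ 2 / m + 8 * d * |Dx| * U * c * 2 ^ (a / 2) / α

lemma regretConstant_pos {d : ℕ} {α U L₀ Dx r m c a : ℝ} (hα : 0 < α) (hU : 0 < U) (hL : 0 < L₀)
    (hr : 0 < r) (hm : 0 < m) (hc : 0 < c) : 0 < regretConstant d α U L₀ Dx r m c a := by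
  unfold regretConstant
  positivity

/-- The regret bound for any smoothing exponent `s` that balances restarting and sampling against
smoothing: `δ = (V / T) ^ s`, `Δ ≈ (T / V) ^ (1 - s)`. -/
theorem regret_bound {d : ℕ} (hd : 0 < d) {α U L₀ Dx r m c a s : ℝ}
    (hα : 0 < α) (hα1 : α ≤ 1) (hU : 0 < U) (hL : 0 < L₀) (hr : 0 < r) (hm : 0 < m)
    (hc : 0 < c) (ha : 0 < a) (hs4 : s ≤ 1 / 4) (hsa : 4 * s ≤ (1 - s) * a)
    {Ξ : Type*} [MetricSpace Ξ] [MeasurableSpace Ξ] [BorelSpace Ξ]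
    {Ω : Type*} [MeasurableSpace Ω] {P : Measure Ω} [IsProbabilityMeasure P]
    {X : Set (Vec d)} {J : Vec d → Ξ → ℝ} {T : ℕ} {V : ℝ} {D : ℕ → Measure Ξ} {Δ : ℕ} {δ : ℝ}
    {φ : ℕ → ℕ} {x₀ : Vec d} {u : ℕ → Ω → UnitSphere d} {ξ : ℕ → ℕ → Ω → Ξ} {γ : ℝ}
    (hX : AdmissibleSet X r Dx) (hJ : AdmissibleCost X J U L₀ m)
    (hD : ∀ t, IsProbabilityMeasure (D t)) (hV : 0 < V)
    (hvar : distributionVariation D T ≤ ENNReal.ofReal V)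
    (hφ : SamplingRequirement φ Δ c a) (hδr : δ < r) (hx₀ : x₀ ∈ shrink X r δ)
    (hR : RandomInputs P D u ξ) (hγ : 0 < γ) (hγ1 : γ < 1)
    (hδ : δ = (V / T) ^ s) (hq : 1 < ((T : ℝ) / V) ^ (1 - s)) (hqT : ((T : ℝ) / V) ^ (1 - s) < T)
    (hΔ : IsRounding Δ (((T : ℝ) / V) ^ (1 - s))) :
    ENNReal.ofReal (1 - γ) ≤
      P {ω | (Params.mk X r α δ Δ φ (fun τ => 1 / (m * τ)) x₀).dynamicRegret J D T
          (fun t => (u t ω : Vec d)) (fun t i => ξ t i ω) ≤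
        regretConstant d α U L₀ Dx r m c a * Real.log (2 * T / γ) ^ 1 *
          ((T : ℝ) ^ (1 - s) * V ^ s)} := by
  set A : Params d := Params.mk X r α δ Δ φ (fun τ => 1 / (m * τ)) x₀ with hA
  obtain ⟨hΔ1, hΔT, hΔq, hΔq2⟩ := hΔ.bounds hq hqT
  have hT1 : (1 : ℝ) < T := hq.trans hqT
  have hT2 : (2 : ℝ) ≤ T := by
    have : 1 < T := by exact_mod_cast hT1
    exact_mod_cast this
  have hT0 : (0 : ℝ) < T := by linarith
  have hΔ0 : (0 : ℝ) < Δ := by exact_mod_cast hΔ1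
  have hδ0 : 0 < δ := hδ ▸ Real.rpow_pos_of_pos (div_pos hV hT0) s
  have hρ : 1 < (T : ℝ) / V := by
    by_contra! hle
    exact absurd (Real.rpow_le_one (by positivity) hle (by linarith : (0 : ℝ) ≤ 1 - s))
      (not_le.2 hq)
  have hrun : AdmissibleRun A J Dx U L₀ m :=
    ⟨hX, hJ, hr, hδ0, hδr, hα, hα1, hU, hL, hm, hΔ1, hφ.1, hx₀⟩
  -- the drift of the objectives
  set w : ℕ → ℝ := fun i => L₀ / α * (wasserstein (D i) (D (i + 1))).toReal with hw
  have hL0 : 0 < L₀ / α := div_pos hL hα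
  have hw0 : ∀ i, 0 ≤ w i := fun i => mul_nonneg hL0.le ENNReal.toReal_nonneg
  have hvar' : ∑ i ∈ Finset.Ico 1 T, wasserstein (D i) (D (i + 1)) ≤ ENNReal.ofReal V := by
    refine le_trans (le_of_eq ?_) hvar
    have := Finset.sum_Ico_add' (fun t => wasserstein (D (t - 1)) (D t)) 1 T 1
    simp only [Nat.add_sub_cancel] at this
    exact this
  have hfin : ∀ i ∈ Finset.Ico 1 T, wasserstein (D i) (D (i + 1)) ≠ ⊤ := fun i hi =>
    (((Finset.single_le_sum (f := fun i => wasserstein (D i) (D (i + 1)))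
      (fun _ _ => zero_le) hi).trans hvar').trans_lt ENNReal.ofReal_lt_top).ne
  have hwV : ∑ i ∈ Finset.Ico 1 T, w i ≤ L₀ / α * V := by
    rw [hw, ← Finset.mul_sum, ← ENNReal.toReal_sum hfin]
    gcongr
    exact ENNReal.toReal_le_of_le_ofReal hV.le hvar'
  have hdrift : ∀ i ∈ Finset.Ico 1 T, ∀ x ∈ A.X,
      |cvarCost A.α J (D i) x - cvarCost A.α J (D (i + 1)) x| ≤ w i := fun i hi x hx =>
    abs_cvarCost_sub_le_wasserstein hJ hL hα hα1 hx (hfin i hi)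
  refine (hrun.one_sub_le_linearized hd hR
    (y := fun t => AdmissibleRun.comparator A J D (batchStart A.Δ t))
    (fun t => (hrun.comparator_spec _).1) T hγ).trans (measure_mono fun ω hω => ?_)
  have hreg := hrun.dynamicRegret_le (u := fun t => u t ω) (ξ := fun t i => ξ t i ω)
    (fun τ => rfl) hw0 hdrift hω
  refine hreg.trans ?_
  change T * (L₀ / α * δ * (1 + Dx / r)) + 2 * (2 * (d / δ * U) ^ 2 / m * Real.log (1 / γ)) +
    2 * ∑ t ∈ Finset.Icc 1 T, (2 * (L₀ / α) * δ +
      d / δ * (Dx * (2 * U / α * (1 / √(φ (epoch Δ t)))))) +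
    (d / δ * U) ^ 2 / m * ∑ t ∈ Finset.Icc 1 T, 1 / (epoch Δ t : ℝ) +
    4 * (Δ * ∑ i ∈ Finset.Ico 1 T, w i) ≤ _
  -- the logarithmic factors
  set ℓ := Real.log (2 * T / γ) with hℓ
  have hℓT : Real.log T ≤ ℓ := Real.log_le_log hT0 (by rw [le_div_iff₀ hγ]; nlinarith)
  have hℓγ : Real.log (1 / γ) ≤ ℓ := Real.log_le_log (by positivity) (by gcongr; linarith)
  have hℓ1 : 1 ≤ ℓ := by
    rw [hℓ, Real.le_log_iff_exp_le (by positivity)]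
    refine Real.exp_one_lt_d9.le.trans ?_
    rw [le_div_iff₀ hγ]
    nlinarith
  have hℓΔ : 1 + Real.log Δ ≤ 2 * ℓ := by
    have : Real.log Δ ≤ Real.log T := Real.log_le_log hΔ0 (by exact_mod_cast hΔT)
    linarith
  -- the sums over the batches
  have hDx : 0 ≤ Dx := hrun.bound_nonneg
  have hsτ : ∑ t ∈ Finset.Icc 1 T, 1 / (epoch Δ t : ℝ) ≤ 2 * T / Δ * (2 * ℓ) := by
    refine (sum_epoch_le hΔ1 hΔT (f := fun τ => 1 / (τ : ℝ)) fun τ _ => by positivity).trans ?_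
    gcongr
    exact (sum_one_div_le Δ).trans hℓΔ
  have hsφ : ∑ t ∈ Finset.Icc 1 T, 1 / √(φ (epoch Δ t) : ℝ) ≤
      2 * T / Δ * (c * (Δ : ℝ) ^ (1 - a / 2)) := by
    refine (sum_epoch_le hΔ1 hΔT (f := fun τ => 1 / √(φ τ : ℝ)) fun τ _ => by positivity).trans ?_
    gcongr
    exact hφ.2
  -- every term is at most a multiple of `Q`
  set Q := (T : ℝ) ^ (1 - s) * V ^ s with hQ
  have hQ0 : 0 ≤ Q := by positivity
  have q1 : T * δ = Q := by rw [hδ, mul_smoothing_eq hT0 hV]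
  have q2 : Δ * V ≤ 2 * Q := by
    rw [hQ, ← batch_mul_eq hT0 hV, ← mul_assoc]
    gcongr
  have q3 : T / Δ / δ ^ 2 ≤ 2 * Q := by
    rw [hδ]; exact restart_le hT0 hV hρ hs4 hΔq
  have q4 : T / Δ * (Δ : ℝ) ^ (1 - a / 2) / δ ≤ 2 ^ (a / 2) * Q := by
    rw [hδ]; exact sampling_le hT0 hV hρ ha hsa hΔq
  have q5 : 1 / δ ^ 2 ≤ 2 * Q := by
    refine le_trans ?_ q3
    gcongr
    rw [one_le_div hΔ0]; exact_mod_cast hΔT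
  have t1 : T * (L₀ / α * δ * (1 + Dx / r)) = L₀ / α * (1 + Dx / r) * Q := by rw [← q1]; ring
  have t2 : 2 * (2 * (d / δ * U) ^ 2 / m * Real.log (1 / γ)) ≤ 8 * (d * U) ^ 2 / m * (Q * ℓ) := by
    have e : 2 * (2 * (d / δ * U) ^ 2 / m * Real.log (1 / γ)) =
        4 * (d * U) ^ 2 / m * (1 / δ ^ 2 * Real.log (1 / γ)) := by ring
    rw [e]
    calc _ ≤ 4 * (d * U) ^ 2 / m * (2 * Q * ℓ) := by
          refine mul_le_mul_of_nonneg_left ?_ (by positivity)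
          calc 1 / δ ^ 2 * Real.log (1 / γ) ≤ 1 / δ ^ 2 * ℓ := by gcongr
            _ ≤ 2 * Q * ℓ := by gcongr
      _ = _ := by ring
  have t3 : ∑ t ∈ Finset.Icc 1 T, (2 * (L₀ / α) * δ +
      d / δ * (Dx * (2 * U / α * (1 / √(φ (epoch Δ t)))))) ≤
      2 * (L₀ / α) * Q + 4 * d * Dx * U * c * 2 ^ (a / 2) / α * Q := by
    have e1 : ∀ t, d / δ * (Dx * (2 * U / α * (1 / √(φ (epoch Δ t) : ℝ)))) =
        2 * d * Dx * U / (α * δ) * (1 / √(φ (epoch Δ t) : ℝ)) := fun t => by ring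
    simp only [e1]
    rw [Finset.sum_add_distrib, Finset.sum_const, Nat.card_Icc, Nat.add_sub_cancel, nsmul_eq_mul,
      ← Finset.mul_sum]
    have e2 : T * (2 * (L₀ / α) * δ) = 2 * (L₀ / α) * Q := by rw [← q1]; ring
    rw [e2]
    refine add_le_add le_rfl ?_
    calc _ ≤ 2 * d * Dx * U / (α * δ) * (2 * T / Δ * (c * (Δ : ℝ) ^ (1 - a / 2))) :=
          mul_le_mul_of_nonneg_left hsφ (by positivity)
      _ = 4 * d * Dx * U * c / α * (T / Δ * (Δ : ℝ) ^ (1 - a / 2) / δ) := by ring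
      _ ≤ 4 * d * Dx * U * c / α * (2 ^ (a / 2) * Q) := by gcongr
      _ = _ := by ring
  have t4 : (d / δ * U) ^ 2 / m * ∑ t ∈ Finset.Icc 1 T, 1 / (epoch Δ t : ℝ) ≤
      8 * (d * U) ^ 2 / m * (Q * ℓ) := by
    calc _ ≤ (d / δ * U) ^ 2 / m * (2 * T / Δ * (2 * ℓ)) := by gcongr
      _ = 4 * (d * U) ^ 2 / m * ℓ * (T / Δ / δ ^ 2) := by ring
      _ ≤ 4 * (d * U) ^ 2 / m * ℓ * (2 * Q) := by gcongr
      _ = _ := by ring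
  have t5 : 4 * (Δ * ∑ i ∈ Finset.Ico 1 T, w i) ≤ 8 * (L₀ / α) * Q := by
    calc _ ≤ 4 * (Δ * (L₀ / α * V)) := by gcongr
      _ = 4 * (L₀ / α) * (Δ * V) := by ring
      _ ≤ 4 * (L₀ / α) * (2 * Q) := by gcongr
      _ = _ := by ring
  have hQℓ : Q ≤ Q * ℓ := le_mul_of_one_le_right hQ0 hℓ1
  have hcoef : 0 ≤ L₀ / α * (13 + Dx / r) + 8 * d * Dx * U * c * 2 ^ (a / 2) / α := by positivity
  have hfinal := mul_le_mul_of_nonneg_left hQℓ hcoef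
  rw [regretConstant, abs_of_nonneg hDx, pow_one]
  have e3 : (L₀ / α * (13 + Dx / r) + 16 * (d * U) ^ 2 / m +
      8 * d * Dx * U * c * 2 ^ (a / 2) / α) * ℓ * Q =
      (L₀ / α * (13 + Dx / r) + 8 * d * Dx * U * c * 2 ^ (a / 2) / α) * (Q * ℓ) +
        16 * (d * U) ^ 2 / m * (Q * ℓ) := by ring
  rw [e3]
  have e4 : 16 * (d * U) ^ 2 / m * (Q * ℓ) = 8 * (d * U) ^ 2 / m * (Q * ℓ) +
    8 * (d * U) ^ 2 / m * (Q * ℓ) := by ring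
  have e5 : (L₀ / α * (13 + Dx / r) + 8 * d * Dx * U * c * 2 ^ (a / 2) / α) * Q =
    L₀ / α * (1 + Dx / r) * Q + 2 * (2 * (L₀ / α) * Q + 4 * d * Dx * U * c * 2 ^ (a / 2) / α * Q) +
      8 * (L₀ / α) * Q := by ring
  rw [t1, e4]
  linarith

end RiskAverse

theorem theorem2 (d : ℕ) (hd : 0 < d) (α U L₀ Dx r m c a : ℝ)
    (hα : 0 < α) (hα1 : α ≤ 1) (hU : 0 < U) (hL : 0 < L₀) (hr : 0 < r) (hm : 0 < m)
    (hc : 0 < c) (ha : 0 < a) :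
    -- the constants hidden in the order notation
    ∃ (K : ℝ) (p : ℕ), 0 < K ∧
      ∀ (Ξ : Type*) [MetricSpace Ξ] [MeasurableSpace Ξ] [BorelSpace Ξ]
        (Ω : Type*) [MeasurableSpace Ω] (P : Measure Ω) [IsProbabilityMeasure P]
        (X : Set (RiskAverse.Vec d)) (J : RiskAverse.Vec d → Ξ → ℝ)
        (T : ℕ) (V : ℝ) (D : ℕ → Measure Ξ) (Δ : ℕ) (δ : ℝ) (φ : ℕ → ℕ) (x₀ : RiskAverse.Vec d)
        (u : ℕ → Ω → RiskAverse.UnitSphere d) (ξ : ℕ → ℕ → Ω → Ξ) (γ : ℝ),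
        RiskAverse.AdmissibleSet X r Dx →
        RiskAverse.AdmissibleCost X J U L₀ m →
        (∀ t, IsProbabilityMeasure (D t)) →
        0 < V →
        RiskAverse.distributionVariation D T ≤ ENNReal.ofReal V →
        RiskAverse.SamplingRequirement φ Δ c a →
        δ < r →
        x₀ ∈ RiskAverse.shrink X r δ →
        RiskAverse.RandomInputs P D u ξ →
        0 < γ → γ < 1 →
        (a ≤ 4 / 3 →
          δ = (V / T) ^ (a / (4 + a)) →
          1 < ((T : ℝ) / V) ^ (4 / (4 + a)) → ((T : ℝ) / V) ^ (4 / (4 + a)) < T →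
          RiskAverse.IsRounding Δ (((T : ℝ) / V) ^ (4 / (4 + a))) →
          ENNReal.ofReal (1 - γ) ≤
            P {ω | (RiskAverse.Params.mk X r α δ Δ φ (fun τ => 1 / (m * τ)) x₀).dynamicRegret J D T
                (fun t => (u t ω : RiskAverse.Vec d)) (fun t i => ξ t i ω) ≤
              K * Real.log (2 * T / γ) ^ p * ((T : ℝ) ^ (4 / (4 + a)) * V ^ (a / (4 + a)))}) ∧
        (4 / 3 < a →
          δ = (V / T) ^ (1 / 4 : ℝ) →
          1 < ((T : ℝ) / V) ^ (3 / 4 : ℝ) → ((T : ℝ) / V) ^ (3 / 4 : ℝ) < T →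
          RiskAverse.IsRounding Δ (((T : ℝ) / V) ^ (3 / 4 : ℝ)) →
          ENNReal.ofReal (1 - γ) ≤
            P {ω | (RiskAverse.Params.mk X r α δ Δ φ (fun τ => 1 / (m * τ)) x₀).dynamicRegret J D T
                (fun t => (u t ω : RiskAverse.Vec d)) (fun t i => ξ t i ω) ≤
              K * Real.log (2 * T / γ) ^ p * ((T : ℝ) ^ (3 / 4 : ℝ) * V ^ (1 / 4 : ℝ))})
    := by
  have h4a : 4 + a ≠ 0 := by positivity
  have e1 : (1 : ℝ) - a / (4 + a) = 4 / (4 + a) := by field_simp; ring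
  have e2 : (1 : ℝ) - 1 / 4 = 3 / 4 := by norm_num
  refine ⟨RiskAverse.regretConstant d α U L₀ Dx r m c a, 1,
    RiskAverse.regretConstant_pos hα hU hL hr hm hc, ?_⟩
  intro Ξ _ _ _ Ω _ P _ X J T V D Δ δ φ x₀ u ξ γ hX hJ hD hV hvar hφ hδr hx₀ hR hγ hγ1
  constructor
  · intro ha43 hδ hq hqT hΔ
    have hs4 : a / (4 + a) ≤ 1 / 4 := by
      rw [div_le_div_iff₀ (by positivity) (by norm_num)]; linarith
    have hsa : 4 * (a / (4 + a)) ≤ (1 - a / (4 + a)) * a := by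
      rw [e1]; exact le_of_eq (by ring)
    rw [← e1] at hq hqT hΔ ⊢
    exact RiskAverse.regret_bound hd hα hα1 hU hL hr hm hc ha hs4 hsa hX hJ hD hV hvar hφ hδr hx₀
      hR hγ hγ1 hδ hq hqT hΔ
  · intro ha43 hδ hq hqT hΔ
    rw [← e2] at hq hqT hΔ ⊢
    exact RiskAverse.regret_bound hd hα hα1 hU hL hr hm hc ha le_rfl (by linarith) hX hJ hD hV hvar
      hφ hδr hx₀ hR hγ hγ1 hδ hq hqT hΔ
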